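/- **Theorem.** Let $a<b$ and $\mu>0$. Let $u_0,u_1\in H^2(a,b)\cap H^1_0(a,b)$ and $\theta_0\in H^3(a,b)$ with $\theta_0\ge 0$. For $\nu>0$ consider the viscous problem $$u_{tt}-u_{xx}-\nu u_{txx}=-\mu\theta_x,\qquad \theta_t-\theta_{xx}+\mu\theta u_{tx}=0,\qquad \theta\ge 0\qquad\text{in }(0,T)\times(a,b),$$ with $u=0$ and $\theta_x=0$ at $x=a,b$, and $u(0)=u_0$, $u_t(0)=u_1$, $\theta(0)=\theta_0$. A *regular solution on $(0,T)$* is a pair $(u,\theta)$ with $$u\in W^{2,\infty}(0,T;L^2)\cap H^2(0,T;H^1),\quad u,u_t\in H^1_0(a,b)\ \text{for a.e. }t,\qquad \theta\in H^2(0,T;L^2)\cap L^2(0,T;H^3),\quad \theta\ge0,$$ attaining the initial data in $C([0,T];L^2(a,b))$ and satisfying, for a.e. $t\in(0,T)$, all $v\in H^1_0(a,b)$ and all $\psi\in H^1(a,b)$, $$\int_a^b u_{tt}v+\int_a^b u_xv_x+\nu\int_a^b u_{tx}v_x+\mu\int_a^b\theta_xv=0,\qquad \int_a^b\theta_t\psi+\int_a^b\theta_x\psi_x+\mu\int_a^b\theta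 u_{tx}\psi=0 .$$ Then there are $T_0>0$ and $C>0$, which may depend on $a,b,\mu,u_0,u_1,\theta_0$ but not on $\nu$, such that for every $\nu>0$, every $T\ge T_0$ and every regular solution $(u,\theta)$ on $(0,T)$ the following holds. The functions $u_{tt},u_{tx},\theta_t$ have representatives in $C([0,T];L^2(a,b))$; put $$R:=\|u_{tt}(0)\|_{L^2(a,b)}+\|u_{tx}(0)\|_{L^2(a,b)}+\|\theta_t(0)\|_{L^2(a,b)} .$$ Moreover $u\in W^{2,\infty}(0,T_0;L^2)\cap W^{1,\infty}(0,T_0;H^1)\cap L^\infty(0,T_0;H^2)$, $\theta\in W^{1,\infty}(0,T_0;L^2)\cap H^1(0,T_0;H^1)$, and $$\|u\|_{W^{2,\infty}(0,T_0;L^2)}+\|u\|_{W^{1,\infty}(0,T_0;H^1)}+\|u\|_{L^\infty(0,T_0;H^2)}\le C\,R ,$$ and, unless $u_0=u_1=0$ and $\theta_0$ is a positive constant, $$\|\theta\|_{W^{1,\infty}(0,T_0;L^2)}+\|\theta\|_{H^1(0,T_0;H^1)}\le C\,R .$$ -/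

import Mathlib

open MeasureTheory Set Filter Topology
open scoped ENNReal ContDiff

noncomputable section

namespace Thermo

/-- Test functions on the open interval `(c, d)`. -/
def IsTest (c d : ℝ) (φ : ℝ → ℝ) : Prop :=
  ContDiff ℝ ∞ φ ∧ HasCompactSupport φ ∧ tsupport φ ⊆ Ioo c d

/-- `g` is the weak derivative of `f` on `(c, d)`; both are locally integrable functions with
values in a normed space (`ℝ` for derivatives in space, `L²(a,b)` for derivatives in time). -/
def IsWeakDeriv {E : Type*} [NormedAddCommGroup E] [NormedSpace ℝ E]
    (c d : ℝ) (f g : ℝ → E) : Prop :=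
  LocallyIntegrableOn f (Ioo c d) ∧ LocallyIntegrableOn g (Ioo c d) ∧
    ∀ φ : ℝ → ℝ, IsTest c d φ →
      ∫ t in Ioo c d, deriv φ t • f t = -∫ t in Ioo c d, φ t • g t

/-- Weak derivatives are unique almost everywhere. -/
theorem IsWeakDeriv.unique {E : Type*} [NormedAddCommGroup E] [NormedSpace ℝ E]
    [CompleteSpace E] {c d : ℝ} {f g h : ℝ → E}
    (hg : IsWeakDeriv c d f g) (hh : IsWeakDeriv c d f h) :
    g =ᵐ[volume.restrict (Ioo c d)] h := by
  obtain ⟨-, hg1, hg2⟩ := hg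
  obtain ⟨-, hh1, hh2⟩ := hh
  have key : ∀ᵐ x ∂(volume : Measure ℝ), x ∈ Ioo c d → (g - h) x = 0 := by
    refine isOpen_Ioo.ae_eq_zero_of_integral_contDiff_smul_eq_zero (hg1.sub hh1) ?_
    intro φ hφ hc hs
    have int : ∀ k : ℝ → E, LocallyIntegrableOn k (Ioo c d) →
        Integrable (fun x => φ x • k x) := by
      intro k hk
      have h1 : IntegrableOn k (tsupport φ) := hk.integrableOn_compact_subset hs hc
      have h2 : IntegrableOn (fun x => φ x • k x) (tsupport φ) :=
        h1.continuousOn_smul hφ.continuous.continuousOn hc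
      refine (integrableOn_iff_integrable_of_support_subset ?_).1 h2
      intro x hx
      refine subset_tsupport φ ?_
      simp only [Function.mem_support, ne_eq] at hx ⊢
      exact fun h0 => hx (by simp [h0])
    have e : ∀ k : ℝ → E, ∫ x in Ioo c d, φ x • k x = ∫ x, φ x • k x := by
      intro k
      refine setIntegral_eq_integral_of_forall_compl_eq_zero ?_
      intro x hx
      have : φ x = 0 := by
        by_contra h0
        exact hx (hs (subset_tsupport φ h0))
      simp [this]
    have h3 := (hg2 φ ⟨hφ, hc, hs⟩).symm.trans (hh2 φ ⟨hφ, hc, hs⟩)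
    rw [neg_inj, e, e] at h3
    simp only [Pi.sub_apply, smul_sub]
    rw [integral_sub (int g hg1) (int h hh1), h3, sub_self]
  rw [EventuallyEq, ae_restrict_iff' measurableSet_Ioo]
  filter_upwards [key] with x hx hm
  exact sub_eq_zero.1 (hx hm)

/-- The Hilbert space `L²(a,b)`. -/
abbrev L2 (a b : ℝ) : Type := Lp ℝ 2 (volume.restrict (Ioo a b))

open Classical in
/-- The weak derivative in space `f_x ∈ L²(a,b)` of `f ∈ L²(a,b)` (`0` if there is none). -/
def weakDx {a b : ℝ} (f : L2 a b) : L2 a b :=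
  if h : ∃ g : L2 a b, IsWeakDeriv a b f g then h.choose else 0

/-- `weakDx` is the weak derivative whenever there is one. -/
theorem weakDx_eq {a b : ℝ} {f g : L2 a b} (h : IsWeakDeriv a b f g) : weakDx f = g := by
  have h' : ∃ g : L2 a b, IsWeakDeriv a b f g := ⟨g, h⟩
  rw [weakDx, dif_pos h']
  exact Lp.ext (h'.choose_spec.unique h)

/-- `f ∈ H^k(a,b)`. -/
def MemH {a b : ℝ} : ℕ → L2 a b → Prop
  | 0, _ => True
  | k + 1, f => (∃ g : L2 a b, IsWeakDeriv a b f g) ∧ MemH k (weakDx f)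

/-- The norm of `H^k(a,b)`. -/
def hNorm {a b : ℝ} (k : ℕ) (f : L2 a b) : ℝ :=
  √(∑ j ∈ Finset.range (k + 1), ‖weakDx^[j] f‖ ^ 2)

/-- `f ∈ H^1_0(a,b)`: the closure of the test functions in `H^1(a,b)`. -/
def MemH10 {a b : ℝ} (f : L2 a b) : Prop :=
  MemH 1 f ∧ ∀ ε : ℝ, 0 < ε → ∃ φ : ℝ → ℝ, IsTest a b φ ∧
    eLpNorm (fun x => f x - φ x) 2 (volume.restrict (Ioo a b)) ≤ ENNReal.ofReal ε ∧
    eLpNorm (fun x => weakDx f x - deriv φ x) 2 (volume.restrict (Ioo a b)) ≤ ENNReal.ofReal ε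

open Classical in
/-- The weak derivative in time on `(0,T)` of a curve in `L²(a,b)` (determined a.e. on `(0,T)`;
`0` if there is none). -/
def weakDt {a b : ℝ} (T : ℝ) (f : ℝ → L2 a b) : ℝ → L2 a b :=
  if h : ∃ g : ℝ → L2 a b, IsWeakDeriv 0 T f g then h.choose else 0

/-- `f ∈ L^p(0,T; H^k(a,b))`. -/
def MemLpH {a b : ℝ} (T : ℝ) (p : ℝ≥0∞) (k : ℕ) (f : ℝ → L2 a b) : Prop :=
  (∀ᵐ t ∂volume.restrict (Ioo 0 T), MemH k (f t)) ∧
    ∀ j ≤ k, MemLp (fun t => weakDx^[j] (f t)) p (volume.restrict (Ioo 0 T))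

/-- `f ∈ W^{m,p}(0,T; H^k(a,b))`. -/
def MemW {a b : ℝ} (T : ℝ) (m : ℕ) (p : ℝ≥0∞) (k : ℕ) (f : ℝ → L2 a b) : Prop :=
  (∀ i < m, ∃ g : ℝ → L2 a b, IsWeakDeriv 0 T ((weakDt T)^[i] f) g) ∧
    ∀ i ≤ m, MemLpH T p k ((weakDt T)^[i] f)

/-- The norm of `W^{m,p}(0,T; H^k(a,b))`, as the sum of the norms of the time derivatives in
`L^p(0,T; H^k(a,b))`. -/
def wNorm {a b : ℝ} (T : ℝ) (m : ℕ) (p : ℝ≥0∞) (k : ℕ) (f : ℝ → L2 a b) : ℝ≥0∞ :=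
  ∑ i ∈ Finset.range (m + 1),
    eLpNorm (fun t => hNorm k ((weakDt T)^[i] f t)) p (volume.restrict (Ioo 0 T))

/-- `f(0) = f₀`: the curve `f`, given almost everywhere on `(0,T)`, has a representative in
`C([0,T]; L²(a,b))` whose value at time `0` is `f₀`. -/
def HasInitialValue {a b : ℝ} (T : ℝ) (f : ℝ → L2 a b) (f₀ : L2 a b) : Prop :=
  ∃ g : ℝ → L2 a b, ContinuousOn g (Icc 0 T) ∧
    g =ᵐ[volume.restrict (Ioo 0 T)] f ∧ g 0 = f₀

/-- `(u, θ)` is a regular solution on `(0,T) × (a,b)` of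
`u_tt - u_xx - ν u_txx = -μ θ_x`, `θ_t - θ_xx + μ θ u_tx = 0`, `θ ≥ 0`, with
`u = 0` and `θ_x = 0` at the end points and initial data `u₀, u₁, θ₀`: a weak solution with
`u ∈ W^{2,∞}(0,T;L²) ∩ H²(0,T;H¹)` and `θ ∈ H²(0,T;L²) ∩ L²(0,T;H³)`. As `u_tt(t)` lies in
`L²(a,b)`, its duality pairing with `v ∈ H^1_0(a,b)` is the inner product of `L²(a,b)`. -/
structure IsRegularSolution {a b : ℝ} (T ν μ : ℝ) (u₀ u₁ θ₀ : L2 a b)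
    (u θ : ℝ → L2 a b) : Prop where
  u_memW2 : MemW T 2 ∞ 0 u
  u_memH2 : MemW T 2 2 1 u
  u_bdry : ∀ᵐ t ∂volume.restrict (Ioo 0 T), MemH10 (u t)
  ut_bdry : ∀ᵐ t ∂volume.restrict (Ioo 0 T), MemH10 (weakDt T u t)
  θ_memH2 : MemW T 2 2 0 θ
  θ_memL2 : MemW T 0 2 3 θ
  θ_nonneg : ∀ᵐ t ∂volume.restrict (Ioo 0 T), 0 ≤ θ t
  momentum : ∀ᵐ t ∂volume.restrict (Ioo 0 T), ∀ v : L2 a b, MemH10 v →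
    inner ℝ ((weakDt T)^[2] u t) v + inner ℝ (weakDx (u t)) (weakDx v)
      + ν * inner ℝ (weakDx (weakDt T u t)) (weakDx v) + μ * inner ℝ (weakDx (θ t)) v = 0
  heat : ∀ᵐ t ∂volume.restrict (Ioo 0 T), ∀ ψ : L2 a b, MemH 1 ψ →
    inner ℝ (weakDt T θ t) ψ + inner ℝ (weakDx (θ t)) (weakDx ψ)
      + μ * ∫ x in Ioo a b, θ t x * weakDx (weakDt T u t) x * ψ x = 0
  u_init : HasInitialValue T u u₀
  ut_init : HasInitialValue T (weakDt T u) u₁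
  θ_init : HasInitialValue T θ θ₀

end Thermo

end

noncomputable section

namespace Thermo

/-! ### Primitives of integrable functions -/

section Prim

variable {E F G : Type*} [NormedAddCommGroup E] [NormedSpace ℝ E]
  [NormedAddCommGroup F] [NormedSpace ℝ F] [NormedAddCommGroup G] [NormedSpace ℝ G]

/-! Everything is controlled by the energy of the time-differentiated system, `‖u_tt‖² + ‖u_tx‖² +
‖θ_t‖²`. When the differentiated equations are tested with `u_tt` and `θ_t`, the dangerous term is
`∫ θ u_ttx θ_t`. Since `u_tt` vanishes at the end points, an integration by parts moves the space
derivative to `θ θ_t`; the embedding `H¹ ⊂ L^∞` and Young's inequality then leave a growth rate `C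
(1 + ‖u_tx‖² + ‖θ‖² + ‖θ_x‖²)` with `C` independent of `ν` (`growth_algebra`). By
`StrongSol.theta_le` the last two terms are controlled by `∫ ‖u_tx‖²`, and hence so is the growth of
the energy. The regularity does not allow a direct differentiation, so the estimate is made for
difference quotients (`StrongSol.quotEnergy_le`) and passed to the limit
(`StrongSol.derivEnergy_le`, `StrongSol.lintegral_theta_tx_le`). This requires `u_tt` to be
continuous in time, which follows from a Cauchy estimate for slopes (`slope_cauchy_of_momentum`).

What remains is a bound of `∫ ‖u_tx‖²` on a time interval independent of `ν`
(`StrongSol.integral_Vx_le`). For `ν ≥ 1` the basic energy law, with its dissipation `ν ‖u_tx‖²`,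
suffices. For `ν < 1` the equations at `t = 0` bound the initial differentiated energy by the data,
uniformly in `ν`, and a continuity argument keeps `∫ ‖u_tx‖²` bounded for a short time.

The differentiated energy bounds `u_tt, u_tx, θ_t` by multiples of `R`. The heat equation then gives
`θ_x`, and `u_xx` is recovered from `u_x + ν u_tx` by an integrating factor whose normalised kernel
has mass less than one for every `ν` (`StrongSol.exists_hasDx_Ux`). These bounds also contain norms
of the data, and the one for `θ_x` is only of order `√R` for small `R`. Both defects are cured by a
positive lower bound of `R`, uniform in `ν` (`exists_pos_le_initial`), valid unless `u₀ = u₁ = 0`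
and `θ₀` is constant. In that exceptional case `R = 0` and all bounds for `u` are zero; the bound
for `θ` is needed only for `θ₀ = 0`, where it is zero too. -/

/-- On `[c, d]` the function `f` is a primitive of the integrable function `g`. -/
def IsPrim (c d : ℝ) (f g : ℝ → E) : Prop :=
  IntervalIntegrable g volume c d ∧ ∀ t ∈ Icc c d, f t = f c + ∫ s in c..t, g s

theorem IsPrim.intervalIntegrable {c d : ℝ} {f g : ℝ → E} (h : IsPrim c d f g) {s t : ℝ}
    (hs : s ∈ Icc c d) (ht : t ∈ Icc c d) : IntervalIntegrable g volume s t := by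
  refine h.1.mono_set ?_
  rw [uIcc_of_le (hs.1.trans hs.2)]
  exact uIcc_subset_Icc hs ht

theorem IsPrim.sub_eq {c d : ℝ} {f g : ℝ → E} (h : IsPrim c d f g) {s t : ℝ}
    (hs : s ∈ Icc c d) (ht : t ∈ Icc c d) : f t - f s = ∫ r in s..t, g r := by
  have hc : c ∈ Icc c d := ⟨le_rfl, hs.1.trans hs.2⟩
  rw [h.2 t ht, h.2 s hs, add_sub_add_left_eq_sub,
    intervalIntegral.integral_interval_sub_left (h.intervalIntegrable hc ht)
      (h.intervalIntegrable hc hs)]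

theorem IsPrim.mono {c d c' d' : ℝ} {f g : ℝ → E} (h : IsPrim c d f g) (hc : c ≤ c')
    (hd : d' ≤ d) (hcd : c' ≤ d') : IsPrim c' d' f g := by
  have h1 : c' ∈ Icc c d := ⟨hc, hcd.trans hd⟩
  refine ⟨h.intervalIntegrable h1 ⟨hc.trans hcd, hd⟩, fun t ht => ?_⟩
  rw [← h.sub_eq h1 ⟨hc.trans ht.1, ht.2.trans hd⟩]
  abel

theorem IsPrim.congr {c d : ℝ} {f g f' g' : ℝ → E} (h : IsPrim c d f g) (hcd : c ≤ d)
    (hf : ∀ t ∈ Icc c d, f' t = f t) (hg : g' =ᵐ[volume.restrict (Ioo c d)] g) :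
    IsPrim c d f' g' := by
  have hg' : g' =ᵐ[volume.restrict (Ioc c d)] g := by
    rwa [← restrict_Ioo_eq_restrict_Ioc]
  refine ⟨h.1.congr_ae (by rw [uIoc_of_le hcd]; exact hg'.symm), fun t ht => ?_⟩
  rw [hf t ht, hf c ⟨le_rfl, hcd⟩, h.2 t ht]
  congr 1
  refine intervalIntegral.integral_congr_ae ?_
  rw [uIoc_of_le ht.1]
  have := (ae_restrict_iff' measurableSet_Ioc).1 hg'
  filter_upwards [this] with x hx hxt
  exact (hx ⟨hxt.1, hxt.2.trans ht.2⟩).symm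

theorem IsPrim.continuousOn {c d : ℝ} {f g : ℝ → E} (h : IsPrim c d f g) :
    ContinuousOn f (Icc c d) := by
  rcases lt_or_ge d c with hcd | hcd
  · rw [Icc_eq_empty (not_le.2 hcd)]; exact continuousOn_empty _
  have h1 : IntegrableOn g (Icc c d) := (intervalIntegrable_iff_integrableOn_Icc_of_le hcd).1 h.1
  have h2 := intervalIntegral.continuousOn_primitive_interval (μ := volume) (f := g) (a := c)
    (b := d) (by rwa [uIcc_of_le hcd])
  rw [uIcc_of_le hcd] at h2
  exact (continuousOn_const.add h2).congr h.2

theorem isPrim_integral {c d : ℝ} {g : ℝ → E} (h : IntervalIntegrable g volume c d) (x : E) :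
    IsPrim c d (fun t => x + ∫ s in c..t, g s) g :=
  ⟨h, fun t _ => by simp⟩

theorem IsPrim.add {c d : ℝ} {f g f' g' : ℝ → E} (h : IsPrim c d f g) (h' : IsPrim c d f' g') :
    IsPrim c d (fun t => f t + f' t) (fun t => g t + g' t) := by
  refine ⟨h.1.add h'.1, fun t ht => ?_⟩
  have hc : c ∈ Icc c d := ⟨le_rfl, ht.1.trans ht.2⟩
  rw [intervalIntegral.integral_add (h.intervalIntegrable hc ht) (h'.intervalIntegrable hc ht)]
  simp only [h.2 t ht, h'.2 t ht]
  abel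

theorem IsPrim.const_smul {c d : ℝ} {f g : ℝ → E} (h : IsPrim c d f g) (r : ℝ) :
    IsPrim c d (fun t => r • f t) (fun t => r • g t) := by
  refine ⟨h.1.smul r, fun t ht => ?_⟩
  rw [intervalIntegral.integral_smul]
  simp only [h.2 t ht, smul_add]

theorem IsPrim.sub {c d : ℝ} {f g f' g' : ℝ → E} (h : IsPrim c d f g) (h' : IsPrim c d f' g') :
    IsPrim c d (fun t => f t - f' t) (fun t => g t - g' t) := by
  have := h.add (h'.const_smul (-1))
  simpa [sub_eq_add_neg] using this

theorem isPrim_const (c d : ℝ) (x : E) : IsPrim c d (fun _ => x) (fun _ => 0) :=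
  ⟨IntervalIntegrable.zero, fun t _ => by simp⟩

theorem IsPrim.comp_add {c d : ℝ} {f g : ℝ → E} (h : IsPrim c d f g) (r : ℝ) :
    IsPrim (c - r) (d - r) (fun t => f (t + r)) (fun t => g (t + r)) := by
  refine ⟨h.1.comp_add_right r, fun t ht => ?_⟩
  simp only [sub_add_cancel, intervalIntegral.integral_comp_add_right]
  exact h.2 _ ⟨by linarith [ht.1], by linarith [ht.2]⟩

theorem IsPrim.ae_hasDerivAt [CompleteSpace E] {c d : ℝ} {f g : ℝ → E} (h : IsPrim c d f g) :
    ∀ᵐ t, t ∈ Ioo c d → HasDerivAt f (g t) t := by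
  filter_upwards [h.1.ae_hasDerivAt_integral] with t ht htm
  have hcd : c ≤ d := htm.1.le.trans htm.2.le
  have h1 := ht (by rw [uIcc_of_le hcd]; exact Ioo_subset_Icc_self htm) c
    (by rw [uIcc_of_le hcd]; exact ⟨le_rfl, hcd⟩)
  refine (h1.const_add (f c)).congr_of_eventuallyEq ?_
  filter_upwards [Ioo_mem_nhds htm.1 htm.2] with s hs
  exact h.2 s (Ioo_subset_Icc_self hs)

omit [NormedSpace ℝ E] [NormedSpace ℝ F] in
-- Absolute continuity only sees sums of increments, so it passes from a real majorant `N` to curves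
-- with values in any normed space.
theorem absolutelyContinuousOnInterval_of_dist_le {f : ℝ → E} {N : ℝ → F} {c d : ℝ}
    (hN : AbsolutelyContinuousOnInterval N c d)
    (h : ∀ s ∈ uIcc c d, ∀ t ∈ uIcc c d, dist (f s) (f t) ≤ dist (N s) (N t)) :
    AbsolutelyContinuousOnInterval f c d := by
  rw [absolutelyContinuousOnInterval_iff] at hN ⊢
  intro ε hε
  obtain ⟨δ, hδ, H⟩ := hN ε hε
  refine ⟨δ, hδ, fun I hI hI' => lt_of_le_of_lt (Finset.sum_le_sum fun i hi => ?_) (H I hI hI')⟩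
  exact h _ (hI.1 i hi).1 _ (hI.1 i hi).2

/-- The primitive of `‖g‖` dominates all increments of `f`. Monotone majorants can be added without
loss, which is what the product rule `IsPrim.bilin` needs. -/
theorem IsPrim.exists_bound {c d : ℝ} {f g : ℝ → E} (h : IsPrim c d f g) (hcd : c ≤ d) :
    ∃ N : ℝ → ℝ, AbsolutelyContinuousOnInterval N c d ∧ MonotoneOn N (Icc c d) ∧
      ∀ s ∈ uIcc c d, ∀ t ∈ uIcc c d, ‖f s - f t‖ ≤ |N s - N t| := by
  have key : ∀ s ∈ Icc c d, ∀ t ∈ Icc c d, s ≤ t →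
      ‖f t - f s‖ ≤ (∫ r in c..t, ‖g r‖) - ∫ r in c..s, ‖g r‖ := by
    intro s hs t ht hst
    have hc : c ∈ Icc c d := ⟨le_rfl, hcd⟩
    rw [h.sub_eq hs ht, intervalIntegral.integral_interval_sub_left
      (h.intervalIntegrable hc ht).norm (h.intervalIntegrable hc hs).norm]
    exact intervalIntegral.norm_integral_le_integral_norm hst
  refine ⟨fun t => ∫ s in c..t, ‖g s‖,
    h.1.norm.absolutelyContinuousOnInterval_intervalIntegral left_mem_uIcc,
    fun s hs t ht hst => ?_, ?_⟩
  · have := (norm_nonneg _).trans (key s hs t ht hst)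
    simpa using this
  rw [uIcc_of_le hcd]
  intro s hs t ht
  rcases le_total s t with hst | hst
  · rw [norm_sub_rev, abs_sub_comm]
    exact (key s hs t ht hst).trans (le_abs_self _)
  · exact (key t ht s hs hst).trans (le_abs_self _)

theorem IsPrim.absolutelyContinuous {c d : ℝ} {f g : ℝ → E} (h : IsPrim c d f g) (hcd : c ≤ d) :
    AbsolutelyContinuousOnInterval f c d := by
  obtain ⟨N, hN, -, h2⟩ := h.exists_bound hcd
  refine absolutelyContinuousOnInterval_of_dist_le hN fun s hs t ht => ?_
  rw [dist_eq_norm, Real.dist_eq]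
  exact h2 s hs t ht

/-- Subtracting the primitive of `g` leaves an absolutely continuous function with zero derivative
almost everywhere, hence a constant. -/
theorem isPrim_of_ae_hasDerivAt [CompleteSpace E] {c d : ℝ} {f g : ℝ → E} (hcd : c ≤ d)
    (hf : AbsolutelyContinuousOnInterval f c d) (hg : IntervalIntegrable g volume c d)
    (h : ∀ᵐ t, t ∈ Ioo c d → HasDerivAt f (g t) t) : IsPrim c d f g := by
  have hP := isPrim_integral hg (0 : E)
  have h1 : AbsolutelyContinuousOnInterval (f - fun t => 0 + ∫ s in c..t, g s) c d :=
    hf.sub (hP.absolutelyContinuous hcd)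
  have hc : ∀ᵐ t : ℝ, t ≠ c := by simp [ae_iff, measure_singleton]
  have hd : ∀ᵐ t : ℝ, t ≠ d := by simp [ae_iff, measure_singleton]
  obtain ⟨C, hC⟩ := h1.const_of_ae_hasDerivAt_zero (by
    filter_upwards [h, hP.ae_hasDerivAt, hc, hd] with t h1 h2 h3 h4 ht
    rw [uIcc_of_le hcd] at ht
    have ht' : t ∈ Ioo c d := ⟨lt_of_le_of_ne ht.1 (Ne.symm h3), lt_of_le_of_ne ht.2 h4⟩
    simpa using (h1 ht').sub (h2 ht'))
  rw [uIcc_of_le hcd] at hC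
  refine ⟨hg, fun t ht => ?_⟩
  have e1 := hC t ht
  have e2 := hC c ⟨le_rfl, hcd⟩
  simp only [Pi.sub_apply, zero_add, intervalIntegral.integral_same, sub_zero] at e1 e2
  rw [e2, ← e1, sub_add_cancel]

/-- The increment splits as `B (Δf) f' + B f (Δf')`, so a combination of the two majorants makes the
product absolutely continuous; its derivative is the expected one wherever both factors are
differentiable. Inner products, scalar multiples and pointwise products are all covered. -/
theorem IsPrim.bilin [CompleteSpace E] [CompleteSpace F] [CompleteSpace G] {c d : ℝ}
    {f g : ℝ → E} {f' g' : ℝ → F} (h : IsPrim c d f g)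
    (h' : IsPrim c d f' g') (hcd : c ≤ d) (B : E →L[ℝ] F →L[ℝ] G) :
    IsPrim c d (fun t => B (f t) (f' t)) (fun t => B (g t) (f' t) + B (f t) (g' t)) := by
  obtain ⟨N, hN, hNm, h1⟩ := h.exists_bound hcd
  obtain ⟨N', hN', hNm', h1'⟩ := h'.exists_bound hcd
  obtain ⟨M, hM⟩ := isCompact_Icc.exists_bound_of_continuousOn h.continuousOn
  obtain ⟨M', hM'⟩ := isCompact_Icc.exists_bound_of_continuousOn h'.continuousOn
  have hc : c ∈ Icc c d := ⟨le_rfl, hcd⟩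
  have hM0 : 0 ≤ M := (norm_nonneg _).trans (hM c hc)
  have hM0' : 0 ≤ M' := (norm_nonneg _).trans (hM' c hc)
  have hsum : AbsolutelyContinuousOnInterval
      ((fun t => (‖B‖ * M') * N t) + fun t => (‖B‖ * M) * N' t) c d :=
    (hN.const_mul (‖B‖ * M')).add (hN'.const_mul (‖B‖ * M))
  refine isPrim_of_ae_hasDerivAt hcd (absolutelyContinuousOnInterval_of_dist_le hsum ?_) ?_ ?_
  · have key : ∀ s ∈ Icc c d, ∀ t ∈ Icc c d, s ≤ t →
        dist (B (f s) (f' s)) (B (f t) (f' t)) ≤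
          dist ((‖B‖ * M') * N s + (‖B‖ * M) * N' s) ((‖B‖ * M') * N t + (‖B‖ * M) * N' t) := by
      intro s hs t ht hst
      have e1 := hNm hs ht hst
      have e2 := hNm' hs ht hst
      have b1 := h1 s (by rwa [uIcc_of_le hcd]) t (by rwa [uIcc_of_le hcd])
      have b2 := h1' s (by rwa [uIcc_of_le hcd]) t (by rwa [uIcc_of_le hcd])
      rw [abs_sub_comm, abs_of_nonneg (sub_nonneg.2 e1)] at b1
      rw [abs_sub_comm, abs_of_nonneg (sub_nonneg.2 e2)] at b2
      rw [dist_comm ((‖B‖ * M') * N s + _), Real.dist_eq, dist_eq_norm]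
      have e : B (f s) (f' s) - B (f t) (f' t) = B (f s - f t) (f' s) + B (f t) (f' s - f' t) := by
        simp
      rw [e]
      calc _ ≤ ‖B (f s - f t) (f' s)‖ + ‖B (f t) (f' s - f' t)‖ := norm_add_le _ _
        _ ≤ ‖B‖ * ‖f s - f t‖ * ‖f' s‖ + ‖B‖ * ‖f t‖ * ‖f' s - f' t‖ :=
          add_le_add (B.le_opNorm₂ _ _) (B.le_opNorm₂ _ _)
        _ ≤ ‖B‖ * (N t - N s) * M' + ‖B‖ * M * (N' t - N' s) := by
          have := hM' s hs
          have := hM t ht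
          have := norm_nonneg B
          have : 0 ≤ N t - N s := sub_nonneg.2 e1
          gcongr
        _ = (‖B‖ * M') * N t + (‖B‖ * M) * N' t - ((‖B‖ * M') * N s + (‖B‖ * M) * N' s) := by ring
        _ ≤ _ := le_abs_self _
    rw [uIcc_of_le hcd]
    intro s hs t ht
    rcases le_total s t with hst | hst
    · exact key s hs t ht hst
    · rw [dist_comm (B _ _), dist_comm (α := ℝ)]
      exact key t ht s hs hst
  · have i1 : IntegrableOn (fun t => B (g t) (f' t)) (Icc c d) := by
      have hg := (intervalIntegrable_iff_integrableOn_Icc_of_le hcd).1 h.1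
      refine Integrable.mono' (hg.norm.const_mul (‖B‖ * M')) ?_ ?_
      · exact B.aestronglyMeasurable_comp₂ hg.aestronglyMeasurable
          (h'.continuousOn.aestronglyMeasurable measurableSet_Icc)
      · filter_upwards [ae_restrict_mem measurableSet_Icc] with t ht
        calc _ ≤ ‖B‖ * ‖g t‖ * ‖f' t‖ := B.le_opNorm₂ _ _
          _ ≤ ‖B‖ * ‖g t‖ * M' := by gcongr; exact hM' t ht
          _ = _ := by ring
    have i2 : IntegrableOn (fun t => B (f t) (g' t)) (Icc c d) := by
      have hg := (intervalIntegrable_iff_integrableOn_Icc_of_le hcd).1 h'.1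
      refine Integrable.mono' (hg.norm.const_mul (‖B‖ * M)) ?_ ?_
      · exact B.aestronglyMeasurable_comp₂ (h.continuousOn.aestronglyMeasurable measurableSet_Icc)
          hg.aestronglyMeasurable
      · filter_upwards [ae_restrict_mem measurableSet_Icc] with t ht
        calc _ ≤ ‖B‖ * ‖f t‖ * ‖g' t‖ := B.le_opNorm₂ _ _
          _ ≤ ‖B‖ * M * ‖g' t‖ := by gcongr; exact hM t ht
          _ = _ := by ring
    exact (intervalIntegrable_iff_integrableOn_Icc_of_le hcd).2 (i1.add i2)
  · filter_upwards [h.ae_hasDerivAt, h'.ae_hasDerivAt] with t h2 h3 ht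
    have := B.hasFDerivAt_of_bilinear (h2 ht).hasFDerivAt (h3 ht).hasFDerivAt
    simpa [add_comm] using this.hasDerivAt

/-- The product `(C + ∫ k φ) exp (-∫ k)` has nonpositive derivative. The rate `k` is merely
integrable, so the argument runs through primitives rather than classical derivatives. -/
theorem gronwall_integral {c d C : ℝ} {φ k : ℝ → ℝ} (hcd : c ≤ d) (hφ : ContinuousOn φ (Icc c d))
    (hk : IntervalIntegrable k volume c d) (hk0 : ∀ᵐ t ∂volume.restrict (Ioo c d), 0 ≤ k t)
    (h : ∀ t ∈ Icc c d, φ t ≤ C + ∫ s in c..t, k s * φ s) {t : ℝ} (ht : t ∈ Icc c d) :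
    φ t ≤ C * Real.exp (∫ s in c..t, k s) := by
  have hk0' := (ae_restrict_iff' measurableSet_Ioo).1 hk0
  have hdn : ∀ᵐ t : ℝ, t ≠ d := by simp [ae_iff, measure_singleton]
  have hint : IntervalIntegrable (fun s => k s * φ s) volume c d :=
    hk.mul_continuousOn (by rwa [uIcc_of_le hcd])
  have hz := isPrim_integral hint C
  have hK := isPrim_integral hk (0 : ℝ)
  have hKnn : ∀ s ∈ Icc c d, 0 ≤ 0 + ∫ r in c..s, k r := by
    intro s hs
    rw [zero_add]
    refine intervalIntegral.integral_nonneg_of_ae_restrict hs.1 ?_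
    rw [← restrict_Ioo_eq_restrict_Icc]
    exact ae_restrict_of_ae_restrict_of_subset (Ioo_subset_Ioo_right hs.2) hk0
  have hexp : IsPrim c d (fun t => Real.exp (-(0 + ∫ r in c..t, k r)))
      (fun t => Real.exp (-(0 + ∫ r in c..t, k r)) * -k t) := by
    refine isPrim_of_ae_hasDerivAt hcd ?_ ?_ ?_
    · refine absolutelyContinuousOnInterval_of_dist_le (hK.absolutelyContinuous hcd) ?_
      rw [uIcc_of_le hcd]
      intro s hs t ht
      rw [Real.dist_eq, Real.dist_eq]
      -- `exp (-x)` is 1-Lipschitz on `[0, ∞)`, where the exponent stays because `k ≥ 0`; this makes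
      -- the integrating factor absolutely continuous.
      have key : ∀ x y : ℝ, 0 ≤ x → x ≤ y → |Real.exp (-x) - Real.exp (-y)| ≤ y - x := by
        intro x y hx hxy
        rw [abs_of_nonneg (sub_nonneg.2 (Real.exp_le_exp.2 (neg_le_neg hxy)))]
        have e1 : Real.exp (-y) = Real.exp (-x) * Real.exp (x - y) := by
          rw [← Real.exp_add]; congr 1; ring
        have e2 := Real.add_one_le_exp (x - y)
        have e3 : Real.exp (-x) ≤ 1 := Real.exp_le_one_iff.2 (neg_nonpos.2 hx)
        have e4 := Real.exp_pos (-x)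
        rw [e1]
        nlinarith
      rcases le_total (0 + ∫ r in c..s, k r) (0 + ∫ r in c..t, k r) with hst | hst
      · rw [abs_sub_comm (0 + ∫ r in c..s, k r)]
        exact (key _ _ (hKnn s hs) hst).trans (le_abs_self _)
      · rw [abs_sub_comm (Real.exp _)]
        exact (key _ _ (hKnn t ht) hst).trans (le_abs_self _)
    · refine IntervalIntegrable.continuousOn_mul hk.neg ?_
      rw [uIcc_of_le hcd]
      exact hK.continuousOn.neg.rexp
    · filter_upwards [hK.ae_hasDerivAt] with t ht htm
      exact (ht htm).neg.exp
  have hprod := hz.bilin hexp hcd (ContinuousLinearMap.mul ℝ ℝ)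
  have hc : c ∈ Icc c d := ⟨le_rfl, hcd⟩
  have hle : (C + ∫ s in c..t, k s * φ s) * Real.exp (-(0 + ∫ r in c..t, k r)) ≤ C := by
    have e := hprod.2 t ht
    simp only [ContinuousLinearMap.mul_apply', intervalIntegral.integral_same, add_zero,
      neg_zero, Real.exp_zero, mul_one] at e
    rw [e]
    have : (∫ s in c..t, (k s * φ s * Real.exp (-(0 + ∫ r in c..s, k r)) +
        (C + ∫ r in c..s, k r * φ r) * (Real.exp (-(0 + ∫ r in c..s, k r)) * -k s))) ≤ 0 := by
      have := intervalIntegral.integral_nonneg_of_ae_restrict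
        (f := fun s => -(k s * φ s * Real.exp (-(0 + ∫ r in c..s, k r)) +
        (C + ∫ r in c..s, k r * φ r) * (Real.exp (-(0 + ∫ r in c..s, k r)) * -k s))) (μ := volume)
        ht.1 (by
          rw [← restrict_Ioo_eq_restrict_Icc]
          filter_upwards [ae_restrict_of_ae_restrict_of_subset (Ioo_subset_Ioo_right ht.2) hk0,
            ae_restrict_mem measurableSet_Ioo] with s hs hsm
          have e1 := h s ⟨hsm.1.le, hsm.2.le.trans ht.2⟩
          have e2 := Real.exp_pos (-(0 + ∫ r in c..s, k r))
          have e3 := mul_nonneg (mul_nonneg hs e2.le) (sub_nonneg.2 e1)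
          simp only [Pi.zero_apply]
          nlinarith)
      rw [intervalIntegral.integral_neg] at this
      linarith
    linarith
  rw [Real.exp_neg, zero_add] at hle
  have hpos := Real.exp_pos (∫ r in c..t, k r)
  rw [← div_eq_mul_inv, div_le_iff₀ hpos] at hle
  exact (h t ht).trans hle

end Prim

/-! ### Weak derivatives of functions of one variable -/

section Weak

variable {E : Type*} [NormedAddCommGroup E] [NormedSpace ℝ E]

theorem IsTest.derivative {c d : ℝ} {φ : ℝ → ℝ} (h : IsTest c d φ) : IsTest c d (deriv φ) :=
  ⟨(contDiff_infty_iff_deriv.1 h.1).2, h.2.1.deriv,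
    (tsupport_deriv_subset).trans h.2.2⟩

theorem IsTest.eq_zero {c d : ℝ} {φ : ℝ → ℝ} (h : IsTest c d φ) {x : ℝ} (hx : x ∉ Ioo c d) :
    φ x = 0 := by
  by_contra h0
  exact hx (h.2.2 (subset_tsupport φ h0))

theorem IsTest.integrable_smul {c d : ℝ} {φ : ℝ → ℝ} (h : IsTest c d φ) {k : ℝ → E}
    (hk : LocallyIntegrableOn k (Ioo c d)) : Integrable (fun x => φ x • k x) := by
  have h1 : IntegrableOn k (tsupport φ) := hk.integrableOn_compact_subset h.2.2 h.2.1
  have h2 : IntegrableOn (fun x => φ x • k x) (tsupport φ) :=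
    h1.continuousOn_smul h.1.continuous.continuousOn h.2.1
  refine (integrableOn_iff_integrable_of_support_subset ?_).1 h2
  intro x hx
  refine subset_tsupport φ ?_
  simp only [Function.mem_support, ne_eq] at hx ⊢
  exact fun h0 => hx (by simp [h0])

theorem IsTest.setIntegral_smul {c d : ℝ} {φ : ℝ → ℝ} (h : IsTest c d φ) (k : ℝ → E) :
    ∫ x in Ioo c d, φ x • k x = ∫ x, φ x • k x := by
  refine setIntegral_eq_integral_of_forall_compl_eq_zero fun x hx => ?_
  simp [h.eq_zero hx]

theorem IsTest.add {c d : ℝ} {φ ψ : ℝ → ℝ} (h : IsTest c d φ) (h' : IsTest c d ψ) :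
    IsTest c d (φ + ψ) :=
  ⟨h.1.add h'.1, h.2.1.add h'.2.1, (tsupport_add φ ψ).trans (union_subset h.2.2 h'.2.2)⟩

theorem IsTest.const_mul {c d : ℝ} {φ : ℝ → ℝ} (h : IsTest c d φ) (r : ℝ) :
    IsTest c d (fun x => r * φ x) :=
  ⟨contDiff_const.mul h.1, h.2.1.mul_left,
    (closure_mono (fun _ hx => right_ne_zero_of_mul hx)).trans h.2.2⟩

theorem isPrim_of_contDiff {c d : ℝ} {φ : ℝ → ℝ} (h : ContDiff ℝ ∞ φ) :
    IsPrim c d φ (deriv φ) := by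
  have hd : Continuous (deriv φ) := (contDiff_infty_iff_deriv.1 h).2.continuous
  refine ⟨hd.intervalIntegrable _ _, fun t _ => ?_⟩
  rw [intervalIntegral.integral_deriv_eq_sub
    (fun x _ => (contDiff_infty_iff_deriv.1 h).1 x) (hd.intervalIntegrable _ _)]
  ring

theorem isPrim_test_smul [CompleteSpace E] {c d : ℝ} (hcd : c ≤ d) {f g : ℝ → E}
    (h : IsPrim c d f g) {φ : ℝ → ℝ} (hφ : IsTest c d φ) :
    ∫ t in Ioo c d, deriv φ t • f t = -∫ t in Ioo c d, φ t • g t := by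
  have h1 := (isPrim_of_contDiff (c := c) (d := d) hφ.1).bilin h hcd (ContinuousLinearMap.lsmul ℝ ℝ)
  have hf : LocallyIntegrableOn f (Ioo c d) :=
    ((h.continuousOn.integrableOn_Icc).mono_set Ioo_subset_Icc_self).locallyIntegrableOn
  have hg : LocallyIntegrableOn g (Ioo c d) :=
    (((intervalIntegrable_iff_integrableOn_Icc_of_le hcd).1 h.1).mono_set
      Ioo_subset_Icc_self).locallyIntegrableOn
  have h2 := h1.2 d ⟨hcd, le_rfl⟩
  simp only [ContinuousLinearMap.lsmul_apply, hφ.eq_zero (x := c) (by simp),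
    hφ.eq_zero (x := d) (by simp), zero_smul, zero_add] at h2
  rw [intervalIntegral.integral_of_le hcd, ← restrict_Ioo_eq_restrict_Ioc,
    integral_add (hφ.derivative.integrable_smul hf).integrableOn
      (hφ.integrable_smul hg).integrableOn] at h2
  exact eq_neg_of_add_eq_zero_left h2.symm

theorem IsPrim.isWeakDeriv [CompleteSpace E] {c d : ℝ} (hcd : c ≤ d) {f g : ℝ → E}
    (h : IsPrim c d f g) : IsWeakDeriv c d f g :=
  ⟨((h.continuousOn.integrableOn_Icc).mono_set Ioo_subset_Icc_self).locallyIntegrableOn,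
    (((intervalIntegrable_iff_integrableOn_Icc_of_le hcd).1 h.1).mono_set
      Ioo_subset_Icc_self).locallyIntegrableOn, fun _ hφ => isPrim_test_smul hcd h hφ⟩

theorem IsWeakDeriv.sub {c d : ℝ} {f g f' g' : ℝ → E} (h : IsWeakDeriv c d f g)
    (h' : IsWeakDeriv c d f' g') : IsWeakDeriv c d (f - f') (g - g') := by
  refine ⟨h.1.sub h'.1, h.2.1.sub h'.2.1, fun φ hφ => ?_⟩
  simp only [Pi.sub_apply, smul_sub]
  rw [integral_sub (hφ.derivative.integrable_smul h.1).integrableOn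
    (hφ.derivative.integrable_smul h'.1).integrableOn, integral_sub
    (hφ.integrable_smul h.2.1).integrableOn (hφ.integrable_smul h'.2.1).integrableOn,
    h.2.2 φ hφ, h'.2.2 φ hφ]
  abel

theorem IsWeakDeriv.congr {c d : ℝ} {f g f' g' : ℝ → E} (h : IsWeakDeriv c d f g)
    (hf : f =ᵐ[volume.restrict (Ioo c d)] f') (hg : g =ᵐ[volume.restrict (Ioo c d)] g') :
    IsWeakDeriv c d f' g' := by
  have key : ∀ {k k' : ℝ → E}, k =ᵐ[volume.restrict (Ioo c d)] k' →
      LocallyIntegrableOn k (Ioo c d) → LocallyIntegrableOn k' (Ioo c d) := by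
    intro k k' hk h
    rw [locallyIntegrableOn_iff isOpen_Ioo.isLocallyClosed] at h ⊢
    intro K hK hKc
    exact (h K hK hKc).congr (ae_restrict_of_ae_restrict_of_subset hK hk)
  refine ⟨key hf h.1, key hg h.2.1, fun φ hφ => ?_⟩
  have e1 : ∫ t in Ioo c d, deriv φ t • f' t = ∫ t in Ioo c d, deriv φ t • f t :=
    integral_congr_ae (hf.mono fun t ht => by simp only [ht])
  have e2 : ∫ t in Ioo c d, φ t • g' t = ∫ t in Ioo c d, φ t • g t :=
    integral_congr_ae (hg.mono fun t ht => by simp only [ht])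
  rw [e1, e2, h.2.2 φ hφ]

theorem exists_isTest_integral_eq_one {c d : ℝ} (hcd : c < d) :
    ∃ ψ : ℝ → ℝ, IsTest c d ψ ∧ ∫ x, ψ x = 1 := by
  let b : ContDiffBump ((c + d) / 2) := ⟨(d - c) / 8, (d - c) / 4, by linarith, by linarith⟩
  refine ⟨b.normed volume, ⟨b.contDiff_normed, b.hasCompactSupport_normed, ?_⟩,
    b.integral_normed⟩
  rw [b.tsupport_normed_eq, Real.closedBall_eq_Icc]
  exact Icc_subset_Ioo (by change c < (c + d) / 2 - (d - c) / 4; linarith)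
    (by change (c + d) / 2 + (d - c) / 4 < d; linarith)

/-- Take the integral of `χ` from `c`. It vanishes to the left of the support trivially and to the
right because the total integral is zero. -/
theorem IsTest.exists_primitive {c d : ℝ} {χ : ℝ → ℝ} (h : IsTest c d χ)
    (h0 : ∫ x, χ x = 0) : ∃ η : ℝ → ℝ, IsTest c d η ∧ deriv η = χ := by
  have hcont := h.1.continuous
  have hder : ∀ x, HasDerivAt (fun t => ∫ s in c..t, χ s) (χ x) x := fun x =>
    hcont.integral_hasStrictDerivAt c x |>.hasDerivAt
  have hd : deriv (fun t => ∫ s in c..t, χ s) = χ := funext fun x => (hder x).deriv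
  obtain ⟨α, β, hα, hβ, hs⟩ : ∃ α β, c < α ∧ β < d ∧ tsupport χ ⊆ Icc α β := by
    rcases (tsupport χ).eq_empty_or_nonempty with he | hne
    -- For an empty support any `α > c` and `β < d` will do; `Icc α β` may be empty.
    · exact ⟨c + 1, d - 1, by linarith, by linarith, by rw [he]; exact empty_subset _⟩
    · have hK : IsCompact (tsupport χ) := h.2.1
      obtain ⟨α, hα, hα'⟩ := hK.exists_isLeast hne
      obtain ⟨β, hβ, hβ'⟩ := hK.exists_isGreatest hne
      exact ⟨α, β, (h.2.2 hα).1, (h.2.2 hβ).2, fun x hx => ⟨hα' hx, hβ' hx⟩⟩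
  have hz : ∀ x, x ∉ Icc α β → χ x = 0 := fun x hx => by
    by_contra h1
    exact hx (hs (subset_tsupport χ h1))
  have hsup : tsupport (fun t => ∫ s in c..t, χ s) ⊆ Icc α β := by
    refine closure_minimal (fun t ht => ?_) isClosed_Icc
    by_contra hn
    apply ht
    rw [mem_Icc, not_and_or, not_le, not_le] at hn
    rcases hn with hn | hn
    · refine intervalIntegral.integral_zero_ae (ae_of_all _ fun s hs => hz s fun hs' => ?_)
      have := (hs.2.trans (max_le hα.le hn.le))
      have h2 : s < α := by
        rcases le_total c t with h1 | h1
        · rw [uIoc_of_le h1] at hs; linarith [hs.2]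
        · rw [uIoc_of_ge h1] at hs; linarith [hs.2]
      exact absurd hs'.1 (not_le.2 h2)
    · have hct : ∫ s in c..t, χ s = ∫ s, χ s := by
        refine intervalIntegral.integral_eq_integral_of_support_subset fun x hx => ?_
        have : x ∈ Icc α β := by
          by_contra h1
          exact hx (hz x h1)
        exact ⟨by linarith [this.1], by linarith [this.2]⟩
      exact hct.trans h0
  refine ⟨fun t => ∫ s in c..t, χ s, ⟨?_, ?_, ?_⟩, hd⟩
  · rw [contDiff_infty_iff_deriv, hd]
    exact ⟨fun x => (hder x).differentiableAt, h.1⟩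
  · exact isCompact_Icc.of_isClosed_subset (isClosed_tsupport _) hsup
  · exact hsup.trans (Icc_subset_Ioo hα hβ)

/-- A function with vanishing weak derivative is constant. -/
theorem IsWeakDeriv.ae_eq_const [CompleteSpace E] {c d : ℝ} (hcd : c < d) {f : ℝ → E}
    (h : IsWeakDeriv c d f 0) : ∃ x : E, f =ᵐ[volume.restrict (Ioo c d)] fun _ => x := by
  obtain ⟨ψ, hψ, hψ1⟩ := exists_isTest_integral_eq_one hcd
  refine ⟨∫ t, ψ t • f t, ?_⟩
  set x := ∫ t, ψ t • f t
  have hx : LocallyIntegrableOn (fun _ : ℝ => x) (Ioo c d) :=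
    (continuous_const.locallyIntegrable).locallyIntegrableOn _
  have key : ∀ᵐ t ∂(volume : Measure ℝ), t ∈ Ioo c d → (f - fun _ : ℝ => x) t = 0 := by
    refine isOpen_Ioo.ae_eq_zero_of_integral_contDiff_smul_eq_zero (h.1.sub hx) ?_
    intro φ hφ hc hs
    have hφt : IsTest c d φ := ⟨hφ, hc, hs⟩
    have hi : Integrable φ := hφ.continuous.integrable_of_hasCompactSupport hc
    have hψi : Integrable ψ := hψ.1.continuous.integrable_of_hasCompactSupport hψ.2.1
    -- Subtracting `(∫ φ) ψ` produces mean zero, hence the derivative of a test function, against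
    -- which `f` integrates to zero.
    have hχ := hφt.add (hψ.const_mul (-∫ t, φ t))
    obtain ⟨η, hη, hη'⟩ := hχ.exists_primitive (by
      simp only [Pi.add_apply]
      rw [integral_add hi (hψi.const_mul _), integral_const_mul, hψ1]
      ring)
    have h1 := h.2.2 η hη
    simp only [Pi.zero_apply, smul_zero, integral_zero, neg_zero] at h1
    rw [hη.derivative.setIntegral_smul, hη'] at h1
    simp only [Pi.add_apply, add_smul, mul_smul] at h1
    rw [integral_add (hφt.integrable_smul h.1)
      (Integrable.fun_smul (-∫ t, φ t) (hψ.integrable_smul h.1)), integral_smul, neg_smul] at h1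
    simp only [Pi.sub_apply, smul_sub]
    rw [integral_sub (hφt.integrable_smul h.1) (hφt.integrable_smul hx), integral_smul_const,
      sub_eq_add_neg]
    exact h1
  rw [EventuallyEq, ae_restrict_iff' measurableSet_Ioo]
  filter_upwards [key] with t ht hm
  exact sub_eq_zero.1 (ht hm)

/-- A function with an integrable weak derivative has a representative which is a primitive. -/
theorem IsWeakDeriv.exists_isPrim [CompleteSpace E] {c d : ℝ} (hcd : c < d) {f g : ℝ → E}
    (h : IsWeakDeriv c d f g) (hg : IntegrableOn g (Ioo c d)) :
    ∃ F : ℝ → E, IsPrim c d F g ∧ F =ᵐ[volume.restrict (Ioo c d)] f := by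
  have hi : IntervalIntegrable g volume c d :=
    (intervalIntegrable_iff_integrableOn_Ioo_of_le hcd.le).2 hg
  have h1 := (isPrim_integral hi (0 : E)).isWeakDeriv hcd.le
  have h2 := h.sub h1
  rw [sub_self] at h2
  obtain ⟨x, hx⟩ := h2.ae_eq_const hcd
  refine ⟨fun t => x + ∫ s in c..t, g s, isPrim_integral hi x, ?_⟩
  filter_upwards [hx] with t ht
  simp only [Pi.sub_apply, zero_add] at ht
  rw [← ht, sub_add_cancel]

end Weak

/-! ### Continuous functions agreeing almost everywhere -/

theorem eqOn_of_ae_eq {E : Type*} [TopologicalSpace E] [T2Space E] {c d : ℝ} (hcd : c < d)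
    {f g : ℝ → E} (hf : ContinuousOn f (Icc c d)) (hg : ContinuousOn g (Icc c d))
    (h : f =ᵐ[volume.restrict (Ioo c d)] g) : EqOn f g (Icc c d) := by
  have h1 : EqOn f g (Ioo c d) :=
    Measure.eqOn_open_of_ae_eq h isOpen_Ioo (hf.mono Ioo_subset_Icc_self)
      (hg.mono Ioo_subset_Icc_self)
  refine h1.of_subset_closure hf hg Ioo_subset_Icc_self ?_
  rw [closure_Ioo hcd.ne]

/-- A set of full measure is dense. Relations known for almost every time, such as the equations,
are carried in this way to every time, in particular to `t = 0`. -/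
theorem exists_seq_tendsto_of_ae {T : ℝ} {p : ℝ → Prop}
    (h : ∀ᵐ t ∂volume.restrict (Ioo 0 T), p t) {t : ℝ} (ht : t ∈ Icc 0 T) (hT : 0 < T) :
    ∃ s : ℕ → ℝ, (∀ n, s n ∈ Ioo 0 T ∧ p (s n)) ∧ Tendsto s atTop (𝓝 t) := by
  have hd : t ∈ closure {s | s ∈ Ioo 0 T ∧ p s} := by
    rw [Metric.mem_closure_iff]
    intro ε hε
    by_contra! hcon
    have h1 : ∀ s ∈ Ioo 0 T ∩ Ioo (t - ε) (t + ε), ¬ p s := by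
      intro s hs hp
      have := hcon s ⟨hs.1, hp⟩
      rw [Real.dist_eq] at this
      exact absurd this (not_le.2 (abs_lt.2 ⟨by linarith [hs.2.2], by linarith [hs.2.1]⟩))
    have h2 : volume (Ioo 0 T ∩ Ioo (t - ε) (t + ε)) = 0 := by
      refine measure_mono_null ?_ ((ae_restrict_iff' measurableSet_Ioo).1 h)
      intro s hs
      simp only [mem_compl_iff, mem_ofPred_eq, Classical.not_imp]
      exact ⟨hs.1, h1 s hs⟩
    rw [Ioo_inter_Ioo, Real.volume_Ioo, ENNReal.ofReal_eq_zero] at h2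
    have : max 0 (t - ε) < min T (t + ε) :=
      max_lt (lt_min hT (by linarith [ht.1])) (lt_min (by linarith [ht.2]) (by linarith))
    linarith
  obtain ⟨s, hs, hs'⟩ := mem_closure_iff_seq_limit.1 hd
  exact ⟨s, hs, hs'⟩

/-! ### Difference quotients -/

section Slope

variable {E : Type*} [NormedAddCommGroup E] [NormedSpace ℝ E]

theorem enorm_integral_sq_le {α : Type*} [MeasurableSpace α] {m : Measure α}
    [IsProbabilityMeasure m] {ψ : α → E} (h : AEStronglyMeasurable ψ m) :
    ‖∫ s, ψ s ∂m‖ₑ ^ 2 ≤ ∫⁻ s, ‖ψ s‖ₑ ^ 2 ∂m := by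
  have h1 : ‖∫ s, ψ s ∂m‖ₑ ≤ eLpNorm ψ 2 m := by
    refine (enorm_integral_le_lintegral_enorm ψ).trans ?_
    rw [← eLpNorm_one_eq_lintegral_enorm]
    exact eLpNorm_le_eLpNorm_of_exponent_le (by norm_num) h
  have h2 := eLpNorm_nnreal_pow_eq_lintegral (f := ψ) (μ := m) (p := 2) (by norm_num)
  have h3 : eLpNorm ψ 2 m ^ 2 = ∫⁻ s, ‖ψ s‖ₑ ^ 2 ∂m := by
    simpa using h2
  rw [← h3]
  gcongr

/-- The average equals `∫₀¹ ψ (t + h s) ds`; Jensen, Tonelli and translation invariance give the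
constant `1` for every step `h`. -/
theorem lintegral_enorm_average_sq_le {ψ : ℝ → E} (hψ : StronglyMeasurable ψ) {h : ℝ}
    (h0 : h ≠ 0) :
    ∫⁻ t, ‖h⁻¹ • ∫ s in t..t + h, ψ s‖ₑ ^ 2 ≤ ∫⁻ t, ‖ψ t‖ₑ ^ 2 := by
  have : IsProbabilityMeasure (volume.restrict (Ioc (0 : ℝ) 1)) := ⟨by simp⟩
  have e : ∀ t, h⁻¹ • ∫ s in t..t + h, ψ s = ∫ s in Ioc (0 : ℝ) 1, ψ (t + h * s) := by
    intro t
    rw [← intervalIntegral.integral_of_le zero_le_one, intervalIntegral.integral_comp_add_mul _ h0]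
    simp
  have hm : Measurable fun p : ℝ × ℝ => ‖ψ (p.1 + h * p.2)‖ₑ ^ 2 :=
    ((hψ.comp_measurable (by fun_prop :
      Measurable fun p : ℝ × ℝ => p.1 + h * p.2)).enorm).pow_const 2
  calc ∫⁻ t, ‖h⁻¹ • ∫ s in t..t + h, ψ s‖ₑ ^ 2
      ≤ ∫⁻ t, ∫⁻ s in Ioc (0 : ℝ) 1, ‖ψ (t + h * s)‖ₑ ^ 2 := by
        refine lintegral_mono fun t => ?_
        rw [e]
        exact enorm_integral_sq_le (hψ.comp_measurable (by fun_prop)).aestronglyMeasurable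
    _ = ∫⁻ s in Ioc (0 : ℝ) 1, ∫⁻ t, ‖ψ (t + h * s)‖ₑ ^ 2 :=
        lintegral_lintegral_swap hm.aemeasurable
    _ = ∫⁻ s in Ioc (0 : ℝ) 1, ∫⁻ t, ‖ψ t‖ₑ ^ 2 := by
        refine lintegral_congr fun s => ?_
        exact lintegral_add_right_eq_self (fun t => ‖ψ t‖ₑ ^ 2) (h * s)
    _ = ∫⁻ t, ‖ψ t‖ₑ ^ 2 := by simp

/-- Extend `ψ` by zero to the line. The conditions on the end points keep the interval between `t`
and `t + h` inside `[0, T]`, so the averages do not see the extension; the sign of `h` is free. -/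
theorem eLpNorm_average_le {ψ : ℝ → E} {T : ℝ} 
    (hψ : AEStronglyMeasurable ψ (volume.restrict (Ioo 0 T))) {h c d : ℝ} (h0 : h ≠ 0)
    (hc : c ∈ Icc 0 T) (hd : d ∈ Icc 0 T) (hch : c + h ∈ Icc 0 T) (hdh : d + h ∈ Icc 0 T) :
    eLpNorm (fun t => h⁻¹ • ∫ s in t..t + h, ψ s) 2 (volume.restrict (Ioo c d)) ≤
      eLpNorm ψ 2 (volume.restrict (Ioo 0 T)) := by
  set ψ' : ℝ → E := (Ioo 0 T).indicator (hψ.mk ψ)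
  have hm : StronglyMeasurable ψ' := hψ.stronglyMeasurable_mk.indicator measurableSet_Ioo
  have e1 : eLpNorm ψ 2 (volume.restrict (Ioo 0 T)) = eLpNorm ψ' 2 volume := by
    rw [eLpNorm_congr_ae hψ.ae_eq_mk]
    exact (eLpNorm_indicator_eq_eLpNorm_restrict measurableSet_Ioo).symm
  have e2 : ∀ᵐ s, s ∈ Ioo 0 T → ψ s = ψ' s := by
    filter_upwards [(ae_restrict_iff' measurableSet_Ioo).1 hψ.ae_eq_mk] with s hs hsm
    rw [hs hsm]
    exact (indicator_of_mem hsm _).symm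
  have hT : ∀ᵐ s : ℝ, s ≠ T := by simp [ae_iff, measure_singleton]
  have h1 : eLpNorm (fun t => h⁻¹ • ∫ s in t..t + h, ψ' s) 2 volume ≤ eLpNorm ψ' 2 volume := by
    have key := lintegral_enorm_average_sq_le hm h0
    have q := fun f : ℝ → E => eLpNorm_nnreal_pow_eq_lintegral (f := f) (μ := volume) (p := 2)
      (by norm_num)
    have a1 : eLpNorm (fun t => h⁻¹ • ∫ s in t..t + h, ψ' s) 2 volume ^ 2 ≤
        eLpNorm ψ' 2 volume ^ 2 := by
      simpa using (q _).le.trans ((by simpa using key : _ ≤ _).trans (q _).ge)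
    exact (ENNReal.pow_le_pow_left_iff two_ne_zero).1 a1
  rw [e1]
  refine le_trans ?_ h1
  refine le_trans (le_of_eq ?_) (eLpNorm_mono_measure _ (Measure.restrict_le_self (s := Ioo c d)))
  refine eLpNorm_congr_ae ?_
  filter_upwards [ae_restrict_mem measurableSet_Ioo] with t ht
  congr 1
  refine intervalIntegral.integral_congr_ae ?_
  filter_upwards [e2, hT] with s hs hsT hsm
  refine hs ⟨?_, lt_of_le_of_ne ?_ hsT⟩
  · refine lt_of_le_of_lt ?_ hsm.1
    exact le_min (hc.1.trans ht.1.le) (hch.1.trans (by linarith [ht.1]))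
  · refine hsm.2.trans ?_
    exact max_le (ht.2.le.trans hd.2) (le_trans (by linarith [ht.2]) hdh.2)

/-- The difference quotients of a primitive of a square integrable function converge in the
square mean, on any interval on which they are defined. -/
theorem IsPrim.eLpNorm_diffQuot_sub_le {T : ℝ} [CompleteSpace E] {F g : ℝ → E} (hF : IsPrim 0 T F g)
    (hg : MemLp g 2 (volume.restrict (Ioo 0 T))) {ε : ℝ} (hε : 0 < ε) :
    ∃ δ > 0, ∀ h : ℝ, h ≠ 0 → |h| < δ → ∀ c ∈ Icc 0 T, ∀ d ∈ Icc 0 T,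
      c + h ∈ Icc 0 T → d + h ∈ Icc 0 T →
      eLpNorm (fun t => h⁻¹ • (F (t + h) - F t) - g t) 2 (volume.restrict (Ioo c d)) ≤
        ENNReal.ofReal ε := by
  rcases le_or_gt T 0 with hT | hT
  · refine ⟨1, one_pos, fun h _ _ c hc d hd _ _ => ?_⟩
    rw [Ioo_eq_empty (by linarith [hc.1, hd.2])]
    simp
  have hε3 : 0 < ε / 3 := by positivity
  -- Averages are contractions in the square mean, so the problem reduces to a continuous `φ` close
  -- to `g`, for which uniform continuity suffices.
  obtain ⟨φ, hφs, hφ, hφc, -⟩ := hg.exists_hasCompactSupport_eLpNorm_sub_le (by norm_num)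
    (ε := ENNReal.ofReal (ε / 3)) (by simpa using hε)
  -- A function bounded by `η` has norm at most `√T η ≤ ε / 3` in the square mean over `(0, T)`.
  set η := ε / 3 / (√T + 1)
  have hη : 0 < η := by positivity
  obtain ⟨δ, hδ, hδ'⟩ := Metric.uniformContinuous_iff.1
    (hφs.uniformContinuous_of_continuous hφc) η hη
  refine ⟨δ, hδ, fun h h0 hhδ c hc d hd hch hdh => ?_⟩
  have hgi : IntervalIntegrable g volume 0 T := hF.1
  have hφi : ∀ x y, IntervalIntegrable φ volume x y := fun x y => hφc.intervalIntegrable x y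
  have e : (fun t => h⁻¹ • (F (t + h) - F t) - g t) =ᵐ[volume.restrict (Ioo c d)]
      fun t => ((h⁻¹ • ∫ s in t..t + h, (g s - φ s)) + (h⁻¹ • (∫ s in t..t + h, φ s) - φ t)) -
        (g t - φ t) := by
    filter_upwards [ae_restrict_mem measurableSet_Ioo] with t ht
    have ht1 : t ∈ Icc 0 T := ⟨hc.1.trans ht.1.le, ht.2.le.trans hd.2⟩
    have ht2 : t + h ∈ Icc 0 T :=
      ⟨hch.1.trans (by linarith [ht.1]), le_trans (by linarith [ht.2]) hdh.2⟩
    rw [hF.sub_eq ht1 ht2, intervalIntegral.integral_sub (hF.intervalIntegrable ht1 ht2)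
      (hφi _ _), smul_sub]
    abel
  have hle : volume.restrict (Ioo c d) ≤ volume.restrict (Ioo 0 T) :=
    Measure.restrict_mono (Ioo_subset_Ioo hc.1 hd.2) le_rfl
  have hm1 : AEStronglyMeasurable (fun t => g t - φ t) (volume.restrict (Ioo 0 T)) :=
    hg.1.sub hφc.aestronglyMeasurable
  have hmi : AEStronglyMeasurable (fun t => h⁻¹ • ∫ s in t..t + h, φ s)
      (volume.restrict (Ioo c d)) := by
    have : Continuous fun t => ∫ s in t..t + h, φ s := by
      have h1 := (continuous_iff_continuousAt.2 fun x =>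
        (hφc.integral_hasStrictDerivAt 0 x).hasDerivAt.continuousAt)
      have : (fun t => ∫ s in t..t + h, φ s) = fun t => (∫ s in (0:ℝ)..t + h, φ s) -
          ∫ s in (0:ℝ)..t, φ s := by
        funext t
        rw [intervalIntegral.integral_interval_sub_left (hφi _ _) (hφi _ _)]
      rw [this]
      exact (h1.comp (continuous_id.add continuous_const)).sub h1
    exact (this.const_smul _).aestronglyMeasurable
  have hmF : AEStronglyMeasurable (fun t => h⁻¹ • ∫ s in t..t + h, (g s - φ s))
      (volume.restrict (Ioo c d)) := by
    have h1 : AEStronglyMeasurable (fun t => h⁻¹ • (F (t + h) - F t))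
        (volume.restrict (Ioo c d)) := by
      refine ContinuousOn.aestronglyMeasurable ?_ measurableSet_Ioo
      refine ((hF.continuousOn.comp (continuousOn_id.add continuousOn_const) ?_).sub
        (hF.continuousOn.mono ?_)).const_smul _
      · exact fun t ht => ⟨hch.1.trans (by simp; linarith [ht.1]),
          le_trans (by simp; linarith [ht.2]) hdh.2⟩
      · exact fun t ht => ⟨hc.1.trans ht.1.le, ht.2.le.trans hd.2⟩
    refine (h1.sub hmi).congr ?_
    filter_upwards [e] with t ht
    simp only [Pi.sub_apply]
    have := congrArg (fun x => x + g t - (h⁻¹ • ∫ s in t..t + h, φ s)) ht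
    simp only [sub_add_cancel] at this
    rw [this]
    abel
  have b1 : eLpNorm (fun t => h⁻¹ • ∫ s in t..t + h, (g s - φ s)) 2 (volume.restrict (Ioo c d)) ≤
      ENNReal.ofReal (ε / 3) :=
    (eLpNorm_average_le hm1 h0 hc hd hch hdh).trans hφ
  have b3 : eLpNorm (fun t => g t - φ t) 2 (volume.restrict (Ioo c d)) ≤ ENNReal.ofReal (ε / 3) :=
    (eLpNorm_mono_measure _ hle).trans hφ
  have b2 : eLpNorm (fun t => h⁻¹ • (∫ s in t..t + h, φ s) - φ t) 2 (volume.restrict (Ioo c d)) ≤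
      ENNReal.ofReal (ε / 3) := by
    have hb : ∀ t, ‖h⁻¹ • (∫ s in t..t + h, φ s) - φ t‖ ≤ η := by
      intro t
      have e1 : h⁻¹ • (∫ s in t..t + h, φ s) - φ t = h⁻¹ • ∫ s in t..t + h, (φ s - φ t) := by
        rw [intervalIntegral.integral_sub (hφi _ _) (by simp), intervalIntegral.integral_const,
          smul_sub, add_sub_cancel_left, smul_smul, inv_mul_cancel₀ h0, one_smul]
      rw [e1, norm_smul, norm_inv, Real.norm_eq_abs]
      have e2 : ‖∫ s in t..t + h, (φ s - φ t)‖ ≤ η * |t + h - t| := by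
        refine intervalIntegral.norm_integral_le_of_norm_le_const fun s hs => ?_
        rw [← dist_eq_norm]
        refine (hδ' ?_).le
        rw [Real.dist_eq]
        refine lt_of_le_of_lt ?_ hhδ
        have := abs_sub_left_of_mem_uIcc (uIoc_subset_uIcc hs)
        simpa using this
      rw [add_sub_cancel_left] at e2
      have := abs_pos.2 h0
      rw [inv_mul_le_iff₀ this]
      linarith
    refine (eLpNorm_mono_measure _ hle).trans ((eLpNorm_le_of_ae_bound (ae_of_all _ hb)).trans ?_)
    simp only [Measure.restrict_apply MeasurableSet.univ, univ_inter, Real.volume_Ioo, sub_zero]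
    rw [ENNReal.ofReal_rpow_of_pos hT, ← ENNReal.ofReal_mul (by positivity)]
    refine ENNReal.ofReal_le_ofReal ?_
    have : T ^ ((2 : ℝ≥0∞).toReal)⁻¹ = √T := by
      rw [Real.sqrt_eq_rpow]; norm_num
    rw [this]
    calc √T * η ≤ (√T + 1) * η := by gcongr; linarith
      _ = ε / 3 := by simp only [η]; field_simp
  rw [eLpNorm_congr_ae e]
  have hm1' := hm1.mono_measure hle
  have hm2 := hmi.sub (hφc.aestronglyMeasurable (μ := volume.restrict (Ioo c d)))
  refine (eLpNorm_sub_le (hmF.add hm2) hm1' (by norm_num)).trans ?_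
  refine (add_le_add ((eLpNorm_add_le hmF hm2 (by norm_num)).trans (add_le_add b1 b2)) b3).trans ?_
  rw [← ENNReal.ofReal_add hε3.le hε3.le, ← ENNReal.ofReal_add (by positivity) hε3.le]
  exact ENNReal.ofReal_le_ofReal (by linarith)

/-- If the slopes of `V` satisfy a uniform Cauchy condition then `V` is continuously
differentiable. -/
theorem exists_hasDerivWithinAt_of_slope [CompleteSpace E] {c d : ℝ} (hcd : c < d) {V : ℝ → E}
    (H : ∀ ε > 0, ∃ δ > 0, ∀ t ∈ Icc c d, ∀ r ∈ Icc c d, ∀ s ∈ Icc c d, r ≠ t → s ≠ t →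
      |r - t| < δ → |s - t| < δ → ‖slope V t r - slope V t s‖ ≤ ε) :
    ∃ Q : ℝ → E, ContinuousOn Q (Icc c d) ∧
      ∀ t ∈ Icc c d, HasDerivWithinAt V (Q t) (Icc c d) t := by
  have hne : ∀ t ∈ Icc c d, (𝓝[Icc c d \ {t}] t).NeBot := by
    intro t ht
    have := uniqueDiffWithinAt_iff_accPt.1 (uniqueDiffOn_Icc hcd t ht)
    rw [accPt_principal_iff_nhdsWithin] at this
    exact this
  have hmem : ∀ (t : ℝ) {δ : ℝ}, 0 < δ →
      {r | r ∈ Icc c d ∧ r ≠ t ∧ |r - t| < δ} ∈ 𝓝[Icc c d \ {t}] t := by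
    intro t δ hδ
    filter_upwards [self_mem_nhdsWithin, mem_nhdsWithin_of_mem_nhds (Metric.ball_mem_nhds t hδ)]
      with r hr hr'
    exact ⟨hr.1, hr.2, by simpa [Real.dist_eq] using hr'⟩
  have hlim : ∀ t ∈ Icc c d, ∃ q, Tendsto (slope V t) (𝓝[Icc c d \ {t}] t) (𝓝 q) := by
    intro t ht
    have := hne t ht
    refine cauchy_map_iff_exists_tendsto.1 (Metric.cauchy_iff.2 ⟨inferInstance, fun ε hε => ?_⟩)
    obtain ⟨δ, hδ, h1⟩ := H (ε / 2) (by positivity)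
    refine ⟨_, image_mem_map (hmem t hδ), ?_⟩
    rintro _ ⟨r, hr, rfl⟩ _ ⟨s, hs, rfl⟩
    rw [dist_eq_norm]
    exact (h1 t ht r hr.1 s hs.1 hr.2.1 hs.2.1 hr.2.2 hs.2.2).trans_lt (by linarith)
  choose! Q hQ using hlim
  refine ⟨Q, ?_, fun t ht => hasDerivWithinAt_iff_tendsto_slope.2 (hQ t ht)⟩
  have key : ∀ ε > 0, ∃ δ > 0, ∀ t ∈ Icc c d, ∀ r ∈ Icc c d, r ≠ t → |r - t| < δ →
      ‖slope V t r - Q t‖ ≤ ε := by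
    intro ε hε
    obtain ⟨δ, hδ, h1⟩ := H ε hε
    refine ⟨δ, hδ, fun t ht r hr hrt hrδ => ?_⟩
    have := hne t ht
    refine le_of_tendsto (tendsto_const_nhds.sub (hQ t ht)).norm ?_
    filter_upwards [hmem t hδ] with s hs
    exact h1 t ht r hr s hs.1 hrt hs.2.1 hrδ hs.2.2
  intro t ht
  rw [Metric.continuousWithinAt_iff]
  intro ε hε
  obtain ⟨δ, hδ, h1⟩ := key (ε / 3) (by positivity)
  refine ⟨δ, hδ, fun r hr hrt => ?_⟩
  rcases eq_or_ne r t with rfl | hne'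
  · simpa using hε
  rw [Real.dist_eq] at hrt
  have a1 := h1 t ht r hr hne' hrt
  have a2 := h1 r hr t ht hne'.symm (by rwa [abs_sub_comm])
  -- The slope is symmetric in its two points, so `Q r` and `Q t` are both close to the same slope.
  rw [slope_comm] at a2
  rw [dist_eq_norm]
  calc ‖Q r - Q t‖ = ‖(slope V t r - Q t) - (slope V t r - Q r)‖ := by congr 1; abel
    _ ≤ ε / 3 + ε / 3 := (norm_sub_le _ _).trans (add_le_add a1 a2)
    _ < ε := by linarith

end Slope

/-! ### The weak derivative in space as a closed operator -/

section Space

variable {a b : ℝ}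

theorem IsTest.memLp {φ : ℝ → ℝ} (h : IsTest a b φ) :
    MemLp φ 2 (volume.restrict (Ioo a b)) :=
  h.1.continuous.memLp_of_hasCompactSupport h.2.1

/-- A test function as an element of `L²(a,b)`. -/
def IsTest.toL2 {φ : ℝ → ℝ} (h : IsTest a b φ) : L2 a b := h.memLp.toLp φ

theorem inner_eq_integral (f g : L2 a b) :
    inner ℝ f g = ∫ x in Ioo a b, f x * g x := by
  rw [L2.inner_def]
  refine integral_congr_ae (ae_of_all _ fun x => ?_)
  simp [mul_comm]

theorem IsTest.inner_toL2 {φ : ℝ → ℝ} (h : IsTest a b φ) (f : L2 a b) :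
    inner ℝ h.toL2 f = ∫ x in Ioo a b, φ x • f x := by
  rw [inner_eq_integral]
  refine integral_congr_ae ?_
  filter_upwards [h.memLp.coeFn_toLp] with x hx
  rw [IsTest.toL2, hx, smul_eq_mul]

theorem integrableOn_L2 (f : L2 a b) : IntegrableOn f (Ioo a b) :=
  (Lp.memLp f).integrable (by norm_num)

/-- `g` is the weak derivative of `f` in `L²(a,b)`. -/
def HasDx (f g : L2 a b) : Prop := IsWeakDeriv a b f g

/-- Testing is pairing with fixed elements of `L²(a,b)`. Linearity, closedness and the exchange with
time integrals are read off from this form. -/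
theorem hasDx_iff {f g : L2 a b} : HasDx f g ↔
    ∀ φ (hφ : IsTest a b φ), inner ℝ hφ.derivative.toL2 f = -inner ℝ hφ.toL2 g := by
  constructor
  · intro h φ hφ
    rw [IsTest.inner_toL2, IsTest.inner_toL2]
    exact h.2.2 φ hφ
  · intro h
    refine ⟨(integrableOn_L2 f).locallyIntegrableOn, (integrableOn_L2 g).locallyIntegrableOn,
      fun φ hφ => ?_⟩
    have := h φ hφ
    rwa [IsTest.inner_toL2, IsTest.inner_toL2] at this

/-- The graph of the weak derivative. -/
def dxGraph (a b : ℝ) : Submodule ℝ (L2 a b × L2 a b) where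
  carrier := {p | HasDx p.1 p.2}
  add_mem' {p q} hp hq := by
    rw [mem_ofPred_eq, hasDx_iff] at *
    intro φ hφ
    simp only [Prod.fst_add, Prod.snd_add, inner_add_right, hp φ hφ, hq φ hφ]
    ring
  zero_mem' := by
    rw [mem_ofPred_eq, hasDx_iff]
    intro φ hφ
    simp
  smul_mem' r p hp := by
    rw [mem_ofPred_eq, hasDx_iff] at *
    intro φ hφ
    simp only [Prod.smul_fst, Prod.smul_snd, inner_smul_right, hp φ hφ]
    ring

theorem isClosed_dxGraph : IsClosed (dxGraph a b : Set (L2 a b × L2 a b)) := by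
  have : (dxGraph a b : Set (L2 a b × L2 a b)) = ⋂ (φ : ℝ → ℝ) (hφ : IsTest a b φ),
      {p | inner ℝ hφ.derivative.toL2 p.1 = -inner ℝ hφ.toL2 p.2} := by
    ext p
    simp only [mem_iInter, mem_ofPred_eq]
    exact hasDx_iff
  rw [this]
  exact isClosed_iInter fun φ => isClosed_iInter fun hφ =>
    isClosed_eq (by fun_prop) (by fun_prop)

theorem HasDx.add {f g f' g' : L2 a b} (h : HasDx f g) (h' : HasDx f' g') :
    HasDx (f + f') (g + g') := (dxGraph a b).add_mem (x := (f, g)) (y := (f', g')) h h'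

theorem HasDx.sub {f g f' g' : L2 a b} (h : HasDx f g) (h' : HasDx f' g') :
    HasDx (f - f') (g - g') := (dxGraph a b).sub_mem (x := (f, g)) (y := (f', g')) h h'

theorem HasDx.smul {f g : L2 a b} (h : HasDx f g) (r : ℝ) :
    HasDx (r • f) (r • g) := (dxGraph a b).smul_mem (x := (f, g)) r h

theorem HasDx.of_tendsto {ι : Type*} {l : Filter ι} [l.NeBot] {f g : ι → L2 a b} {f₀ g₀ : L2 a b}
    (h : ∀ᶠ i in l, HasDx (f i) (g i)) (hf : Tendsto f l (𝓝 f₀)) (hg : Tendsto g l (𝓝 g₀)) :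
    HasDx f₀ g₀ :=
  isClosed_dxGraph.mem_of_tendsto (hf.prodMk_nhds hg) h

theorem HasDx.weakDx_eq {f g : L2 a b} (h : HasDx f g) : weakDx f = g := Thermo.weakDx_eq h

theorem HasDx.unique {f g g' : L2 a b} (h : HasDx f g) (h' : HasDx f g') : g = g' := by
  rw [← h.weakDx_eq, h'.weakDx_eq]

theorem memH_one_iff {f : L2 a b} : MemH 1 f ↔ HasDx f (weakDx f) := by
  constructor
  · rintro ⟨⟨g, hg⟩, -⟩
    have : HasDx f g := hg
    rwa [this.weakDx_eq]
  · intro h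
    exact ⟨⟨_, h⟩, trivial⟩

theorem memH_succ_iff {k : ℕ} {f : L2 a b} :
    MemH (k + 1) f ↔ HasDx f (weakDx f) ∧ MemH k (weakDx f) := by
  constructor
  · rintro ⟨⟨g, hg⟩, h⟩
    have h1 : HasDx f g := hg
    refine ⟨?_, h⟩
    rwa [h1.weakDx_eq]
  · rintro ⟨h, h'⟩
    exact ⟨⟨_, h⟩, h'⟩

theorem HasDx.memH_one {f g : L2 a b} (h : HasDx f g) : MemH 1 f := ⟨⟨g, h⟩, trivial⟩

theorem HasDx.intervalIntegral {f g : ℝ → L2 a b} {c d : ℝ} (hcd : c ≤ d)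
    (h : ∀ᵐ t ∂volume.restrict (Ioo c d), HasDx (f t) (g t))
    (hf : IntervalIntegrable f volume c d) (hg : IntervalIntegrable g volume c d) :
    HasDx (∫ t in c..d, f t) (∫ t in c..d, g t) := by
  rw [hasDx_iff]
  intro φ hφ
  rw [intervalIntegral.integral_of_le hcd, intervalIntegral.integral_of_le hcd,
    ← integral_inner hf.1, ← integral_inner hg.1, ← integral_neg]
  refine integral_congr_ae ?_
  rw [← restrict_Ioo_eq_restrict_Ioc]
  filter_upwards [h] with t ht
  exact hasDx_iff.1 ht φ hφ

/-- Pairs of a test function and its derivative. -/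
def testGraph (a b : ℝ) : Submodule ℝ (L2 a b × L2 a b) where
  carrier := {p | ∃ φ, ∃ hφ : IsTest a b φ, p = (hφ.toL2, hφ.derivative.toL2)}
  add_mem' := by
    rintro _ _ ⟨φ, hφ, rfl⟩ ⟨ψ, hψ, rfl⟩
    refine ⟨φ + ψ, hφ.add hψ, ?_⟩
    have e : deriv (φ + ψ) = deriv φ + deriv ψ := funext fun x => deriv_add
      ((contDiff_infty_iff_deriv.1 hφ.1).1 x) ((contDiff_infty_iff_deriv.1 hψ.1).1 x)
    simp only [IsTest.toL2, e]
    rfl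
  zero_mem' := by
    have h0 : IsTest a b (0 : ℝ → ℝ) :=
      ⟨contDiff_const, HasCompactSupport.zero, by simp [tsupport]⟩
    refine ⟨0, h0, ?_⟩
    have e : deriv (0 : ℝ → ℝ) = 0 := funext fun x => deriv_const x 0
    simp only [IsTest.toL2, e]
    rfl
  smul_mem' := by
    rintro r _ ⟨φ, hφ, rfl⟩
    refine ⟨_, hφ.const_mul r, ?_⟩
    have e : deriv (fun x => r * φ x) = fun x => r * deriv φ x := funext fun x =>
      deriv_const_mul r ((contDiff_infty_iff_deriv.1 hφ.1).1 x)
    simp only [IsTest.toL2, e]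
    rfl

/-- `v ∈ H^1_0(a,b)` with weak derivative `w`. -/
def HasDx0 (v w : L2 a b) : Prop := (v, w) ∈ (testGraph a b).topologicalClosure

theorem isClosed_hasDx0 : IsClosed {p : L2 a b × L2 a b | HasDx0 p.1 p.2} :=
  (testGraph a b).isClosed_topologicalClosure

theorem HasDx0.sub {f g f' g' : L2 a b} (h : HasDx0 f g) (h' : HasDx0 f' g') :
    HasDx0 (f - f') (g - g') :=
  (testGraph a b).topologicalClosure.sub_mem (x := (f, g)) (y := (f', g')) h h'

theorem HasDx0.smul {f g : L2 a b} (h : HasDx0 f g) (r : ℝ) :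
    HasDx0 (r • f) (r • g) := (testGraph a b).topologicalClosure.smul_mem (x := (f, g)) r h

theorem IsTest.hasDx0 {φ : ℝ → ℝ} (h : IsTest a b φ) : HasDx0 h.toL2 h.derivative.toL2 :=
  (testGraph a b).le_topologicalClosure ⟨φ, h, rfl⟩

/-- Integration by parts without boundary terms, by approximating `v` with test functions; nothing
is asked of `f` at the end points. -/
theorem HasDx.inner_right {f g v w : L2 a b} (h : HasDx f g) (h' : HasDx0 v w) :
    inner ℝ f w = -inner ℝ g v := by
  have hc : IsClosed {p : L2 a b × L2 a b | inner ℝ f p.2 = -inner ℝ g p.1} :=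
    isClosed_eq (by fun_prop) (by fun_prop)
  have : closure (testGraph a b : Set (L2 a b × L2 a b)) ⊆
      {p : L2 a b × L2 a b | inner ℝ f p.2 = -inner ℝ g p.1} := by
    refine closure_minimal ?_ hc
    rintro _ ⟨φ, hφ, rfl⟩
    rw [mem_ofPred_eq, real_inner_comm, real_inner_comm _ g]
    exact hasDx_iff.1 h φ hφ
  exact this h'

theorem hasDx_of_forall_hasDx0 {f g : L2 a b}
    (h : ∀ v w, HasDx0 v w → inner ℝ g v = -inner ℝ f w) : HasDx f g := by
  rw [hasDx_iff]
  intro φ hφ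
  rw [real_inner_comm, real_inner_comm g, h _ _ hφ.hasDx0, neg_neg]

theorem HasDx0.hasDx {v w : L2 a b} (h : HasDx0 v w) : HasDx v w := by
  have : (testGraph a b).topologicalClosure ≤ dxGraph a b := by
    refine Submodule.topologicalClosure_minimal _ ?_ isClosed_dxGraph
    rintro _ ⟨φ, hφ, rfl⟩
    refine IsWeakDeriv.congr ?_ hφ.memLp.coeFn_toLp.symm hφ.derivative.memLp.coeFn_toLp.symm
    rcases le_or_gt a b with hab | hab
    · exact (isPrim_of_contDiff hφ.1).isWeakDeriv hab
    · have : Ioo a b = ∅ := Ioo_eq_empty (not_lt.2 hab.le)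
      simp [IsWeakDeriv, this, LocallyIntegrableOn]
  exact this h

theorem eLpNorm_sub_toL2 {φ : ℝ → ℝ} (h : IsTest a b φ) (f : L2 a b) :
    eLpNorm (fun x => f x - φ x) 2 (volume.restrict (Ioo a b)) =
      ENNReal.ofReal ‖f - h.toL2‖ := by
  rw [Lp.norm_def, ENNReal.ofReal_toReal (Lp.eLpNorm_ne_top _)]
  refine eLpNorm_congr_ae ?_
  filter_upwards [Lp.coeFn_sub f h.toL2, h.memLp.coeFn_toLp] with x h1 h2
  rw [h1, Pi.sub_apply, IsTest.toL2, h2]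

theorem memH10_iff {f : L2 a b} : MemH10 f ↔ HasDx0 f (weakDx f) := by
  have key : ∀ ε : ℝ, 0 < ε → ((∃ φ : ℝ → ℝ, IsTest a b φ ∧
      eLpNorm (fun x => f x - φ x) 2 (volume.restrict (Ioo a b)) ≤ ENNReal.ofReal ε ∧
      eLpNorm (fun x => weakDx f x - deriv φ x) 2 (volume.restrict (Ioo a b)) ≤
        ENNReal.ofReal ε) ↔
      ∃ φ, ∃ hφ : IsTest a b φ, ‖f - hφ.toL2‖ ≤ ε ∧ ‖weakDx f - hφ.derivative.toL2‖ ≤ ε) := by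
    intro ε hε
    constructor
    · rintro ⟨φ, hφ, h1, h2⟩
      rw [eLpNorm_sub_toL2 hφ, ENNReal.ofReal_le_ofReal_iff hε.le] at h1
      rw [eLpNorm_sub_toL2 hφ.derivative, ENNReal.ofReal_le_ofReal_iff hε.le] at h2
      exact ⟨φ, hφ, h1, h2⟩
    · rintro ⟨φ, hφ, h1, h2⟩
      refine ⟨φ, hφ, ?_, ?_⟩
      · rw [eLpNorm_sub_toL2 hφ]
        exact ENNReal.ofReal_le_ofReal h1
      · rw [eLpNorm_sub_toL2 hφ.derivative]
        exact ENNReal.ofReal_le_ofReal h2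
  constructor
  · rintro ⟨-, h⟩
    refine Metric.mem_closure_iff.2 fun ε hε => ?_
    obtain ⟨φ, hφ, h1, h2⟩ := (key (ε / 2) (by positivity)).1 (h (ε / 2) (by positivity))
    refine ⟨_, ⟨φ, hφ, rfl⟩, ?_⟩
    rw [Prod.dist_eq, max_lt_iff, dist_eq_norm, dist_eq_norm]
    exact ⟨by linarith, by linarith⟩
  · intro h
    refine ⟨h.hasDx.memH_one, fun ε hε => (key ε hε).2 ?_⟩
    obtain ⟨_, ⟨φ, hφ, rfl⟩, h1⟩ := Metric.mem_closure_iff.1 h ε hε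
    rw [Prod.dist_eq, max_lt_iff, dist_eq_norm, dist_eq_norm] at h1
    exact ⟨φ, hφ, h1.1.le, h1.2.le⟩

theorem HasDx0.memH10 {v w : L2 a b} (h : HasDx0 v w) : MemH10 v := by
  rw [memH10_iff, h.hasDx.weakDx_eq]
  exact h

/-- Test functions are dense in `L²(a,b)`. -/
theorem closure_test_eq_top :
    ((testGraph a b).map (LinearMap.fst ℝ (L2 a b) (L2 a b))).topologicalClosure = ⊤ := by
  rw [Submodule.topologicalClosure_eq_top_iff, Submodule.eq_bot_iff]
  intro f hf
  have h1 : ∀ᵐ x ∂(volume : Measure ℝ), x ∈ Ioo a b → f x = 0 := by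
    refine isOpen_Ioo.ae_eq_zero_of_integral_contDiff_smul_eq_zero
      (integrableOn_L2 f).locallyIntegrableOn ?_
    intro φ hφ hc hs
    have hφ' : IsTest a b φ := ⟨hφ, hc, hs⟩
    rw [← hφ'.setIntegral_smul, ← hφ'.inner_toL2]
    exact (Submodule.mem_orthogonal _ _).1 hf _ ⟨_, ⟨φ, hφ', rfl⟩, rfl⟩
  rw [← (ae_restrict_iff' measurableSet_Ioo)] at h1
  exact Lp.eq_zero_iff_ae_eq_zero.2 h1

theorem mem_closure_test (f : L2 a b) : ∀ ε > 0, ∃ φ, ∃ hφ : IsTest a b φ, ‖f - hφ.toL2‖ < ε := by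
  intro ε hε
  have : f ∈ ((testGraph a b).map (LinearMap.fst ℝ (L2 a b) (L2 a b))).topologicalClosure := by
    rw [closure_test_eq_top]; trivial
  obtain ⟨_, ⟨_, ⟨φ, hφ, rfl⟩, rfl⟩, h⟩ := Metric.mem_closure_iff.1 this ε hε
  exact ⟨φ, hφ, by simpa [dist_eq_norm] using h⟩

theorem eq_of_inner_test {f g : L2 a b}
    (h : ∀ φ (hφ : IsTest a b φ), inner ℝ f hφ.toL2 = inner ℝ g hφ.toL2) : f = g := by
  have hc : IsClosed {v : L2 a b | inner ℝ f v = inner ℝ g v} :=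
    isClosed_eq (by fun_prop) (by fun_prop)
  refine ext_inner_right ℝ fun v => ?_
  refine closure_minimal (s := {v | ∃ φ, ∃ hφ : IsTest a b φ, v = hφ.toL2}) ?_ hc ?_
  · rintro _ ⟨φ, hφ, rfl⟩
    exact h φ hφ
  · refine Metric.mem_closure_iff.2 fun ε hε => ?_
    obtain ⟨φ, hφ, h1⟩ := mem_closure_test v ε hε
    exact ⟨_, ⟨φ, hφ, rfl⟩, by rwa [dist_eq_norm]⟩

/-- The weak derivative is closed with respect to bounded sequences of derivatives. -/
theorem HasDx.of_tendsto_of_bounded {f g : ℕ → L2 a b} {f₀ : L2 a b} {M : ℝ}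
    (h : ∀ᶠ n in atTop, HasDx (f n) (g n)) (hf : Tendsto f atTop (𝓝 f₀))
    (hM : ∃ᶠ n in atTop, ‖g n‖ ≤ M) : ∃ g₀, HasDx f₀ g₀ ∧ ‖g₀‖ ≤ M := by
  -- The bound holds only along infinitely many indices. An ultrafilter finer than `atTop` and
  -- concentrated on them selects a weak limit of the `g n` by Banach–Alaoglu, and the defining
  -- identities pass to it.
  have hne : (atTop ⊓ 𝓟 {n : ℕ | ‖g n‖ ≤ M}).NeBot := frequently_iff_neBot.1 hM
  set U := Ultrafilter.of (atTop ⊓ 𝓟 {n : ℕ | ‖g n‖ ≤ M})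
  have hU : (U : Filter ℕ) ≤ atTop ⊓ 𝓟 {n : ℕ | ‖g n‖ ≤ M} := Ultrafilter.of_le _
  have hUM : ∀ᶠ n in (U : Filter ℕ), ‖g n‖ ≤ M := hU.trans inf_le_right (mem_principal_self _)
  let J : ℕ → WeakDual ℝ (L2 a b) := fun n => StrongDual.toWeakDual (InnerProductSpace.toDual ℝ _ (g n))
  have hK := WeakDual.isCompact_closedBall (𝕜 := ℝ) (0 : StrongDual ℝ (L2 a b)) M
  obtain ⟨x, hx, hxU⟩ := hK.ultrafilter_le_nhds (U.map J) (by
    rw [le_principal_iff]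
    refine Ultrafilter.mem_map.2 (show ∀ᶠ n in (U : Filter ℕ), _ from ?_)
    filter_upwards [hUM] with n hn
    simpa [J] using hn)
  have hlim : ∀ v : L2 a b, Tendsto (fun n => inner ℝ (g n) v) U (𝓝 (x v)) := by
    intro v
    have h1 : Tendsto J U (𝓝 x) := hxU
    have h2 := ((WeakDual.eval_continuous v).tendsto x).comp h1
    exact h2
  refine ⟨(InnerProductSpace.toDual ℝ _).symm (WeakDual.toStrongDual x), ?_, ?_⟩
  · rw [hasDx_iff]
    intro φ hφ
    have h1 : Tendsto (fun n => inner ℝ hφ.derivative.toL2 (f n)) U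
        (𝓝 (inner ℝ hφ.derivative.toL2 f₀)) :=
      (tendsto_const_nhds.inner hf).mono_left (hU.trans inf_le_left)
    have h2 := (hlim hφ.toL2).neg
    rw [real_inner_comm _ hφ.toL2, InnerProductSpace.toDual_symm_apply]
    have h3 : ∀ᶠ n in (U : Filter ℕ), HasDx (f n) (g n) := hU.trans inf_le_left h
    refine tendsto_nhds_unique h1 (h2.congr' ?_)
    filter_upwards [h3] with n hn
    rw [hasDx_iff.1 hn φ hφ, real_inner_comm]
  · rw [LinearIsometryEquiv.norm_map]
    simpa using hx

end Space

/-! ### Measurability, embedding and products -/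

section Product

variable {a b : ℝ}

/-- The graph is closed in a separable complete space, hence Polish, and the first projection is
injective on it because weak derivatives are unique. By Lusin–Souslin it is a measurable embedding,
and `weakDx` is its inverse followed by the second projection, extended by zero. -/
theorem aestronglyMeasurable_weakDx {α : Type*} [MeasurableSpace α] {m : Measure α}
    {f : α → L2 a b} (hf : AEStronglyMeasurable f m) :
    AEStronglyMeasurable (fun t => weakDx (f t)) m := by
  classical
  borelize (L2 a b)
  have : Fact ((2 : ℝ≥0∞) ≠ ⊤) := ⟨by norm_num⟩
  have : SecondCountableTopology (L2 a b) := inferInstance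
  let π : dxGraph a b → L2 a b := fun p => p.1.1
  have hcl : IsClosed ((dxGraph a b : Set (L2 a b × L2 a b))) := isClosed_dxGraph
  have : PolishSpace (dxGraph a b) := hcl.polishSpace
  have hπ : MeasurableEmbedding π := by
    refine Continuous.measurableEmbedding (by fun_prop) ?_
    rintro ⟨⟨f, g⟩, h⟩ ⟨⟨f', g'⟩, h'⟩ (e : f = f')
    subst e
    have : g = g' := HasDx.unique h h'
    subst this
    rfl
  have hm : Measurable (weakDx : L2 a b → L2 a b) := by
    have e : (weakDx : L2 a b → L2 a b) = Function.extend π (fun p => p.1.2) 0 := by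
      funext f
      by_cases h : ∃ g, HasDx f g
      · obtain ⟨g, hg⟩ := h
        rw [hg.weakDx_eq]
        exact (hπ.injective.extend_apply (fun p => p.1.2) 0 ⟨(f, g), hg⟩).symm
      · rw [Function.extend_apply']
        · have h' : ¬ ∃ g : L2 a b, IsWeakDeriv a b f g := h
          rw [weakDx, dif_neg h']
          rfl
        · rintro ⟨⟨⟨f', g⟩, hp⟩, rfl⟩
          exact h ⟨g, hp⟩
    rw [e]
    exact hπ.measurable_extend (by fun_prop) measurable_const
  exact (hm.comp_aemeasurable hf.aemeasurable).aestronglyMeasurable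

theorem integral_abs_L2_le (f : L2 a b) (hab : a ≤ b) :
    ∫ x in Ioo a b, |f x| ≤ √(b - a) * ‖f‖ := by
  have h1 : eLpNorm f 1 (volume.restrict (Ioo a b)) ≤
      eLpNorm f 2 (volume.restrict (Ioo a b)) *
        (volume.restrict (Ioo a b)) univ ^ (1 / (1 : ℝ≥0∞).toReal - 1 / (2 : ℝ≥0∞).toReal) :=
    eLpNorm_le_eLpNorm_mul_rpow_measure_univ (by norm_num) (Lp.aestronglyMeasurable f)
  have h2 : ∫ x in Ioo a b, |f x| = (eLpNorm f 1 (volume.restrict (Ioo a b))).toReal := by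
    rw [eLpNorm_one_eq_lintegral_enorm, ← integral_norm_eq_lintegral_enorm
      (Lp.aestronglyMeasurable f)]
    rfl
  have h3 : (volume.restrict (Ioo a b)) univ ^ (1 / (1 : ℝ≥0∞).toReal - 1 / (2 : ℝ≥0∞).toReal) =
      ENNReal.ofReal (√(b - a)) := by
    rw [Measure.restrict_apply_univ, Real.volume_Ioo, ENNReal.ofReal_rpow_of_nonneg
      (sub_nonneg.2 hab) (by norm_num), Real.sqrt_eq_rpow]
    norm_num
  rw [h3] at h1
  rw [h2, Lp.norm_def, mul_comm, ← ENNReal.toReal_ofReal (Real.sqrt_nonneg (b - a)),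
    ← ENNReal.toReal_mul]
  exact ENNReal.toReal_mono (ENNReal.mul_ne_top (Lp.eLpNorm_ne_top _) ENNReal.ofReal_ne_top) h1

/-- The constant of the embedding of `H^1(a,b)` into the bounded functions. -/
def embC (a b : ℝ) : ℝ := (√(b - a))⁻¹ + √(b - a)

theorem embC_pos (hab : a < b) : 0 < embC a b := by
  have : 0 < √(b - a) := Real.sqrt_pos.2 (sub_pos.2 hab)
  unfold embC
  positivity

/-- The primitive varies by at most `√(b - a) ‖f'‖`. Averaging `|F x| ≤ |F y| + √(b - a) ‖f'‖` over
`y` replaces `|F y|` by `‖f‖ / √(b - a)`. -/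
theorem HasDx.exists_rep {f f' : L2 a b} (h : HasDx f f') (hab : a < b) :
    ∃ F : ℝ → ℝ, IsPrim a b F f' ∧ F =ᵐ[volume.restrict (Ioo a b)] f ∧
      ∀ x ∈ Icc a b, |F x| ≤ embC a b * (‖f‖ + ‖f'‖) := by
  obtain ⟨F, hF, hFf⟩ := IsWeakDeriv.exists_isPrim hab h (integrableOn_L2 f')
  refine ⟨F, hF, hFf, fun x hx => ?_⟩
  have hs : 0 < √(b - a) := Real.sqrt_pos.2 (sub_pos.2 hab)
  have hss : √(b - a) * √(b - a) = b - a := Real.mul_self_sqrt (sub_pos.2 hab).le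
  have h1 : ∀ y ∈ Icc a b, |F x| ≤ |F y| + √(b - a) * ‖f'‖ := by
    intro y hy
    have e : F x = F y + ∫ r in y..x, f' r := by rw [← hF.sub_eq hy hx]; ring
    have e1 : |∫ r in y..x, f' r| ≤ ∫ r in Ioo a b, |f' r| := by
      rw [← Real.norm_eq_abs]
      refine intervalIntegral.norm_integral_le_integral_norm_uIoc.trans ?_
      refine setIntegral_mono_set (integrableOn_L2 f').norm (ae_of_all _ fun _ => norm_nonneg _) ?_
      exact ((uIoc_subset_uIcc.trans (uIcc_subset_Icc hy hx)).eventuallyLE).trans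
        Ioo_ae_eq_Icc.symm.le
    rw [e]
    exact (abs_add_le _ _).trans (by linarith [integral_abs_L2_le f' hab.le])
  have h2 : (b - a) * |F x| ≤ √(b - a) * ‖f‖ + (b - a) * (√(b - a) * ‖f'‖) := by
    have hi : IntegrableOn (fun y => |F y|) (Ioo a b) :=
      ((hF.continuousOn.integrableOn_Icc).mono_set Ioo_subset_Icc_self).norm
    have e1 : ∫ y in Ioo a b, |F y| ≤ √(b - a) * ‖f‖ := by
      refine le_trans (le_of_eq ?_) (integral_abs_L2_le f hab.le)
      exact integral_congr_ae (hFf.mono fun y hy => by simp only [hy])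
    have hc : ∀ r : ℝ, ∫ _ in Ioo a b, r = (b - a) * r := by
      intro r
      rw [setIntegral_const, smul_eq_mul, Measure.real, Real.volume_Ioo,
        ENNReal.toReal_ofReal (sub_pos.2 hab).le]
    have e2 : ∫ _ in Ioo a b, |F x| ≤ ∫ y in Ioo a b, (|F y| + √(b - a) * ‖f'‖) := by
      refine setIntegral_mono_on (integrableOn_const (by simp)) (hi.add (integrableOn_const (by simp)))
        measurableSet_Ioo fun y hy => h1 y (Ioo_subset_Icc_self hy)
    rw [hc, integral_add hi (integrableOn_const (by simp)), hc] at e2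
    linarith
  have h3 : (b - a) * |F x| ≤ (b - a) * ((√(b - a))⁻¹ * ‖f‖ + √(b - a) * ‖f'‖) := by
    refine h2.trans (le_of_eq ?_)
    have : (b - a) * (√(b - a))⁻¹ = √(b - a) := by
      nth_rw 1 [← hss]
      field_simp
    rw [mul_add, ← mul_assoc (b - a) (√(b - a))⁻¹, this]
  refine (le_of_mul_le_mul_left h3 (sub_pos.2 hab)).trans ?_
  unfold embC
  have := norm_nonneg f
  have := norm_nonneg f'
  have : 0 ≤ (√(b - a))⁻¹ := by positivity
  nlinarith [mul_nonneg hs.le (norm_nonneg f), mul_nonneg this (norm_nonneg f')]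

theorem HasDx.ae_abs_le {f f' : L2 a b} (h : HasDx f f') (hab : a < b) :
    ∀ᵐ x ∂volume.restrict (Ioo a b), |f x| ≤ embC a b * (‖f‖ + ‖f'‖) := by
  obtain ⟨F, -, hFf, hb⟩ := h.exists_rep hab
  filter_upwards [hFf, ae_restrict_mem measurableSet_Ioo] with x hx hxm
  rw [← hx]
  exact hb x (Ioo_subset_Icc_self hxm)

/-- The integral of a product of three functions. -/
def tri (f g h : L2 a b) : ℝ := ∫ x in Ioo a b, f x * g x * h x

theorem tri_comm (f g h : L2 a b) : tri f g h = tri g f h := by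
  unfold tri
  congr 1
  funext x
  ring

theorem tri_swap (f g h : L2 a b) : tri f g h = tri f h g := by
  unfold tri
  congr 1
  funext x
  ring

theorem HasDx.memLp_mul {f f' : L2 a b} (h : HasDx f f') (hab : a < b) (g : L2 a b) :
    MemLp (fun x => f x * g x) 2 (volume.restrict (Ioo a b)) := by
  refine MemLp.of_le_mul (c := embC a b * (‖f‖ + ‖f'‖)) (Lp.memLp g)
    ((Lp.aestronglyMeasurable f).mul (Lp.aestronglyMeasurable g)) ?_
  filter_upwards [h.ae_abs_le hab] with x hx
  rw [norm_mul]
  gcongr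
  exact hx

theorem HasDx.tri_eq {f f' : L2 a b} (h : HasDx f f') (hab : a < b) (g k : L2 a b) :
    tri f g k = inner ℝ ((h.memLp_mul hab g).toLp _) k := by
  rw [inner_eq_integral, tri]
  refine integral_congr_ae ?_
  filter_upwards [(h.memLp_mul hab g).coeFn_toLp] with x hx
  rw [hx]

theorem HasDx.norm_mul_le {f f' : L2 a b} (h : HasDx f f') (hab : a < b) (g : L2 a b) :
    ‖(h.memLp_mul hab g).toLp _‖ ≤ embC a b * (‖f‖ + ‖f'‖) * ‖g‖ := by
  refine Lp.norm_le_mul_norm_of_ae_le_mul ?_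
  filter_upwards [h.ae_abs_le hab, (h.memLp_mul hab g).coeFn_toLp] with x hx hx'
  rw [hx', norm_mul]
  gcongr
  exact hx

theorem HasDx.abs_tri_le {f f' : L2 a b} (h : HasDx f f') (hab : a < b) (g k : L2 a b) :
    |tri f g k| ≤ embC a b * (‖f‖ + ‖f'‖) * ‖g‖ * ‖k‖ := by
  rw [h.tri_eq hab]
  exact (abs_real_inner_le_norm _ _).trans
    (mul_le_mul_of_nonneg_right (h.norm_mul_le hab g) (norm_nonneg _))

theorem HasDx.integrable_tri {f f' : L2 a b} (h : HasDx f f') (hab : a < b) (g k : L2 a b) :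
    Integrable (fun x => f x * g x * k x) (volume.restrict (Ioo a b)) :=
  (h.memLp_mul hab g).integrable_mul (Lp.memLp k)

theorem HasDx.tri_sub_right {f f' : L2 a b} (h : HasDx f f') (hab : a < b) (g k l : L2 a b) :
    tri f g (k - l) = tri f g k - tri f g l := by
  rw [h.tri_eq hab, h.tri_eq hab, h.tri_eq hab, inner_sub_right]

theorem HasDx.tri_sub_mid {f f' : L2 a b} (h : HasDx f f') (hab : a < b) (g k l : L2 a b) :
    tri f (g - k) l = tri f g l - tri f k l := by
  rw [tri_swap, h.tri_sub_right hab, tri_swap f l, tri_swap f l]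

theorem HasDx.tri_smul_right {f f' : L2 a b} (h : HasDx f f') (hab : a < b) (g k : L2 a b)
    (r : ℝ) : tri f g (r • k) = r * tri f g k := by
  rw [h.tri_eq hab, h.tri_eq hab, inner_smul_right]

/-- The product rule, integrated against the derivative of an element of `H^1_0`. -/
theorem HasDx.tri_parts {f f' g g' v w : L2 a b} (hf : HasDx f f') (hg : HasDx g g')
    (hv : HasDx0 v w) (hab : a < b) : tri f w g = -(tri g v f' + tri f v g') := by
  obtain ⟨F, hF, hFf, -⟩ := hf.exists_rep hab
  obtain ⟨G, hG, hGg, -⟩ := hg.exists_rep hab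
  have hP := (hF.bilin hG hab.le (ContinuousLinearMap.mul ℝ ℝ)).isWeakDeriv hab.le
  have e1 := (hf.memLp_mul hab g).coeFn_toLp
  have e2 := (hg.memLp_mul hab f').coeFn_toLp
  have e3 := (hf.memLp_mul hab g').coeFn_toLp
  -- Both factors have absolutely continuous representatives, so `f g` has the weak derivative `g f'
  -- + f g'`; it remains to pair with `v`.
  have key : HasDx ((hf.memLp_mul hab g).toLp _)
      ((hg.memLp_mul hab f').toLp _ + (hf.memLp_mul hab g').toLp _) := by
    refine IsWeakDeriv.congr hP ?_ ?_
    · filter_upwards [hFf, hGg, e1] with x h1 h2 h3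
      rw [h3, ContinuousLinearMap.mul_apply', h1, h2]
    · filter_upwards [hFf, hGg, e2, e3, Lp.coeFn_add ((hg.memLp_mul hab f').toLp _)
        ((hf.memLp_mul hab g').toLp _)] with x h1 h2 h3 h4 h5
      rw [h5, Pi.add_apply, h3, h4, ContinuousLinearMap.mul_apply',
        ContinuousLinearMap.mul_apply', h1, h2]
      ring
  have h := key.inner_right hv
  rw [inner_add_left, ← hf.tri_eq hab, ← hg.tri_eq hab, ← hf.tri_eq hab] at h
  rw [tri_swap f w, tri_swap g v, tri_swap f v]
  exact h

/-- The constant function `1`. -/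
def oneL2 (a b : ℝ) : L2 a b := (memLp_const (1 : ℝ)).toLp _

theorem coeFn_oneL2 : oneL2 a b =ᵐ[volume.restrict (Ioo a b)] fun _ => 1 :=
  (memLp_const (1 : ℝ)).coeFn_toLp

theorem hasDx_oneL2 (hab : a < b) : HasDx (oneL2 a b) 0 := by
  refine IsWeakDeriv.congr ((isPrim_const a b (1 : ℝ)).isWeakDeriv hab.le) coeFn_oneL2.symm ?_
  exact (Lp.coeFn_zero ℝ 2 _).symm

theorem tri_oneL2 (f g : L2 a b) : tri f g (oneL2 a b) = inner ℝ f g := by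
  rw [inner_eq_integral, tri]
  refine integral_congr_ae ?_
  filter_upwards [coeFn_oneL2 (a := a) (b := b)] with x hx
  rw [hx, mul_one]

theorem inner_oneL2_nonneg {f : L2 a b} (hf : 0 ≤ f) : 0 ≤ inner ℝ f (oneL2 a b) := by
  rw [inner_eq_integral]
  refine integral_nonneg_of_ae ?_
  filter_upwards [coeFn_oneL2 (a := a) (b := b), (Lp.coeFn_nonneg f).2 hf] with x hx h
  simpa [hx] using h

theorem HasDx.ae_eq_const_of_zero {f : L2 a b} (h : HasDx f 0) (hab : a < b) :
    ∃ c : ℝ, ∀ᵐ x ∂volume.restrict (Ioo a b), f x = c := by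
  have : IsWeakDeriv a b f 0 :=
    IsWeakDeriv.congr h (ae_eq_refl _) (Lp.coeFn_zero ℝ 2 _)
  exact this.ae_eq_const hab

theorem exists_hasDx (f : L2 a b) (hab : a < b) : ∃ F : L2 a b, HasDx F f := by
  have hi : IntervalIntegrable f volume a b :=
    (intervalIntegrable_iff_integrableOn_Ioo_of_le hab.le).2 (integrableOn_L2 f)
  have hF := isPrim_integral hi (0 : ℝ)
  obtain ⟨M, hM⟩ := isCompact_Icc.exists_bound_of_continuousOn hF.continuousOn
  have hm : MemLp (fun t => 0 + ∫ s in a..t, f s) 2 (volume.restrict (Ioo a b)) := by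
    refine MemLp.of_bound ((hF.continuousOn.mono Ioo_subset_Icc_self).aestronglyMeasurable
      measurableSet_Ioo) M ?_
    filter_upwards [ae_restrict_mem measurableSet_Ioo] with t ht
    exact hM t (Ioo_subset_Icc_self ht)
  exact ⟨hm.toLp _, IsWeakDeriv.congr (hF.isWeakDeriv hab.le) hm.coeFn_toLp.symm (ae_eq_refl _)⟩

/-- Integration by parts against an antiderivative of `v` gives `‖v‖² = 0`; this takes the place of
the Poincaré inequality. -/
theorem HasDx0.eq_zero {v : L2 a b} (h : HasDx0 v 0) (hab : a < b) : v = 0 := by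
  obtain ⟨F, hF⟩ := exists_hasDx v hab
  have := hF.inner_right h
  rw [inner_zero_right, eq_comm, neg_eq_zero] at this
  exact inner_self_eq_zero.1 this

end Product

/-! ### Continuous representatives of a regular solution -/

section Extract

variable {a b : ℝ}

theorem weakDt_spec {T : ℝ} {f : ℝ → L2 a b} (h : ∃ g : ℝ → L2 a b, IsWeakDeriv 0 T f g) :
    IsWeakDeriv 0 T f (weakDt T f) := by
  rw [weakDt, dif_pos h]
  exact h.choose_spec

/-- The space derivative commutes with the time integral. The primitive of `weakDx (g t)` is
normalised at one time `s` at which `F` agrees with `f` and lies in `H¹`; it is then the space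
derivative of `F` at every time. -/
theorem exists_isPrim_hasDx {T : ℝ} (hT : 0 < T) {f g : ℝ → L2 a b} (h : IsWeakDeriv 0 T f g)
    (hf : ∀ᵐ t ∂volume.restrict (Ioo 0 T), MemH 1 (f t))
    (hg : ∀ᵐ t ∂volume.restrict (Ioo 0 T), MemH 1 (g t))
    (hgi : IntegrableOn g (Ioo 0 T)) (hgx : IntegrableOn (fun t => weakDx (g t)) (Ioo 0 T)) :
    ∃ F F' : ℝ → L2 a b, IsPrim 0 T F g ∧ F =ᵐ[volume.restrict (Ioo 0 T)] f ∧
      IsPrim 0 T F' (fun t => weakDx (g t)) ∧ ∀ t ∈ Icc 0 T, HasDx (F t) (F' t) := by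
  obtain ⟨F, hF, hFf⟩ := h.exists_isPrim hT hgi
  obtain ⟨r, hr, -⟩ := exists_seq_tendsto_of_ae (hFf.and hf) (t := 0) ⟨le_rfl, hT.le⟩ hT
  set s := r 0
  have hs : s ∈ Ioo 0 T := (hr 0).1
  have hsF : HasDx (F s) (weakDx (F s)) := by
    rw [(hr 0).2.1]
    exact memH_one_iff.1 (hr 0).2.2
  have hi : IntervalIntegrable (fun t => weakDx (g t)) volume 0 T :=
    (intervalIntegrable_iff_integrableOn_Ioo_of_le hT.le).2 hgx
  have hF' := isPrim_integral hi (weakDx (F s) - ∫ t in 0..s, weakDx (g t))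
  refine ⟨F, _, hF, hFf, hF', fun t ht => ?_⟩
  have h0 : (0 : ℝ) ∈ Icc 0 T := ⟨le_rfl, hT.le⟩
  have key : ∀ t ∈ Icc 0 T, HasDx (∫ r in 0..t, g r) (∫ r in 0..t, weakDx (g r)) := by
    intro t ht
    refine HasDx.intervalIntegral ht.1 ?_ (hF.intervalIntegrable h0 ht)
      (hF'.intervalIntegrable h0 ht)
    exact (ae_restrict_of_ae_restrict_of_subset (Ioo_subset_Ioo_right ht.2) hg).mono
      fun t ht => memH_one_iff.1 ht
  have e : F t = F s - (∫ r in 0..s, g r) + ∫ r in 0..t, g r := by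
    rw [hF.2 t ht, hF.2 s (Ioo_subset_Icc_self hs)]
    abel
  rw [e]
  exact (hsF.sub (key s (Ioo_subset_Icc_self hs))).add (key t ht)

/-- Membership in `H¹₀` is closed for the graph norm, so by continuity the boundary condition passes
from almost every time to every time. -/
theorem hasDx0_of_ae {T : ℝ} (hT : 0 < T) {f F F' : ℝ → L2 a b}
    (hF : ContinuousOn F (Icc 0 T)) (hF' : ContinuousOn F' (Icc 0 T))
    (hFf : F =ᵐ[volume.restrict (Ioo 0 T)] f) (hFF' : ∀ t ∈ Icc 0 T, HasDx (F t) (F' t))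
    (hf : ∀ᵐ t ∂volume.restrict (Ioo 0 T), MemH10 (f t)) {t : ℝ} (ht : t ∈ Icc 0 T) :
    HasDx0 (F t) (F' t) := by
  obtain ⟨s, hs, hst⟩ := exists_seq_tendsto_of_ae (hFf.and hf) ht hT
  have hst' : Tendsto s atTop (𝓝[Icc 0 T] t) :=
    tendsto_nhdsWithin_iff.2 ⟨hst, Eventually.of_forall fun n => Ioo_subset_Icc_self (hs n).1⟩
  refine isClosed_hasDx0.mem_of_tendsto (b := atTop) (f := fun n => (F (s n), F' (s n)))
    (((hF t ht).tendsto.comp hst').prodMk_nhds ((hF' t ht).tendsto.comp hst'))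
    (Eventually.of_forall fun n => ?_)
  have h1 := memH10_iff.1 (hs n).2.2
  rw [← (hs n).2.1] at h1
  rwa [(hFF' _ (Ioo_subset_Icc_self (hs n).1)).weakDx_eq] at h1

theorem HasInitialValue.eq {T : ℝ} (hT : 0 < T) {f F : ℝ → L2 a b} {f₀ : L2 a b}
    (h : HasInitialValue T f f₀) (hF : ContinuousOn F (Icc 0 T))
    (hFf : F =ᵐ[volume.restrict (Ioo 0 T)] f) : F 0 = f₀ := by
  obtain ⟨g, hg, hgf, rfl⟩ := h
  exact eqOn_of_ae_eq hT hF hg (hFf.trans hgf.symm) ⟨le_rfl, hT.le⟩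

/-- A regular solution in terms of continuous representatives: `u, u_x, u_t, u_tx, θ, θ_t` are
primitives, `P, Px, Θtt, Θx` represent `u_tt, u_ttx, θ_tt, θ_x`. -/
structure StrongSol (T ν μ : ℝ) (u₀ u₁ θ₀ : L2 a b)
    (U Ux V Vx P Px Θ Θt Θtt Θx : ℝ → L2 a b) : Prop where
  hU : IsPrim 0 T U V
  hUx : IsPrim 0 T Ux Vx
  hV : IsPrim 0 T V P
  hVx : IsPrim 0 T Vx Px
  hΘ : IsPrim 0 T Θ Θt
  hΘt : IsPrim 0 T Θt Θtt
  dxU : ∀ t ∈ Icc 0 T, HasDx0 (U t) (Ux t)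
  dxV : ∀ t ∈ Icc 0 T, HasDx0 (V t) (Vx t)
  dxΘ : ∀ᵐ t ∂volume.restrict (Ioo 0 T), HasDx (Θ t) (Θx t)
  memP : MemLp P 2 (volume.restrict (Ioo 0 T))
  memPx : MemLp Px 2 (volume.restrict (Ioo 0 T))
  memΘx : MemLp Θx 2 (volume.restrict (Ioo 0 T))
  nonneg : ∀ᵐ t ∂volume.restrict (Ioo 0 T), 0 ≤ Θ t
  momentum : ∀ᵐ t ∂volume.restrict (Ioo 0 T), ∀ v w : L2 a b, HasDx0 v w →
    inner ℝ (P t) v + inner ℝ (Ux t) w + ν * inner ℝ (Vx t) w + μ * inner ℝ (Θx t) v = 0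
  heat : ∀ᵐ t ∂volume.restrict (Ioo 0 T), ∀ ψ ψ' : L2 a b, HasDx ψ ψ' →
    inner ℝ (Θt t) ψ + inner ℝ (Θx t) ψ' + μ * tri (Θ t) (Vx t) ψ = 0
  initU : U 0 = u₀
  initV : V 0 = u₁
  initΘ : Θ 0 = θ₀

/-- `u ∈ H²(0,T;H¹)` makes `u, u_x, u_t, u_tx` primitives in time, and `θ ∈ H²(0,T;L²)` does so for
`θ, θ_t`. The curve `θ_x` is only kept as square integrable, so it is never evaluated at a
prescribed time. -/
theorem IsRegularSolution.exists_strongSol {T ν μ : ℝ} (hT : 0 < T) {u₀ u₁ θ₀ : L2 a b}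
    {u θ : ℝ → L2 a b} (h : IsRegularSolution T ν μ u₀ u₁ θ₀ u θ) :
    ∃ U Ux V Vx Px Θ Θt Θtt : ℝ → L2 a b,
      StrongSol T ν μ u₀ u₁ θ₀ U Ux V Vx ((weakDt T)^[2] u) Px Θ Θt Θtt (fun t => weakDx (θ t)) ∧
      U =ᵐ[volume.restrict (Ioo 0 T)] u ∧ V =ᵐ[volume.restrict (Ioo 0 T)] weakDt T u ∧
      Θ =ᵐ[volume.restrict (Ioo 0 T)] θ ∧ Θt =ᵐ[volume.restrict (Ioo 0 T)] weakDt T θ ∧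
      IsWeakDeriv 0 T u (weakDt T u) ∧ IsWeakDeriv 0 T (weakDt T u) ((weakDt T)^[2] u) ∧
      IsWeakDeriv 0 T θ (weakDt T θ) := by
  have d0 : IsWeakDeriv 0 T u (weakDt T u) := weakDt_spec (h.u_memH2.1 0 (by norm_num))
  have d1 : IsWeakDeriv 0 T (weakDt T u) ((weakDt T)^[2] u) :=
    weakDt_spec (h.u_memH2.1 1 (by norm_num))
  have e0 : IsWeakDeriv 0 T θ (weakDt T θ) := weakDt_spec (h.θ_memH2.1 0 (by norm_num))
  have e1 : IsWeakDeriv 0 T (weakDt T θ) ((weakDt T)^[2] θ) :=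
    weakDt_spec (h.θ_memH2.1 1 (by norm_num))
  have m0 := h.u_memH2.2 0 (by norm_num)
  have m1 := h.u_memH2.2 1 (by norm_num)
  have m2 := h.u_memH2.2 2 (by norm_num)
  have n1 := h.θ_memH2.2 1 (by norm_num)
  have n2 := h.θ_memH2.2 2 (by norm_num)
  have int : ∀ {k : ℝ → L2 a b}, MemLp k 2 (volume.restrict (Ioo 0 T)) →
      IntegrableOn k (Ioo 0 T) := fun hk => hk.integrable (by norm_num)
  obtain ⟨U, Ux, hU, hUu, hUx, hUUx⟩ := exists_isPrim_hasDx hT d0 m0.1 m1.1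
    (int (m1.2 0 (by norm_num))) (int (m1.2 1 le_rfl))
  obtain ⟨V, Vx, hV, hVu, hVx, hVVx⟩ := exists_isPrim_hasDx hT d1 m1.1 m2.1
    (int (m2.2 0 (by norm_num))) (int (m2.2 1 le_rfl))
  obtain ⟨Θ, hΘ, hΘθ⟩ := e0.exists_isPrim hT (int (n1.2 0 le_rfl))
  obtain ⟨Θt, hΘt, hΘtθ⟩ := e1.exists_isPrim hT (int (n2.2 0 le_rfl))
  have hVxu : Vx =ᵐ[volume.restrict (Ioo 0 T)] fun t => weakDx (weakDt T u t) := by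
    filter_upwards [hVu, ae_restrict_mem measurableSet_Ioo] with t ht htm
    rw [← ht, (hVVx t (Ioo_subset_Icc_self htm)).weakDx_eq]
  refine ⟨U, Ux, V, Vx, _, Θ, Θt, _, ⟨hU.congr hT.le (fun _ _ => rfl) hVu,
    hUx.congr hT.le (fun _ _ => rfl) hVxu, hV, hVx,
    hΘ.congr hT.le (fun _ _ => rfl) hΘtθ, hΘt, ?_, ?_, ?_, m2.2 0 (by norm_num), m2.2 1 le_rfl,
    h.θ_memL2.2 0 le_rfl |>.2 1 (by norm_num), ?_, ?_, ?_, ?_, ?_, ?_⟩,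
    hUu, hVu, hΘθ, hΘtθ, d0, d1, e0⟩
  · exact fun t ht => hasDx0_of_ae hT hU.continuousOn hUx.continuousOn hUu hUUx h.u_bdry ht
  · exact fun t ht => hasDx0_of_ae hT hV.continuousOn hVx.continuousOn hVu hVVx h.ut_bdry ht
  · filter_upwards [hΘθ, (h.θ_memL2.2 0 le_rfl).1] with t ht h3
    rw [ht]
    exact (memH_succ_iff.1 h3).1
  · filter_upwards [hΘθ, h.θ_nonneg] with t ht h3
    rwa [ht]
  · filter_upwards [h.momentum, hVxu, hUu, ae_restrict_mem measurableSet_Ioo] with t ht h2 h3 htm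
    intro v w hvw
    have := ht v hvw.memH10
    rwa [hvw.hasDx.weakDx_eq, ← h2, ← h3,
      (hUUx t (Ioo_subset_Icc_self htm)).weakDx_eq] at this
  · filter_upwards [h.heat, hVxu, hΘθ, hΘtθ] with t ht h2 h3 h4
    intro v w hvw
    have := ht v hvw.memH_one
    rw [hvw.weakDx_eq, ← h2, ← h3, ← h4] at this
    rw [← h3]
    exact this
  · exact h.u_init.eq hT hU.continuousOn hUu
  · exact h.ut_init.eq hT hV.continuousOn hVu
  · exact h.θ_init.eq hT hΘ.continuousOn hΘθ

end Extract

/-! ### Difference quotients of curves and continuity of `u_tt` -/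

section DiffQuot

variable {E : Type*} [NormedAddCommGroup E] [NormedSpace ℝ E]

/-- The difference quotient with step `h`. -/
def diffQuot (h : ℝ) (F : ℝ → E) (t : ℝ) : E := h⁻¹ • (F (t + h) - F t)

theorem IsPrim.diffQuotient {T c d h : ℝ} {F g : ℝ → E} (hF : IsPrim 0 T F g) (hc : 0 ≤ c)
    (hcd : c ≤ d) (hd : d ≤ T) (hch : 0 ≤ c + h) (hdh : d + h ≤ T) :
    IsPrim c d (diffQuot h F) (diffQuot h g) := by
  have h1 := (hF.comp_add h).mono (c' := c) (d' := d) (by linarith) (by linarith) hcd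
  exact ((h1.sub (hF.mono hc hd hcd)).const_smul h⁻¹)

theorem ae_comp_add {T c d h : ℝ} {p : ℝ → Prop} (hp : ∀ᵐ t ∂volume.restrict (Ioo 0 T), p t)
    (hch : 0 ≤ c + h) (hdh : d + h ≤ T) : ∀ᵐ t ∂volume.restrict (Ioo c d), p (t + h) := by
  have h1 := (ae_restrict_iff' measurableSet_Ioo).1 hp
  have h2 := (measurePreserving_add_right volume h).quasiMeasurePreserving.ae h1
  rw [ae_restrict_iff' measurableSet_Ioo]
  filter_upwards [h2] with t ht htm
  exact ht ⟨by linarith [htm.1], by linarith [htm.2]⟩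

omit [NormedSpace ℝ E] in
theorem integral_norm_sq_eq {α : Type*} [MeasurableSpace α] {m : Measure α} {f : α → E}
    (hf : MemLp f 2 m) : ∫ x, ‖f x‖ ^ 2 ∂m = (eLpNorm f 2 m).toReal ^ 2 := by
  have h2 := eLpNorm_nnreal_pow_eq_lintegral (f := f) (μ := m) (p := 2) (by norm_num)
  have h3 : eLpNorm f 2 m ^ 2 = ∫⁻ s, ‖f s‖ₑ ^ 2 ∂m := by
    simpa using h2
  rw [← ENNReal.toReal_pow, h3, integral_eq_lintegral_of_nonneg_ae
    (ae_of_all _ fun x => by positivity) (show AEStronglyMeasurable (fun x => ‖f x‖ ^ 2) m from hf.1.norm.pow 2)]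
  congr 1
  refine lintegral_congr fun x => ?_
  rw [ENNReal.ofReal_pow (norm_nonneg _), ofReal_norm]

omit [NormedSpace ℝ E] in
theorem integral_norm_sq_le {α : Type*} [MeasurableSpace α] {m : Measure α} {f : α → E} {r : ℝ}
    (hf : AEStronglyMeasurable f m) (hr : 0 ≤ r) (h : eLpNorm f 2 m ≤ ENNReal.ofReal r) :
    ∫ x, ‖f x‖ ^ 2 ∂m ≤ r ^ 2 := by
  rw [integral_norm_sq_eq ⟨hf, h.trans_lt ENNReal.ofReal_lt_top⟩]
  gcongr
  exact ENNReal.toReal_le_of_le_ofReal hr h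

omit [NormedSpace ℝ E] in
theorem memLp_two_iff_integrable_norm_sq {α : Type*} [MeasurableSpace α] {m : Measure α}
    {f : α → E} (hf : AEStronglyMeasurable f m) :
    MemLp f 2 m ↔ Integrable (fun x => ‖f x‖ ^ 2) m := by
  have := integrable_norm_rpow_iff (p := 2) hf (by norm_num) (by norm_num)
  simpa using this.symm

theorem IsPrim.integral_diffQuot_sub_le [CompleteSpace E] {T : ℝ} {F g : ℝ → E}
    (hF : IsPrim 0 T F g)
    (hg : MemLp g 2 (volume.restrict (Ioo 0 T))) {ε : ℝ} (hε : 0 < ε) :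
    ∃ δ > 0, ∀ h : ℝ, h ≠ 0 → |h| < δ → ∀ k : ℝ, k ≠ 0 → |k| < δ → ∀ c d : ℝ, 0 ≤ c → c ≤ d →
      d ≤ T → 0 ≤ c + h → d + h ≤ T → 0 ≤ c + k → d + k ≤ T →
      ∫ t in c..d, ‖diffQuot h F t - diffQuot k F t‖ ^ 2 ≤ ε := by
  obtain ⟨δ, hδ, H⟩ := hF.eLpNorm_diffQuot_sub_le hg (ε := √ε / 2) (by positivity)
  refine ⟨δ, hδ, fun h h0 hh k k0 hk c d hc hcd hd hch hdh hck hdk => ?_⟩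
  have e1 := H h h0 hh c ⟨hc, hcd.trans hd⟩ d ⟨hc.trans hcd, hd⟩ ⟨hch, by linarith⟩
    ⟨by linarith, hdh⟩
  have e2 := H k k0 hk c ⟨hc, hcd.trans hd⟩ d ⟨hc.trans hcd, hd⟩ ⟨hck, by linarith⟩
    ⟨by linarith, hdk⟩
  have m1 := ((hF.diffQuotient hc hcd hd hch hdh).continuousOn.mono
    Ioo_subset_Icc_self).aestronglyMeasurable (μ := volume) measurableSet_Ioo
  have m2 := ((hF.diffQuotient hc hcd hd hck hdk).continuousOn.mono
    Ioo_subset_Icc_self).aestronglyMeasurable (μ := volume) measurableSet_Ioo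
  have mg : AEStronglyMeasurable g (volume.restrict (Ioo c d)) :=
    hg.1.mono_measure (Measure.restrict_mono (Ioo_subset_Ioo hc hd) le_rfl)
  rw [intervalIntegral.integral_of_le hcd, ← restrict_Ioo_eq_restrict_Ioc]
  have := integral_norm_sq_le (m1.sub m2) (Real.sqrt_nonneg ε) ?_
  · rwa [Real.sq_sqrt hε.le] at this
  have e3 : diffQuot h F - diffQuot k F = (diffQuot h F - g) -
      (diffQuot k F - g) := by abel
  rw [e3]
  refine (eLpNorm_sub_le (m1.sub mg) (m2.sub mg) (by norm_num)).trans ?_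
  refine (add_le_add e1 e2).trans ?_
  rw [← ENNReal.ofReal_add (by positivity) (by positivity), add_halves]

end DiffQuot

/-! ### Inner products and squared norms of primitives. -/

section Energy

variable {H : Type*} [NormedAddCommGroup H] [InnerProductSpace ℝ H] [CompleteSpace H]

theorem IsPrim.innerProd {c d : ℝ} {f g f' g' : ℝ → H} (h : IsPrim c d f g)
    (h' : IsPrim c d f' g') (hcd : c ≤ d) :
    IsPrim c d (fun t => inner ℝ (f t) (f' t))
      (fun t => inner ℝ (g t) (f' t) + inner ℝ (f t) (g' t)) :=
  h.bilin h' hcd (innerSL ℝ)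

theorem IsPrim.norm_sq {c d : ℝ} {f g : ℝ → H} (h : IsPrim c d f g) (hcd : c ≤ d) :
    IsPrim c d (fun t => ‖f t‖ ^ 2) (fun t => 2 * inner ℝ (g t) (f t)) := by
  have := h.innerProd h hcd
  simp only [real_inner_self_eq_norm_sq] at this
  refine this.congr hcd (fun _ _ => rfl) (ae_of_all _ fun t => ?_)
  simp only
  rw [real_inner_comm (g t)]
  ring

end Energy

section Momentum

variable {a b : ℝ}

/-- Let `w` be the difference of the quotients of `V` with steps `h` and `k`, and `Γ`, `w_x` the
same expressions for `G`, `Vx`. Testing the equation with `w` itself bounds `d/dt ‖w‖²` by `‖Γ‖² +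
‖w_x‖²`, which has small integral because `G` and `Vx` are primitives of square integrable curves.
As `‖w‖²` is also small on average, it is small at every time. This is the argument for `L²(H¹₀) ∩
H¹(H⁻¹) ⊂ C(L²)`, applied to `u_tt` without dual spaces. -/
theorem slope_cauchy_of_momentum {T : ℝ} (hT : 0 < T) {V Vx P Px G g : ℝ → L2 a b}
    (hV : IsPrim 0 T V P) (hVx : IsPrim 0 T Vx Px) (hG : IsPrim 0 T G g)
    (mP : MemLp P 2 (volume.restrict (Ioo 0 T))) (mPx : MemLp Px 2 (volume.restrict (Ioo 0 T)))
    (mg : MemLp g 2 (volume.restrict (Ioo 0 T)))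
    (hdx : ∀ t ∈ Icc 0 T, HasDx0 (V t) (Vx t))
    (hmom : ∀ᵐ t ∂volume.restrict (Ioo 0 T), ∀ v w : L2 a b, HasDx0 v w →
      inner ℝ (P t) v = -inner ℝ (G t) w) {ε : ℝ} (hε : 0 < ε) :
    ∃ δ > 0, ∀ t ∈ Icc 0 T, ∀ r ∈ Icc 0 T, ∀ s ∈ Icc 0 T, r ≠ t → s ≠ t →
      |r - t| < δ → |s - t| < δ → ‖slope V t r - slope V t s‖ ≤ ε := by
  -- Averaging over an interval of length `d - c ≥ T / 2` costs a factor `1 / (d - c)`, absorbed by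
  -- the minimum; three contributions of at most `ε ^ 2 / 3` remain.
  set η := ε ^ 2 / 3 * min 1 (T / 2)
  have hη : 0 < η := by positivity
  obtain ⟨δ1, hδ1, H1⟩ := hV.integral_diffQuot_sub_le mP hη
  obtain ⟨δ2, hδ2, H2⟩ := hVx.integral_diffQuot_sub_le mPx hη
  obtain ⟨δ3, hδ3, H3⟩ := hG.integral_diffQuot_sub_le mg hη
  refine ⟨min (min δ1 δ2) (min δ3 (T / 4)), by positivity, fun t ht r hr s hs hrt hst h1 h2 => ?_⟩
  obtain ⟨h, rfl⟩ : ∃ h, r = t + h := ⟨r - t, by ring⟩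
  obtain ⟨k, rfl⟩ : ∃ k, s = t + k := ⟨s - t, by ring⟩
  simp only [add_sub_cancel_left, lt_min_iff] at h1 h2
  have h0 : h ≠ 0 := fun h0 => hrt (by simp [h0])
  have k0 : k ≠ 0 := fun h0 => hst (by simp [h0])
  have hh := abs_lt.1 h1.2.2
  have hk := abs_lt.1 h2.2.2
  -- An interval containing `t` on which both shifts stay inside `[0, T]`; steps below `T / 4` leave
  -- it a length of at least `T / 2`.
  obtain ⟨c, d, hc, hd, hch, hdh, hck, hdk, hct, htd, hcd⟩ : ∃ c d : ℝ, 0 ≤ c ∧ d ≤ T ∧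
      0 ≤ c + h ∧ d + h ≤ T ∧ 0 ≤ c + k ∧ d + k ≤ T ∧ c ≤ t ∧ t ≤ d ∧ T / 2 ≤ d - c := by
    refine ⟨max 0 (max (-h) (-k)), min T (min (T - h) (T - k)), le_max_left _ _, min_le_left _ _,
      ?_, ?_, ?_, ?_, ?_, ?_, ?_⟩
    · linarith [(le_max_left (-h) (-k)).trans (le_max_right 0 _)]
    · linarith [(min_le_right T _).trans (min_le_left (T - h) (T - k))]
    · linarith [(le_max_right (-h) (-k)).trans (le_max_right 0 _)]
    · linarith [(min_le_right T _).trans (min_le_right (T - h) (T - k))]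
    · exact max_le ht.1 (max_le (by linarith [hr.1]) (by linarith [hs.1]))
    · exact le_min ht.2 (le_min (by linarith [hr.2]) (by linarith [hs.2]))
    · have e1 : max 0 (max (-h) (-k)) ≤ T / 4 := max_le (by positivity)
        (max_le (by linarith) (by linarith))
      have e2 : T - T / 4 ≤ min T (min (T - h) (T - k)) := le_min (by linarith)
        (le_min (by linarith) (by linarith))
      linarith
  have hcd' : c ≤ d := hct.trans htd
  have e1 := H1 h h0 h1.1.1 k k0 h2.1.1 c d hc hcd' hd hch hdh hck hdk
  have e2 := H2 h h0 h1.1.2 k k0 h2.1.2 c d hc hcd' hd hch hdh hck hdk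
  have e3 := H3 h h0 h1.2.1 k k0 h2.2.1 c d hc hcd' hd hch hdh hck hdk
  have pV := (hV.diffQuotient hc hcd' hd hch hdh).sub (hV.diffQuotient hc hcd' hd hck hdk)
  have pVx := (hVx.diffQuotient hc hcd' hd hch hdh).sub (hVx.diffQuotient hc hcd' hd hck hdk)
  have pG := (hG.diffQuotient hc hcd' hd hch hdh).sub (hG.diffQuotient hc hcd' hd hck hdk)
  set w := fun t => diffQuot h V t - diffQuot k V t
  set wx := fun t => diffQuot h Vx t - diffQuot k Vx t
  set W := fun t => diffQuot h P t - diffQuot k P t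
  set Γ := fun t => diffQuot h G t - diffQuot k G t
  have hI : ∀ {f : ℝ → ℝ}, ContinuousOn f (Icc c d) → ∀ x ∈ Icc c d, ∀ y ∈ Icc c d,
      IntervalIntegrable f volume x y := fun {f} hf x hx y hy =>
    (hf.mono (uIcc_subset_Icc hx hy)).intervalIntegrable
  have cΓ : ContinuousOn (fun t => ‖Γ t‖ ^ 2) (Icc c d) := pG.continuousOn.norm.pow 2
  have cwx : ContinuousOn (fun t => ‖wx t‖ ^ 2) (Icc c d) := pVx.continuousOn.norm.pow 2
  have cw : ContinuousOn (fun t => ‖w t‖ ^ 2) (Icc c d) := pV.continuousOn.norm.pow 2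
  have hw : ∀ᵐ s ∂volume.restrict (Ioo c d), |2 * inner ℝ (W s) (w s)| ≤
      ‖Γ s‖ ^ 2 + ‖wx s‖ ^ 2 := by
    filter_upwards [ae_restrict_of_ae_restrict_of_subset (Ioo_subset_Ioo hc hd) hmom,
      ae_comp_add hmom hch hdh, ae_comp_add hmom hck hdk, ae_restrict_mem measurableSet_Ioo]
      with s q1 q2 q3 hsm
    have d1 := hdx s ⟨hc.trans hsm.1.le, hsm.2.le.trans hd⟩
    have d2 := hdx (s + h) ⟨by linarith [hsm.1], by linarith [hsm.2]⟩
    have d3 := hdx (s + k) ⟨by linarith [hsm.1], by linarith [hsm.2]⟩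
    have dw : HasDx0 (w s) (wx s) := ((d2.sub d1).smul h⁻¹).sub ((d3.sub d1).smul k⁻¹)
    have e : inner ℝ (W s) (w s) = -inner ℝ (Γ s) (wx s) := by
      have f1 := q1 _ _ dw
      have f2 := q2 _ _ dw
      have f3 := q3 _ _ dw
      simp only [W, Γ, diffQuot, inner_sub_left, inner_smul_left, f1, f2, f3]
      simp
      ring
    rw [e, mul_neg, abs_neg, abs_mul, abs_two]
    have := abs_real_inner_le_norm (Γ s) (wx s)
    nlinarith [sq_nonneg (‖Γ s‖ - ‖wx s‖)]
  have hst : ∀ s ∈ Icc c d, ‖w t‖ ^ 2 ≤ ‖w s‖ ^ 2 + 2 * η := by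
    intro s hs
    have n1 := (pV.norm_sq hcd').sub_eq hs ⟨hct, htd⟩
    have n2 : |∫ r in s..t, 2 * inner ℝ (W r) (w r)| ≤ 2 * η := by
      rw [← Real.norm_eq_abs]
      refine intervalIntegral.norm_integral_le_integral_norm_uIoc.trans ?_
      have hsub : uIoc s t ⊆ Ioc c d := by
        rw [uIoc]
        exact Ioc_subset_Ioc (le_min hs.1 hct) (max_le hs.2 htd)
      have hint : IntegrableOn (fun r => ‖2 * inner ℝ (W r) (w r)‖) (Ioc c d) :=
        (pV.norm_sq hcd').1.1.norm
      refine (setIntegral_mono_set hint (ae_of_all _ fun _ => norm_nonneg _)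
        hsub.eventuallyLE).trans ?_
      rw [← intervalIntegral.integral_of_le hcd']
      have hcm : c ∈ Icc c d := ⟨le_rfl, hcd'⟩
      have hdm : d ∈ Icc c d := ⟨hcd', le_rfl⟩
      refine (intervalIntegral.integral_mono_ae_restrict hcd' (pV.norm_sq hcd').1.norm
        ((hI cΓ c hcm d hdm).add (hI cwx c hcm d hdm)) ?_).trans ?_
      · rw [← restrict_Ioo_eq_restrict_Icc]
        exact hw
      · rw [intervalIntegral.integral_add (hI cΓ c hcm d hdm) (hI cwx c hcm d hdm)]
        linarith
    have := (le_abs_self _).trans n2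
    linarith
  have havg : (d - c) * ‖w t‖ ^ 2 ≤ η + (d - c) * (2 * η) := by
    have hcm : c ∈ Icc c d := ⟨le_rfl, hcd'⟩
    have hdm : d ∈ Icc c d := ⟨hcd', le_rfl⟩
    have := intervalIntegral.integral_mono_on hcd' (by simp)
      ((hI cw c hcm d hdm).add (by simp)) hst
    rw [intervalIntegral.integral_add (hI cw c hcm d hdm) (by simp),
      intervalIntegral.integral_const, intervalIntegral.integral_const, smul_eq_mul,
      smul_eq_mul] at this
    linarith
  have hfin : ‖w t‖ ^ 2 ≤ ε ^ 2 := by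
    have a1 : η ≤ ε ^ 2 / 3 := by
      have : min 1 (T / 2) ≤ 1 := min_le_left _ _
      have h3 : 0 ≤ ε ^ 2 / 3 := by positivity
      calc η ≤ ε ^ 2 / 3 * 1 := mul_le_mul_of_nonneg_left this h3
        _ = _ := mul_one _
    have a2 : η ≤ ε ^ 2 / 3 * (d - c) := by
      have : min 1 (T / 2) ≤ d - c := (min_le_right _ _).trans hcd
      exact mul_le_mul_of_nonneg_left this (by positivity)
    have hpos : 0 < d - c := by linarith
    have : (d - c) * ‖w t‖ ^ 2 ≤ (d - c) * ε ^ 2 := by nlinarith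
    exact le_of_mul_le_mul_left this hpos
  have := abs_le_of_sq_le_sq hfin hε.le
  rw [abs_of_nonneg (norm_nonneg _)] at this
  simpa [slope_def_module, w, diffQuot] using this

variable {T ν μ : ℝ} {u₀ u₁ θ₀ : L2 a b} {U Ux V Vx P Px Θ Θt Θtt Θx : ℝ → L2 a b}

/-- Moving the derivative off `θ` produces the flux `u_x + ν u_tx - μ θ`, which is a primitive in
time, a property not available for `θ_x`. -/
theorem StrongSol.momentum' (h : StrongSol T ν μ u₀ u₁ θ₀ U Ux V Vx P Px Θ Θt Θtt Θx) :
    ∀ᵐ t ∂volume.restrict (Ioo 0 T), ∀ v w : L2 a b, HasDx0 v w →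
      inner ℝ (P t) v = -inner ℝ (Ux t + ν • Vx t - μ • Θ t) w := by
  filter_upwards [h.momentum, h.dxΘ] with t h1 h2 v w hvw
  have e1 := h1 v w hvw
  have e2 := h2.inner_right hvw
  rw [inner_sub_left, inner_add_left, inner_smul_left, inner_smul_left]
  simp only [conj_trivial]
  rw [e2]
  linarith

theorem memLp_of_continuousOn {k : ℝ → L2 a b} (hk : ContinuousOn k (Icc 0 T)) (p : ℝ≥0∞) :
    MemLp k p (volume.restrict (Ioo 0 T)) := by
  obtain ⟨M, hM⟩ := isCompact_Icc.exists_bound_of_continuousOn hk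
  refine MemLp.of_bound ((hk.mono Ioo_subset_Icc_self).aestronglyMeasurable measurableSet_Ioo) M ?_
  filter_upwards [ae_restrict_mem measurableSet_Ioo] with t ht
  exact hM t (Ioo_subset_Icc_self ht)

/-- `u_t` is continuously differentiable. -/
theorem StrongSol.exists_utt (hT : 0 < T)
    (h : StrongSol T ν μ u₀ u₁ θ₀ U Ux V Vx P Px Θ Θt Θtt Θx) :
    ∃ Q : ℝ → L2 a b, ContinuousOn Q (Icc 0 T) ∧
      (∀ t ∈ Icc 0 T, HasDerivWithinAt V (Q t) (Icc 0 T) t) ∧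
      Q =ᵐ[volume.restrict (Ioo 0 T)] P := by
  have hG := (h.hUx.add (h.hVx.const_smul ν)).sub (h.hΘ.const_smul μ)
  have mg : MemLp (fun t => Vx t + ν • Px t - μ • Θt t) 2 (volume.restrict (Ioo 0 T)) :=
    ((memLp_of_continuousOn h.hVx.continuousOn 2).add (h.memPx.const_smul ν)).sub
      ((memLp_of_continuousOn h.hΘt.continuousOn 2).const_smul μ)
  obtain ⟨Q, hQ, hQ'⟩ := exists_hasDerivWithinAt_of_slope hT (fun ε hε =>
    slope_cauchy_of_momentum hT h.hV h.hVx hG h.memP h.memPx mg h.dxV h.momentum' hε)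
  refine ⟨Q, hQ, hQ', ?_⟩
  rw [EventuallyEq, ae_restrict_iff' measurableSet_Ioo]
  filter_upwards [h.hV.ae_hasDerivAt] with t ht htm
  exact ((hQ' t (Ioo_subset_Icc_self htm)).hasDerivAt (Icc_mem_nhds htm.1 htm.2)).unique (ht htm)

end Momentum

/-! ### Energy estimates -/

theorem IsPrim.le_add_integral {c d : ℝ} {F g k : ℝ → ℝ} (hF : IsPrim c d F g)
    (hk : IntervalIntegrable k volume c d) (h : ∀ᵐ t ∂volume.restrict (Ioo c d), g t ≤ k t)
    {t : ℝ} (ht : t ∈ Icc c d) : F t ≤ F c + ∫ s in c..t, k s := by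
  have hc : c ∈ Icc c d := ⟨le_rfl, ht.1.trans ht.2⟩
  have hkt : IntervalIntegrable k volume c t := (isPrim_integral hk (0 : ℝ)).intervalIntegrable hc ht
  rw [hF.2 t ht]
  have := intervalIntegral.integral_mono_ae_restrict ht.1 (hF.intervalIntegrable hc ht) hkt (by
    rw [← restrict_Ioo_eq_restrict_Icc]
    exact ae_restrict_of_ae_restrict_of_subset (Ioo_subset_Ioo_right ht.2) h)
  linarith

/-- Gronwall's inequality for an energy with dissipation. -/
theorem energy_gronwall {c d : ℝ} {F g D k : ℝ → ℝ} (hcd : c ≤ d) (hF : IsPrim c d F g)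
    (hD : IntervalIntegrable D volume c d) (hD0 : ∀ t, 0 ≤ D t)
    (hk : IntervalIntegrable k volume c d) (hk0 : ∀ t, 0 ≤ k t)
    (h : ∀ᵐ t ∂volume.restrict (Ioo c d), g t + D t ≤ k t * F t) {t : ℝ} (ht : t ∈ Icc c d) :
    F t + ∫ s in c..t, D s ≤ F c * Real.exp (∫ s in c..t, k s) := by
  have hD' := isPrim_integral hD (0 : ℝ)
  have hφ := hF.add hD'
  have hc : c ∈ Icc c d := ⟨le_rfl, hcd⟩
  have hD0' : ∀ t ∈ Icc c d, 0 ≤ 0 + ∫ s in c..t, D s := fun t ht => by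
    rw [zero_add]
    exact intervalIntegral.integral_nonneg ht.1 fun s _ => hD0 s
  have hkφ : IntervalIntegrable (fun s => k s * (F s + (0 + ∫ r in c..s, D r))) volume c d :=
    hk.mul_continuousOn (by rw [uIcc_of_le hcd]; exact hφ.continuousOn)
  -- Gronwall is applied to `F + ∫ D`; as `D ≥ 0`, replacing `F` by this sum on the right only
  -- weakens the hypothesis.
  have := gronwall_integral (C := F c) hcd hφ.continuousOn hk (ae_of_all _ hk0) (fun t ht => ?_) ht
  · simpa using this
  · have h2 := hφ.le_add_integral hkφ (by
      filter_upwards [h, ae_restrict_mem measurableSet_Ioo] with s hs hsm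
      refine hs.trans (mul_le_mul_of_nonneg_left ?_ (hk0 s))
      linarith [hD0' s (Ioo_subset_Icc_self hsm)]) ht
    simpa using h2

section Est

variable {a b T ν μ : ℝ} {u₀ u₁ θ₀ : L2 a b} {U Ux V Vx P Px Θ Θt Θtt Θx : ℝ → L2 a b}

theorem intervalIntegrable_norm_sq {E : Type*} [NormedAddCommGroup E] {k : ℝ → E} (hT : 0 ≤ T)
    (hk : MemLp k 2 (volume.restrict (Ioo 0 T))) :
    IntervalIntegrable (fun t => ‖k t‖ ^ 2) volume 0 T :=
  (intervalIntegrable_iff_integrableOn_Ioo_of_le hT).2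
    ((memLp_two_iff_integrable_norm_sq hk.1).1 hk)

/-- Momentum is tested with `u_t` and heat with `1`; the coupling terms `μ ∫ θ_x u_t` and `μ ∫ θ
u_tx` cancel by parts. Because `θ ≥ 0`, the term `∫ θ` may be dropped at time `t`, and the viscous
dissipation is bounded by the data. -/
theorem StrongSol.energy_le (hab : a < b) (hT : 0 < T)
    (h : StrongSol T ν μ u₀ u₁ θ₀ U Ux V Vx P Px Θ Θt Θtt Θx) {t : ℝ} (ht : t ∈ Icc 0 T) :
    ν * ∫ s in 0..t, ‖Vx s‖ ^ 2 ≤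
      (‖u₁‖ ^ 2 + ‖Ux 0‖ ^ 2) / 2 + inner ℝ θ₀ (oneL2 a b) := by
  have h1 := (((h.hV.norm_sq hT.le).add (h.hUx.norm_sq hT.le)).const_smul (1 / 2)).add
    (h.hΘ.innerProd (isPrim_const 0 T (oneL2 a b)) hT.le)
  have hi : IntervalIntegrable (fun s => -ν * ‖Vx s‖ ^ 2) volume 0 T :=
    ((h.hVx.continuousOn.norm.pow 2).intervalIntegrable_of_Icc hT.le).const_mul _
  have h2 := h1.le_add_integral hi (by
    filter_upwards [h.momentum, h.heat, h.dxΘ, ae_restrict_mem measurableSet_Ioo]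
      with s e1 e2 e3 hs
    have dV := h.dxV s (Ioo_subset_Icc_self hs)
    have f1 := e1 _ _ dV
    have f2 := e2 _ _ (hasDx_oneL2 hab)
    have f3 := e3.inner_right dV
    rw [tri_oneL2, inner_zero_right] at f2
    rw [real_inner_self_eq_norm_sq] at f1
    rw [real_inner_comm (Vx s) (Ux s)] at f1
    rw [f3] at f2
    simp only [smul_eq_mul, inner_zero_right]
    linarith) ht
  have h3 : 0 ≤ inner ℝ (Θ t) (oneL2 a b) := by
    obtain ⟨s, hs, hst⟩ := exists_seq_tendsto_of_ae h.nonneg ht hT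
    have hst' : Tendsto s atTop (𝓝[Icc 0 T] t) :=
      tendsto_nhdsWithin_iff.2 ⟨hst, Eventually.of_forall fun n => Ioo_subset_Icc_self (hs n).1⟩
    exact ge_of_tendsto' (((h.hΘ.continuousOn t ht).tendsto.comp hst').inner
      (tendsto_const_nhds (x := oneL2 a b))) fun n => inner_oneL2_nonneg (hs n).2
  simp only [smul_eq_mul, intervalIntegral.integral_const_mul, h.initV, h.initΘ] at h2
  have := sq_nonneg ‖V t‖
  have := sq_nonneg ‖Ux t‖
  linarith

/-- The heat equation is tested with `θ`, one factor `θ` of the cubic term being estimated in `L^∞`.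
Young's inequality spends half of the dissipation `2 ‖θ_x‖²`; the other half stays on the left. -/
theorem StrongSol.theta_le (hab : a < b) (hT : 0 < T) (hμ : 0 < μ)
    (h : StrongSol T ν μ u₀ u₁ θ₀ U Ux V Vx P Px Θ Θt Θtt Θx) {t : ℝ} (ht : t ∈ Icc 0 T) :
    ‖Θ t‖ ^ 2 + ∫ s in 0..t, ‖Θx s‖ ^ 2 ≤
      ‖θ₀‖ ^ 2 * Real.exp (t + 2 * (μ * embC a b) ^ 2 * ∫ s in 0..t, ‖Vx s‖ ^ 2) := by
  have h1 := h.hΘ.norm_sq hT.le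
  have hV := (h.hVx.continuousOn.norm.pow 2).intervalIntegrable_of_Icc (μ := volume) hT.le
  have hc := embC_pos hab
  set c := embC a b
  have hi : IntervalIntegrable (fun s => 1 + 2 * (μ * c) ^ 2 * ‖Vx s‖ ^ 2) volume 0 T :=
    (intervalIntegrable_const).add (hV.const_mul _)
  have h2 := energy_gronwall hT.le h1
    (intervalIntegrable_norm_sq hT.le h.memΘx) (fun _ => sq_nonneg _)
    (k := fun s => 1 + 2 * (μ * c) ^ 2 * ‖Vx s‖ ^ 2) hi (fun s => by positivity) (by
      filter_upwards [h.heat, h.dxΘ] with s e1 e2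
      have f1 := e1 _ _ e2
      have f2 := e2.abs_tri_le hab (Vx s) (Θ s)
      rw [real_inner_self_eq_norm_sq] at f1
      have f3 := neg_abs_le (tri (Θ s) (Vx s) (Θ s))
      have n1 := norm_nonneg (Θ s)
      have n2 := norm_nonneg (Θx s)
      have n3 := norm_nonneg (Vx s)
      generalize ‖Θ s‖ = e at *
      generalize ‖Θx s‖ = X at *
      generalize ‖Vx s‖ = v at *
      have f4 : -(μ * tri (Θ s) (Vx s) (Θ s)) ≤ μ * (c * (e + X) * v * e) := by
        have := mul_le_mul_of_nonneg_left (show -tri (Θ s) (Vx s) (Θ s) ≤ c * (e + X) * v * e by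
          linarith) hμ.le
        linarith
      have f5 : 2 * (μ * (c * (e + X) * v * e)) ≤ X ^ 2 + (1 + 2 * (μ * c) ^ 2 * v ^ 2) * e ^ 2 := by
        nlinarith [sq_nonneg (X - μ * c * v * e), sq_nonneg (e - μ * c * v * e)]
      linarith) ht
  have ht0 : IntervalIntegrable (fun s => ‖Vx s‖ ^ 2) volume 0 t :=
    (isPrim_integral hV (0 : ℝ)).intervalIntegrable ⟨le_rfl, hT.le⟩ ht
  rw [intervalIntegral.integral_add intervalIntegrable_const (ht0.const_mul _),
    intervalIntegral.integral_const_mul, h.initΘ] at h2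
  simpa using h2

/-- The sum of the squares of the norms of the difference quotients. -/
def quotEnergy (h : ℝ) (V Ux Θ : ℝ → L2 a b) (t : ℝ) : ℝ :=
  ‖diffQuot h V t‖ ^ 2 + ‖diffQuot h Ux t‖ ^ 2 + ‖diffQuot h Θ t‖ ^ 2

/-- The growth constant in the estimate of the difference quotients. -/
def growthC (a b μ : ℝ) : ℝ := 2 + 8 * μ ^ 2 + 26 * (μ * embC a b) ^ 2

/-- Here `p, q, z, Z, w` are the norms of the difference quotients of `u_t, u_x, θ, θ_x, u_tx`, and
`α, e, X` those of `u_tx, θ, θ_x`. Each of the four products with a factor `Z` is split so as to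
spend `Z ^ 2 / 16`, which leaves more than half of the dissipation. The viscous term has the good
sign and is dropped, so no `ν` enters the constant. -/
theorem growth_algebra {μ c p q z Z α e X ν w J : ℝ} (hμ : 0 < μ) (hc : 0 < c) (hν : 0 < ν)
    (hJ : J ≤ -(ν * w ^ 2) - Z ^ 2 + μ * (Z * p) + μ * (c * (z + Z) * α * z) +
      μ * (c * (z + Z) * p * X + c * (e + X) * p * Z)) :
    2 * J + Z ^ 2 ≤ (2 + 8 * μ ^ 2 + 26 * (μ * c) ^ 2) * (1 + α ^ 2 + e ^ 2 + X ^ 2) *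
      (p ^ 2 + q ^ 2 + z ^ 2) := by
  have hνw : 0 ≤ ν * w ^ 2 := by positivity
  have h1 : μ * (Z * p) ≤ Z ^ 2 / 16 + 4 * μ ^ 2 * p ^ 2 := by
    nlinarith [sq_nonneg (Z - 8 * (μ * p))]
  have h2 : μ * c * α * z ^ 2 ≤ (1 + (μ * c) ^ 2 * α ^ 2) * z ^ 2 / 2 := by
    nlinarith [sq_nonneg (z - μ * c * α * z)]
  have h3 : μ * c * α * z * Z ≤ Z ^ 2 / 16 + 4 * (μ * c) ^ 2 * α ^ 2 * z ^ 2 := by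
    nlinarith [sq_nonneg (Z - 8 * (μ * c * α * z))]
  have h4 : μ * c * z * p * X ≤ z ^ 2 / 2 + (μ * c) ^ 2 * X ^ 2 * p ^ 2 / 2 := by
    nlinarith [sq_nonneg (z - μ * c * X * p)]
  have h5 : μ * c * Z * p * X ≤ Z ^ 2 / 16 + 4 * (μ * c) ^ 2 * X ^ 2 * p ^ 2 := by
    nlinarith [sq_nonneg (Z - 8 * (μ * c * X * p))]
  have h6 : μ * c * e * p * Z ≤ Z ^ 2 / 16 + 4 * (μ * c) ^ 2 * e ^ 2 * p ^ 2 := by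
    nlinarith [sq_nonneg (Z - 8 * (μ * c * e * p))]
  have hsum : J ≤ - Z ^ 2 / 2 + (4 * μ ^ 2 * p ^ 2 + (1 + (μ * c) ^ 2 * α ^ 2) * z ^ 2 / 2 +
      4 * (μ * c) ^ 2 * α ^ 2 * z ^ 2 + z ^ 2 / 2 + (μ * c) ^ 2 * X ^ 2 * p ^ 2 / 2 +
      8 * (μ * c) ^ 2 * X ^ 2 * p ^ 2 + 4 * (μ * c) ^ 2 * e ^ 2 * p ^ 2) := by
    nlinarith [sq_nonneg Z]
  have hb : 2 * (4 * μ ^ 2 * p ^ 2 + (1 + (μ * c) ^ 2 * α ^ 2) * z ^ 2 / 2 +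
      4 * (μ * c) ^ 2 * α ^ 2 * z ^ 2 + z ^ 2 / 2 + (μ * c) ^ 2 * X ^ 2 * p ^ 2 / 2 +
      8 * (μ * c) ^ 2 * X ^ 2 * p ^ 2 + 4 * (μ * c) ^ 2 * e ^ 2 * p ^ 2) ≤
      (2 + 8 * μ ^ 2 + 26 * (μ * c) ^ 2) * (1 + α ^ 2 + e ^ 2 + X ^ 2) *
      (p ^ 2 + q ^ 2 + z ^ 2) := by
    rw [← sub_nonneg]
    have : (2 + 8 * μ ^ 2 + 26 * (μ * c) ^ 2) * (1 + α ^ 2 + e ^ 2 + X ^ 2) *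
      (p ^ 2 + q ^ 2 + z ^ 2) - 2 * (4 * μ ^ 2 * p ^ 2 + (1 + (μ * c) ^ 2 * α ^ 2) * z ^ 2 / 2 +
      4 * (μ * c) ^ 2 * α ^ 2 * z ^ 2 + z ^ 2 / 2 + (μ * c) ^ 2 * X ^ 2 * p ^ 2 / 2 +
      8 * (μ * c) ^ 2 * X ^ 2 * p ^ 2 + 4 * (μ * c) ^ 2 * e ^ 2 * p ^ 2) =
      (2 + 8 * μ ^ 2 + 26 * (μ * c) ^ 2) * (1 + α ^ 2 + e ^ 2 + X ^ 2) * q ^ 2 +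
      p ^ 2 * (2 * (1 + α ^ 2 + e ^ 2 + X ^ 2) + 8 * μ ^ 2 * (α ^ 2 + e ^ 2 + X ^ 2) +
        (μ * c) ^ 2 * (26 + 26 * α ^ 2 + 18 * e ^ 2 + 9 * X ^ 2)) +
      z ^ 2 * (2 * (α ^ 2 + e ^ 2 + X ^ 2) + 8 * μ ^ 2 * (1 + α ^ 2 + e ^ 2 + X ^ 2) +
        (μ * c) ^ 2 * (26 + 17 * α ^ 2 + 26 * e ^ 2 + 26 * X ^ 2)) := by ring
    rw [this]
    positivity
  linarith

/-- The equations at times `s` and `s + r` are subtracted and tested with the quotients of `u_t` and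
`θ`. With `D` for the quotient, `D(θ u_tx) = Dθ · u_tx(· + r) + θ · D u_tx`; in the second term
`HasDx.tri_parts` takes the space derivative off `D u_tx`, leaving `D u_t`, which is part of the
energy. -/
theorem StrongSol.quotEnergy_le (hab : a < b) (hT : 0 < T) (hμ : 0 < μ) (hν : 0 < ν)
    (h : StrongSol T ν μ u₀ u₁ θ₀ U Ux V Vx P Px Θ Θt Θtt Θx) {d r : ℝ} (hr : 0 < r) (hd : 0 ≤ d)
    (hdr : d + r ≤ T) {t : ℝ} (ht : t ∈ Icc 0 d) :
    quotEnergy r V Ux Θ t + ∫ s in 0..t, ‖diffQuot r Θx s‖ ^ 2 ≤ quotEnergy r V Ux Θ 0 *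
      Real.exp (∫ s in 0..t, growthC a b μ *
        (1 + ‖Vx (s + r)‖ ^ 2 + ‖Θ s‖ ^ 2 + ‖Θx s‖ ^ 2)) := by
  have hdT : d ≤ T := by linarith
  have pV := h.hV.diffQuotient le_rfl hd hdT (by linarith) hdr
  have pU := h.hUx.diffQuotient le_rfl hd hdT (by linarith) hdr
  have pΘ := h.hΘ.diffQuotient le_rfl hd hdT (by linarith) hdr
  have hF := ((pV.norm_sq hd).add (pU.norm_sq hd)).add (pΘ.norm_sq hd)
  have hc := embC_pos hab
  have h0 : (0 : ℝ) ∈ Icc 0 T := ⟨le_rfl, hT.le⟩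
  have hM : 0 < growthC a b μ := by unfold growthC; positivity
  have mΘx : MemLp Θx 2 (volume.restrict (Ioo 0 d)) :=
    h.memΘx.mono_measure (Measure.restrict_mono (Ioo_subset_Ioo_right hdT) le_rfl)
  have mΘxr : MemLp (fun s => Θx (s + r)) 2 (volume.restrict (Ioo 0 d)) := by
    have hm := (measurePreserving_add_right volume r).restrict_preimage
      (s := Ioo r (d + r)) measurableSet_Ioo
    have he : (fun x => x + r) ⁻¹' Ioo r (d + r) = Ioo 0 d := by
      ext x; simp
    rw [he] at hm
    have h2 : MemLp Θx 2 (volume.restrict (Ioo r (d + r))) :=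
      h.memΘx.mono_measure (Measure.restrict_mono (Ioo_subset_Ioo hr.le hdr) le_rfl)
    exact h2.comp_measurePreserving hm
  have mD : MemLp (diffQuot r Θx) 2 (volume.restrict (Ioo 0 d)) := (mΘxr.sub mΘx).const_smul r⁻¹
  have cVr : ContinuousOn (fun s => ‖Vx (s + r)‖ ^ 2) (Icc 0 d) := by
    refine (h.hVx.continuousOn.comp (continuousOn_id.add continuousOn_const) ?_).norm.pow 2
    exact fun s hs => ⟨by simp; linarith [hs.1], by simp; linarith [hs.2]⟩
  have cΘ : ContinuousOn (fun s => ‖Θ s‖ ^ 2) (Icc 0 d) :=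
    (h.hΘ.continuousOn.mono (Icc_subset_Icc_right hdT)).norm.pow 2
  have hk : IntervalIntegrable (fun s => growthC a b μ *
      (1 + ‖Vx (s + r)‖ ^ 2 + ‖Θ s‖ ^ 2 + ‖Θx s‖ ^ 2)) volume 0 d :=
    (((intervalIntegrable_const.add (cVr.intervalIntegrable_of_Icc hd)).add
      (cΘ.intervalIntegrable_of_Icc hd)).add (intervalIntegrable_norm_sq hd mΘx)).const_mul _
  refine energy_gronwall hd hF
    (intervalIntegrable_norm_sq hd mD) (fun _ => sq_nonneg _) hk (fun s => by positivity) ?_ ht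
  filter_upwards [ae_restrict_of_ae_restrict_of_subset (Ioo_subset_Ioo_right hdT) h.momentum,
    ae_restrict_of_ae_restrict_of_subset (Ioo_subset_Ioo_right hdT) h.heat,
    ae_restrict_of_ae_restrict_of_subset (Ioo_subset_Ioo_right hdT) h.dxΘ,
    ae_comp_add (c := 0) h.momentum (by linarith) hdr, ae_comp_add (c := 0) h.heat (by linarith) hdr,
    ae_comp_add (c := 0) h.dxΘ (by linarith) hdr, ae_restrict_mem measurableSet_Ioo]
    with s m1 q1 x1 m2 q2 x2 hs
  have dv1 := h.dxV s ⟨hs.1.le, hs.2.le.trans hdT⟩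
  have dv2 := h.dxV (s + r) ⟨by linarith [hs.1], by linarith [hs.2]⟩
  have dV : HasDx0 (diffQuot r V s) (diffQuot r Vx s) := (dv2.sub dv1).smul r⁻¹
  have dΘ : HasDx (diffQuot r Θ s) (diffQuot r Θx s) := (x2.sub x1).smul r⁻¹
  have eqm : inner ℝ (diffQuot r P s) (diffQuot r V s) +
      inner ℝ (diffQuot r Vx s) (diffQuot r Ux s) + ν * ‖diffQuot r Vx s‖ ^ 2 +
      μ * inner ℝ (diffQuot r Θx s) (diffQuot r V s) = 0 := by
    have f1 := m1 _ _ dV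
    have f2 := m2 _ _ dV
    rw [← real_inner_self_eq_norm_sq, real_inner_comm (diffQuot r Ux s)]
    have e1 : ∀ (F : ℝ → L2 a b) (v : L2 a b), inner ℝ (diffQuot r F s) v =
        r⁻¹ * (inner ℝ (F (s + r)) v - inner ℝ (F s) v) := by
      intro F v
      rw [diffQuot, inner_smul_left, inner_sub_left]
      simp
    rw [e1 P, e1 Ux, e1 Vx, e1 Θx]
    linear_combination r⁻¹ * f2 - r⁻¹ * f1
  have eqh : inner ℝ (diffQuot r Θt s) (diffQuot r Θ s) + ‖diffQuot r Θx s‖ ^ 2 +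
      μ * (tri (diffQuot r Θ s) (Vx (s + r)) (diffQuot r Θ s) -
        (tri (diffQuot r Θ s) (diffQuot r V s) (Θx s) +
          tri (Θ s) (diffQuot r V s) (diffQuot r Θx s))) = 0 := by
    have f1 := q1 _ _ dΘ
    have f2 := q2 _ _ dΘ
    have f3 := x1.tri_parts dΘ dV hab
    have e1 : ∀ (F : ℝ → L2 a b) (v : L2 a b), inner ℝ (diffQuot r F s) v =
        r⁻¹ * (inner ℝ (F (s + r)) v - inner ℝ (F s) v) := by
      intro F v
      rw [diffQuot, inner_smul_left, inner_sub_left]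
      simp
    have e2 : ∀ g k : L2 a b, tri (diffQuot r Θ s) g k =
        r⁻¹ * (inner ℝ ((x2.memLp_mul hab g).toLp _) k - tri (Θ s) g k) := by
      intro g k
      rw [← x2.tri_eq hab]
      have i1 := x2.integrable_tri hab g k
      have i2 := x1.integrable_tri hab g k
      unfold tri
      rw [← integral_sub i1 i2, ← integral_const_mul]
      refine integral_congr_ae ?_
      filter_upwards [Lp.coeFn_smul r⁻¹ (Θ (s + r) - Θ s), Lp.coeFn_sub (Θ (s + r)) (Θ s)]
        with x y1 y2
      simp only [diffQuot, y1, Pi.smul_apply, y2, Pi.sub_apply, smul_eq_mul]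
      ring
    have e3 : tri (Θ s) (diffQuot r Vx s) (diffQuot r Θ s) =
        r⁻¹ * (tri (Θ s) (Vx (s + r)) (diffQuot r Θ s) - tri (Θ s) (Vx s) (diffQuot r Θ s)) := by
      rw [diffQuot, tri_swap, x1.tri_smul_right hab, tri_swap, x1.tri_sub_mid hab]
    have e4 := e2 (Vx (s + r)) (diffQuot r Θ s)
    rw [← x2.tri_eq hab] at e4
    rw [← real_inner_self_eq_norm_sq, e1 Θt, e1 Θx, ]
    rw [e3] at f3
    linear_combination r⁻¹ * f2 - r⁻¹ * f1 + μ * e4 - μ * f3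
  have c1 := abs_real_inner_le_norm (diffQuot r Θx s) (diffQuot r V s)
  have c2 := dΘ.abs_tri_le hab (Vx (s + r)) (diffQuot r Θ s)
  have c3 := dΘ.abs_tri_le hab (diffQuot r V s) (Θx s)
  have c4 := x1.abs_tri_le hab (diffQuot r V s) (diffQuot r Θx s)
  have key := growth_algebra (J := inner ℝ (diffQuot r P s) (diffQuot r V s) +
      inner ℝ (diffQuot r Vx s) (diffQuot r Ux s) + inner ℝ (diffQuot r Θt s) (diffQuot r Θ s))
      (q := ‖diffQuot r Ux s‖) (w := ‖diffQuot r Vx s‖) hμ hc hν (p := ‖diffQuot r V s‖)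
      (z := ‖diffQuot r Θ s‖) (Z := ‖diffQuot r Θx s‖) (α := ‖Vx (s + r)‖)
      (e := ‖Θ s‖) (X := ‖Θx s‖) (by
    have g1 := mul_le_mul_of_nonneg_left ((neg_abs_le _).trans' (neg_le_neg c1)) hμ.le
    have g2 := mul_le_mul_of_nonneg_left ((neg_abs_le _).trans' (neg_le_neg c2)) hμ.le
    have g3 := mul_le_mul_of_nonneg_left ((le_abs_self _).trans c3) hμ.le
    have g4 := mul_le_mul_of_nonneg_left ((le_abs_self _).trans c4) hμ.le
    linarith)
  refine le_trans (le_of_eq ?_) key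
  ring

end Est

/-! ### Passage to the limit in the difference quotients -/

theorem IsPrim.tendsto_diffQuot {E : Type*} [NormedAddCommGroup E] [NormedSpace ℝ E]
    [CompleteSpace E] {T : ℝ} {F g : ℝ → E} (hF : IsPrim 0 T F g)
    (hg : ContinuousOn g (Icc 0 T)) {t : ℝ} (ht : t ∈ Ico 0 T) :
    Tendsto (fun r => diffQuot r F t) (𝓝[>] 0) (𝓝 (g t)) := by
  have ht' : t ∈ Icc 0 T := Ico_subset_Icc_self ht
  rw [Metric.tendsto_nhds]
  intro ε hε
  obtain ⟨δ, hδ, H⟩ := Metric.continuousWithinAt_iff.1 (hg t ht') (ε / 2) (by positivity)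
  have h1 : ∀ᶠ r in 𝓝[>] (0 : ℝ), r < min δ (T - t) :=
    mem_nhdsWithin_of_mem_nhds (Iio_mem_nhds (lt_min hδ (sub_pos.2 ht.2)))
  filter_upwards [h1, self_mem_nhdsWithin] with r hr hr0
  have hr0' : (0 : ℝ) < r := hr0
  have hrδ := hr.trans_le (min_le_left _ _)
  have hrT := hr.trans_le (min_le_right _ _)
  have htr : t + r ∈ Icc 0 T := ⟨by linarith [ht.1], by linarith⟩
  have e1 : diffQuot r F t - g t = r⁻¹ • ∫ s in t..t + r, (g s - g t) := by
    rw [intervalIntegral.integral_sub (hF.intervalIntegrable ht' htr) (by simp),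
      intervalIntegral.integral_const, ← hF.sub_eq ht' htr, smul_sub, add_sub_cancel_left,
      smul_smul, inv_mul_cancel₀ hr0'.ne', one_smul, diffQuot]
  have e2 : ‖∫ s in t..t + r, (g s - g t)‖ ≤ ε / 2 * |t + r - t| := by
    refine intervalIntegral.norm_integral_le_of_norm_le_const fun s hs => ?_
    rw [uIoc_of_le (by linarith)] at hs
    rw [← dist_eq_norm]
    refine (H ⟨by linarith [ht.1, hs.1], by linarith [hs.2]⟩ ?_).le
    rw [Real.dist_eq, abs_of_nonneg (by linarith [hs.1])]
    linarith [hs.2]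
  rw [dist_eq_norm, e1, norm_smul, norm_inv, Real.norm_eq_abs, abs_of_pos hr0']
  rw [add_sub_cancel_left, abs_of_pos hr0'] at e2
  have : r⁻¹ * ‖∫ s in t..t + r, (g s - g t)‖ ≤ ε / 2 := by
    rw [inv_mul_le_iff₀ hr0']
    linarith
  linarith

section Limit

variable {a b T ν μ : ℝ} {u₀ u₁ θ₀ : L2 a b} {U Ux V Vx P Px Θ Θt Θtt Θx : ℝ → L2 a b}

/-- The bound of `‖θ‖²` in terms of a bound of `∫ ‖u_tx‖²`. -/
def thetaBd (a b μ : ℝ) (θ₀ : L2 a b) (K : ℝ) : ℝ :=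
  ‖θ₀‖ ^ 2 * Real.exp (1 + 2 * (μ * embC a b) ^ 2 * K)

/-- The growth factor of the differentiated energy in terms of a bound of `∫ ‖u_tx‖²`. -/
def growBd (a b μ : ℝ) (θ₀ : L2 a b) (K : ℝ) : ℝ :=
  Real.exp (growthC a b μ * (1 + K + 2 * thetaBd a b μ θ₀ K))

/-- The differentiated energy. -/
def derivEnergy (P Vx Θt : ℝ → L2 a b) (t : ℝ) : ℝ := ‖P t‖ ^ 2 + ‖Vx t‖ ^ 2 + ‖Θt t‖ ^ 2

theorem StrongSol.integral_Vx_mono (h : StrongSol T ν μ u₀ u₁ θ₀ U Ux V Vx P Px Θ Θt Θtt Θx)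
    {S x y : ℝ} (hST : S ≤ T) (hx : 0 ≤ x) (hxy : x ≤ y) (hy : y ≤ S) :
    ∫ s in x..y, ‖Vx s‖ ^ 2 ≤ ∫ s in 0..S, ‖Vx s‖ ^ 2 := by
  refine intervalIntegral.integral_mono_interval hx hxy hy (ae_of_all _ fun _ => sq_nonneg _) ?_
  exact ((h.hVx.continuousOn.mono (Icc_subset_Icc_right hST)).norm.pow 2).intervalIntegrable_of_Icc
    (by linarith)

theorem StrongSol.theta_le_thetaBd (hab : a < b) (hT : 0 < T) (hμ : 0 < μ)
    (h : StrongSol T ν μ u₀ u₁ θ₀ U Ux V Vx P Px Θ Θt Θtt Θx) {S K : ℝ} (hS1 : S ≤ 1) (hST : S ≤ T)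
    (hK : ∫ s in 0..S, ‖Vx s‖ ^ 2 ≤ K) {t : ℝ} (ht : t ∈ Icc 0 S) :
    ‖Θ t‖ ^ 2 + ∫ s in 0..t, ‖Θx s‖ ^ 2 ≤ thetaBd a b μ θ₀ K := by
  refine (h.theta_le hab hT hμ ⟨ht.1, ht.2.trans hST⟩).trans ?_
  unfold thetaBd
  have := (h.integral_Vx_mono hST le_rfl ht.1 ht.2).trans hK
  have h1 := ht.2.trans hS1
  gcongr

theorem StrongSol.norm_sq_theta_le (hab : a < b) (hT : 0 < T) (hμ : 0 < μ)
    (h : StrongSol T ν μ u₀ u₁ θ₀ U Ux V Vx P Px Θ Θt Θtt Θx) {S K : ℝ} (hS1 : S ≤ 1) (hST : S ≤ T)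
    (hK : ∫ s in 0..S, ‖Vx s‖ ^ 2 ≤ K) {t : ℝ} (ht : t ∈ Icc 0 S) :
    ‖Θ t‖ ^ 2 ≤ thetaBd a b μ θ₀ K := by
  have h1 := h.theta_le_thetaBd hab hT hμ hS1 hST hK ht
  have : 0 ≤ ∫ s in 0..t, ‖Θx s‖ ^ 2 := intervalIntegral.integral_nonneg ht.1 fun _ _ => sq_nonneg _
  linarith

theorem growthC_pos (a b μ : ℝ) : 0 < growthC a b μ := by
  unfold growthC
  positivity

/-- Over a time of at most `1`, the growth rate without its constant integrates to at most `1 + K +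
2 thetaBd`: `K` for `‖u_tx‖²`, and one `thetaBd` each for `‖θ‖²` and `‖θ_x‖²`. -/
theorem StrongSol.quotEnergy_le_growBd (hab : a < b) (hT : 0 < T) (hμ : 0 < μ) (hν : 0 < ν)
    (h : StrongSol T ν μ u₀ u₁ θ₀ U Ux V Vx P Px Θ Θt Θtt Θx) {S K : ℝ} (hS1 : S ≤ 1) (hST : S ≤ T)
    (hK : ∫ s in 0..S, ‖Vx s‖ ^ 2 ≤ K) {t r : ℝ} (ht : 0 ≤ t) (hr : 0 < r) (htr : t + r ≤ S) :
    quotEnergy r V Ux Θ t + ∫ s in 0..t, ‖diffQuot r Θx s‖ ^ 2 ≤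
      quotEnergy r V Ux Θ 0 * growBd a b μ θ₀ K := by
  refine (h.quotEnergy_le hab hT hμ hν hr ht (htr.trans hST) ⟨ht, le_rfl⟩).trans ?_
  have htT : t ≤ T := by linarith
  have hq : 0 ≤ quotEnergy r V Ux Θ 0 := by unfold quotEnergy; positivity
  refine mul_le_mul_of_nonneg_left (Real.exp_le_exp.2 ?_) hq
  have cVr : IntervalIntegrable (fun s => ‖Vx (s + r)‖ ^ 2) volume 0 t := by
    refine ContinuousOn.intervalIntegrable_of_Icc ht ?_
    refine (h.hVx.continuousOn.comp (continuousOn_id.add continuousOn_const) ?_).norm.pow 2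
    exact fun s hs => ⟨by simp; linarith [hs.1], by simp; linarith [hs.2]⟩
  have cΘ : IntervalIntegrable (fun s => ‖Θ s‖ ^ 2) volume 0 t :=
    ((h.hΘ.continuousOn.mono (Icc_subset_Icc_right htT)).norm.pow 2).intervalIntegrable_of_Icc ht
  have cΘx : IntervalIntegrable (fun s => ‖Θx s‖ ^ 2) volume 0 t :=
    intervalIntegrable_norm_sq ht
      (h.memΘx.mono_measure (Measure.restrict_mono (Ioo_subset_Ioo_right htT) le_rfl))
  rw [intervalIntegral.integral_const_mul, intervalIntegral.integral_add
    ((intervalIntegrable_const.add cVr).add cΘ) cΘx,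
    intervalIntegral.integral_add (intervalIntegrable_const.add cVr) cΘ,
    intervalIntegral.integral_add intervalIntegrable_const cVr]
  refine mul_le_mul_of_nonneg_left ?_ (growthC_pos a b μ).le
  have e1 : ∫ _ in (0 : ℝ)..t, (1 : ℝ) = t := by simp
  have e2 : ∫ s in 0..t, ‖Vx (s + r)‖ ^ 2 ≤ K := by
    rw [intervalIntegral.integral_comp_add_right (fun s => ‖Vx s‖ ^ 2)]
    exact (h.integral_Vx_mono hST (by linarith) (by linarith) htr).trans hK
  have hB : ∀ s ∈ Icc 0 t, ‖Θ s‖ ^ 2 ≤ thetaBd a b μ θ₀ K := fun s hs =>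
    h.norm_sq_theta_le hab hT hμ hS1 hST hK ⟨hs.1, by linarith [hs.2]⟩
  have hB0 : 0 ≤ thetaBd a b μ θ₀ K := by unfold thetaBd; positivity
  have e3 : ∫ s in 0..t, ‖Θ s‖ ^ 2 ≤ thetaBd a b μ θ₀ K := by
    refine (intervalIntegral.integral_mono_on ht cΘ intervalIntegrable_const hB).trans ?_
    rw [intervalIntegral.integral_const, smul_eq_mul, sub_zero]
    nlinarith
  have e4 : ∫ s in 0..t, ‖Θx s‖ ^ 2 ≤ thetaBd a b μ θ₀ K := by
    have := h.theta_le_thetaBd hab hT hμ hS1 hST hK (t := t) ⟨ht, by linarith⟩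
    have := sq_nonneg ‖Θ t‖
    linarith
  rw [e1]
  linarith

theorem StrongSol.tendsto_quotEnergy (h : StrongSol T ν μ u₀ u₁ θ₀ U Ux V Vx P Px Θ Θt Θtt Θx)
    (hP : ContinuousOn P (Icc 0 T)) {t : ℝ} (ht : t ∈ Ico 0 T) :
    Tendsto (fun r => quotEnergy r V Ux Θ t) (𝓝[>] 0) (𝓝 (derivEnergy P Vx Θt t)) :=
  (((h.hV.tendsto_diffQuot hP ht).norm.pow 2).add
    ((h.hUx.tendsto_diffQuot h.hVx.continuousOn ht).norm.pow 2)).add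
    ((h.hΘ.tendsto_diffQuot h.hΘt.continuousOn ht).norm.pow 2)

theorem StrongSol.derivEnergy_le (hab : a < b) (hT : 0 < T) (hμ : 0 < μ) (hν : 0 < ν)
    (h : StrongSol T ν μ u₀ u₁ θ₀ U Ux V Vx P Px Θ Θt Θtt Θx) (hP : ContinuousOn P (Icc 0 T))
    {S K : ℝ} (hS0 : 0 < S) (hS1 : S ≤ 1) (hST : S ≤ T)
    (hK : ∫ s in 0..S, ‖Vx s‖ ^ 2 ≤ K) {t : ℝ} (ht : t ∈ Icc 0 S) :
    derivEnergy P Vx Θt t ≤ derivEnergy P Vx Θt 0 * growBd a b μ θ₀ K := by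
  have hcont : ContinuousOn (derivEnergy P Vx Θt) (Icc 0 S) := by
    refine ContinuousOn.mono ?_ (Icc_subset_Icc_right hST)
    exact ((hP.norm.pow 2).add (h.hVx.continuousOn.norm.pow 2)).add
      (h.hΘt.continuousOn.norm.pow 2)
  have key : ∀ t ∈ Ico 0 S, derivEnergy P Vx Θt t ≤
      derivEnergy P Vx Θt 0 * growBd a b μ θ₀ K := by
    intro t ht
    refine le_of_tendsto_of_tendsto (h.tendsto_quotEnergy hP ⟨ht.1, ht.2.trans_le hST⟩)
      ((h.tendsto_quotEnergy hP ⟨le_rfl, hT⟩).mul_const _) ?_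
    have h1 : ∀ᶠ r in 𝓝[>] (0 : ℝ), r < S - t :=
      mem_nhdsWithin_of_mem_nhds (Iio_mem_nhds (sub_pos.2 ht.2))
    filter_upwards [h1, self_mem_nhdsWithin] with r hr hr0
    have := h.quotEnergy_le_growBd hab hT hμ hν hS1 hST hK ht.1 hr0 (by linarith)
    have h2 : 0 ≤ ∫ s in 0..t, ‖diffQuot r Θx s‖ ^ 2 :=
      intervalIntegral.integral_nonneg ht.1 fun _ _ => sq_nonneg _
    linarith
  -- Forward quotients at `t = S` would leave `[0, S]`, so this time is reached by continuity.
  have hcl : ∀ t ∈ closure (Ico 0 S), derivEnergy P Vx Θt t ≤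
      derivEnergy P Vx Θt 0 * growBd a b μ θ₀ K := by
    intro t ht
    refine le_on_closure key ?_ continuousOn_const ht
    rwa [closure_Ico hS0.ne]
  exact hcl t (by rwa [closure_Ico hS0.ne])

/-- The dissipation in the quotient estimate bounds the quotients of `θ_x` in the square mean. By
Fatou the lower limit of their squared norms is finite at almost every time; there the quotients of
`θ` converge to `θ_t` with derivatives bounded along a subsequence, so `θ_t ∈ H¹` with the same
bound. -/
theorem StrongSol.lintegral_theta_tx_le (hab : a < b) (hT : 0 < T) (hμ : 0 < μ) (hν : 0 < ν)
    (h : StrongSol T ν μ u₀ u₁ θ₀ U Ux V Vx P Px Θ Θt Θtt Θx) (hP : ContinuousOn P (Icc 0 T))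
    {S K : ℝ} (hS0 : 0 < S) (hS1 : S ≤ 1) (hST : S ≤ T)
    (hK : ∫ s in 0..S, ‖Vx s‖ ^ 2 ≤ K) :
    (∀ᵐ t ∂volume.restrict (Ioo 0 S), MemH 1 (Θt t)) ∧
      ∫⁻ t in Ioo 0 S, ‖weakDx (Θt t)‖ₑ ^ 2 ≤
        ENNReal.ofReal (derivEnergy P Vx Θt 0 * growBd a b μ θ₀ K) := by
  -- `n + 2` keeps the step strictly below `S` already for `n = 0`.
  set r : ℕ → ℝ := fun n => S / (n + 2)
  have hr0 : ∀ n, 0 < r n := fun n => by positivity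
  have hrS : ∀ n, r n < S := fun n => div_lt_self hS0 (by
    have : (0 : ℝ) ≤ n := Nat.cast_nonneg n
    linarith)
  have hrt : Tendsto r atTop (𝓝[>] 0) := by
    refine tendsto_nhdsWithin_iff.2 ⟨?_, Eventually.of_forall hr0⟩
    exact Tendsto.div_atTop tendsto_const_nhds
      (tendsto_atTop_add_const_right _ _ tendsto_natCast_atTop_atTop)
  set Y := growBd a b μ θ₀ K
  set Z : ℕ → ℝ → ℝ≥0∞ := fun n =>
    (Ioo 0 (S - r n)).indicator fun t => ‖diffQuot (r n) Θx t‖ₑ ^ 2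
  have hsub : ∀ n, Ioo 0 (S - r n) ⊆ Ioo 0 T := fun n =>
    Ioo_subset_Ioo_right (by linarith [hr0 n])
  have hmem : ∀ n, MemLp (diffQuot (r n) Θx) 2 (volume.restrict (Ioo 0 (S - r n))) := by
    intro n
    have m1 : MemLp Θx 2 (volume.restrict (Ioo 0 (S - r n))) :=
      h.memΘx.mono_measure (Measure.restrict_mono (hsub n) le_rfl)
    have hm := (measurePreserving_add_right volume (r n)).restrict_preimage
      (s := Ioo (r n) S) measurableSet_Ioo
    have he : (fun x => x + r n) ⁻¹' Ioo (r n) S = Ioo 0 (S - r n) := by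
      ext x; simp [lt_sub_iff_add_lt]
    rw [he] at hm
    have m2 : MemLp Θx 2 (volume.restrict (Ioo (r n) S)) :=
      h.memΘx.mono_measure (Measure.restrict_mono (Ioo_subset_Ioo (hr0 n).le hST) le_rfl)
    exact ((m2.comp_measurePreserving hm).sub m1).const_smul (r n)⁻¹
  have hle : ∀ n, (volume.restrict (Ioo 0 S)).restrict (Ioo 0 (S - r n)) ≤
      volume.restrict (Ioo 0 (S - r n)) := fun n =>
    Measure.restrict_mono_measure Measure.restrict_le_self _
  have hZm : ∀ n, AEMeasurable (Z n) (volume.restrict (Ioo 0 S)) := fun n =>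
    (aemeasurable_indicator_iff measurableSet_Ioo).2
      (((hmem n).1.mono_measure (hle n)).enorm.pow_const 2)
  have hZ : ∀ n, ∫⁻ t in Ioo 0 S, Z n t ≤ ENNReal.ofReal (quotEnergy (r n) V Ux Θ 0 * Y) := by
    intro n
    have h0 : 0 ≤ S - r n := by linarith [hrS n]
    have h1 := h.quotEnergy_le_growBd hab hT hμ hν hS1 hST hK h0 (hr0 n) (by linarith)
    have h2 : 0 ≤ quotEnergy (r n) V Ux Θ (S - r n) := by unfold quotEnergy; positivity
    have h3 : ∫ s in 0..S - r n, ‖diffQuot (r n) Θx s‖ ^ 2 ≤ quotEnergy (r n) V Ux Θ 0 * Y := by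
      linarith
    rw [intervalIntegral.integral_of_le h0, ← restrict_Ioo_eq_restrict_Ioc] at h3
    calc ∫⁻ t in Ioo 0 S, Z n t
        = ∫⁻ t in Ioo 0 (S - r n), ‖diffQuot (r n) Θx t‖ₑ ^ 2 ∂volume.restrict (Ioo 0 S) :=
          lintegral_indicator measurableSet_Ioo _
      _ ≤ ∫⁻ t in Ioo 0 (S - r n), ‖diffQuot (r n) Θx t‖ₑ ^ 2 := lintegral_mono' (hle n) le_rfl
      _ = ENNReal.ofReal (∫ t in Ioo 0 (S - r n), ‖diffQuot (r n) Θx t‖ ^ 2) := by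
          rw [ofReal_integral_eq_lintegral_ofReal
            ((memLp_two_iff_integrable_norm_sq (hmem n).1).1 (hmem n))
            (ae_of_all _ fun _ => sq_nonneg _)]
          refine lintegral_congr fun t => ?_
          rw [ENNReal.ofReal_pow (norm_nonneg _), ofReal_norm]
      _ ≤ _ := ENNReal.ofReal_le_ofReal h3
  have hlim : Tendsto (fun n => ENNReal.ofReal (quotEnergy (r n) V Ux Θ 0 * Y)) atTop
      (𝓝 (ENNReal.ofReal (derivEnergy P Vx Θt 0 * Y))) :=
    ENNReal.tendsto_ofReal (((h.tendsto_quotEnergy hP ⟨le_rfl, hT⟩).comp hrt).mul_const Y)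
  have hfatou : ∫⁻ t in Ioo 0 S, liminf (fun n => Z n t) atTop ≤
      ENNReal.ofReal (derivEnergy P Vx Θt 0 * Y) := by
    refine (lintegral_liminf_le' hZm).trans ?_
    rw [← hlim.liminf_eq]
    exact liminf_le_liminf (Eventually.of_forall hZ)
  have hfin : ∀ᵐ t ∂volume.restrict (Ioo 0 S), liminf (fun n => Z n t) atTop < ⊤ := by
    refine ae_lt_top' ?_ (hfatou.trans_lt ENNReal.ofReal_lt_top).ne
    simp_rw [liminf_eq_iSup_iInf_of_nat']
    exact AEMeasurable.iSup fun n => AEMeasurable.iInf fun i => hZm (i + n)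
  have hdx : ∀ᵐ t ∂volume.restrict (Ioo 0 S), ∀ n, t < S - r n →
      HasDx (diffQuot (r n) Θ t) (diffQuot (r n) Θx t) := by
    rw [ae_all_iff]
    intro n
    have h1 := (ae_restrict_iff' measurableSet_Ioo).1 h.dxΘ
    have h2 := (ae_restrict_iff' measurableSet_Ioo).1
      (ae_comp_add (c := 0) (d := S - r n) (h := r n) h.dxΘ (by linarith [hr0 n]) (by linarith))
    rw [ae_restrict_iff' measurableSet_Ioo]
    filter_upwards [h1, h2] with t h1 h2 ht htn
    exact ((h2 ⟨ht.1, htn⟩).sub (h1 ⟨ht.1, ht.2.trans_le hST⟩)).smul _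
  have key : ∀ᵐ t ∂volume.restrict (Ioo 0 S), MemH 1 (Θt t) ∧
      ‖weakDx (Θt t)‖ₑ ^ 2 ≤ liminf (fun n => Z n t) atTop := by
    filter_upwards [hfin, hdx, ae_restrict_mem measurableSet_Ioo] with t h1 h2 ht
    have hev : ∀ᶠ n in atTop, t < S - r n := by
      have : ∀ᶠ x in 𝓝[>] (0 : ℝ), x < S - t :=
        mem_nhdsWithin_of_mem_nhds (Iio_mem_nhds (sub_pos.2 ht.2))
      filter_upwards [hrt this] with n hn
      have : r n < S - t := hn
      linarith
    have hT' : Tendsto (fun n => diffQuot (r n) Θ t) atTop (𝓝 (Θt t)) :=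
      (h.hΘ.tendsto_diffQuot h.hΘt.continuousOn ⟨ht.1.le, ht.2.trans_le hST⟩).comp hrt
    have hM : ∀ M : ℝ, 0 ≤ M → liminf (fun n => Z n t) atTop < ENNReal.ofReal M ^ 2 →
        ∃ g, HasDx (Θt t) g ∧ ‖g‖ ≤ M := by
      intro M hM0 hM
      refine HasDx.of_tendsto_of_bounded (hev.mono fun n hn => h2 n hn) hT' ?_
      refine ((frequently_lt_of_liminf_lt (by isBoundedDefault) hM).and_eventually hev).mono ?_
      rintro n ⟨hn, hn'⟩
      simp only [Z] at hn
      rw [indicator_of_mem (show t ∈ Ioo 0 (S - r n) from ⟨ht.1, hn'⟩)] at hn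
      have := (ENNReal.pow_lt_pow_left_iff two_ne_zero).1 hn
      rw [← ofReal_norm, ENNReal.ofReal_lt_ofReal_iff_of_nonneg (norm_nonneg _)] at this
      exact this.le
    -- `L` is the square root of the lower limit; every real `M` above it bounds infinitely many of
    -- the quotients.
    obtain ⟨L, hL⟩ : ∃ L : ℝ≥0∞, L ^ 2 = liminf (fun n => Z n t) atTop :=
      ⟨(liminf (fun n => Z n t) atTop) ^ (1 / 2 : ℝ), by rw [← ENNReal.rpow_natCast, ← ENNReal.rpow_mul]; norm_num⟩
    have hLtop : L ≠ ⊤ := by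
      rintro rfl
      simp [← hL] at h1
    have hM' : ∀ M : ℝ, L.toReal < M → ∃ g, HasDx (Θt t) g ∧ ‖g‖ ≤ M := by
      intro M hLM
      refine hM M (ENNReal.toReal_nonneg.trans hLM.le) ?_
      rw [← hL]
      refine (ENNReal.pow_lt_pow_left_iff two_ne_zero).2 ?_
      rwa [← ENNReal.ofReal_toReal hLtop,
        ENNReal.ofReal_lt_ofReal_iff_of_nonneg ENNReal.toReal_nonneg]
    obtain ⟨g, hg, -⟩ := hM' (L.toReal + 1) (by linarith)
    refine ⟨hg.memH_one, ?_⟩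
    rw [hg.weakDx_eq, ← hL]
    gcongr
    rw [← ofReal_norm, ← ENNReal.ofReal_toReal hLtop]
    refine ENNReal.ofReal_le_ofReal (le_of_forall_gt_imp_ge_of_dense fun M hLM => ?_)
    obtain ⟨g', hg', h3⟩ := hM' M hLM
    rwa [hg.unique hg']
  refine ⟨key.mono fun t ht => ht.1, (lintegral_mono_ae (key.mono fun t ht => ht.2)).trans hfatou⟩

/-- The bound of `‖θ_x‖` from the heat equation. -/
theorem StrongSol.norm_sq_theta_x_le (hab : a < b) (hμ : 0 < μ)
    (h : StrongSol T ν μ u₀ u₁ θ₀ U Ux V Vx P Px Θ Θt Θtt Θx) :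
    ∀ᵐ t ∂volume.restrict (Ioo 0 T), ∀ r B : ℝ, ‖Θt t‖ ≤ r → ‖Vx t‖ ≤ r → ‖Θ t‖ ≤ B →
      ‖Θx t‖ ^ 2 ≤ 2 * r * B * (1 + μ * embC a b * B) + (μ * embC a b * B * r) ^ 2 := by
  filter_upwards [h.heat, h.dxΘ] with t e1 e2 r B h1 h2 h3
  have hc := embC_pos hab
  have f1 := e1 _ _ e2
  have f2 := e2.abs_tri_le hab (Vx t) (Θ t)
  have f3 := abs_real_inner_le_norm (Θt t) (Θ t)
  rw [real_inner_self_eq_norm_sq] at f1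
  have n1 := norm_nonneg (Θ t)
  have n2 := norm_nonneg (Θx t)
  have n3 := norm_nonneg (Vx t)
  have n4 := norm_nonneg (Θt t)
  have hr : 0 ≤ r := n4.trans h1
  have hB : 0 ≤ B := n1.trans h3
  have f5 : ‖Θt t‖ * ‖Θ t‖ ≤ r * B := by gcongr
  have f6 : embC a b * (‖Θ t‖ + ‖Θx t‖) * ‖Vx t‖ * ‖Θ t‖ ≤
      embC a b * (B + ‖Θx t‖) * r * B := by gcongr
  have f7 : -(μ * tri (Θ t) (Vx t) (Θ t)) ≤ μ * (embC a b * (B + ‖Θx t‖) * r * B) := by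
    have := mul_le_mul_of_nonneg_left (show -tri (Θ t) (Vx t) (Θ t) ≤
      embC a b * (B + ‖Θx t‖) * r * B by linarith [neg_abs_le (tri (Θ t) (Vx t) (Θ t))]) hμ.le
    linarith
  have f8 := neg_abs_le (inner ℝ (Θt t) (Θ t))
  -- Young absorbs the mixed term. What is left is linear in `r` for small `r`, so this bounds
  -- `‖θ_x‖` only by the order `√r`.
  nlinarith [sq_nonneg (‖Θx t‖ - μ * embC a b * r * B)]

/-- A bound of `∫ ‖u_tx‖²` on an interval whose length does not depend on `ν`. -/
theorem StrongSol.integral_Vx_le (hab : a < b) (hT : 0 < T) (hμ : 0 < μ) (hν : 0 < ν)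
    (h : StrongSol T ν μ u₀ u₁ θ₀ U Ux V Vx P Px Θ Θt Θtt Θx) (hP : ContinuousOn P (Icc 0 T))
    {K M S : ℝ} (hK1 : 1 ≤ K) (hKE : (‖u₁‖ ^ 2 + ‖Ux 0‖ ^ 2) / 2 + inner ℝ θ₀ (oneL2 a b) ≤ K)
    (hM : ν < 1 → derivEnergy P Vx Θt 0 ≤ M) (hS0 : 0 < S) (hS1 : S ≤ 1) (hST : S ≤ T)
    (hSM : S * (M * growBd a b μ θ₀ K) ≤ 1 / 2) : ∫ s in 0..S, ‖Vx s‖ ^ 2 ≤ K := by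
  -- For large viscosity the energy law is enough, since `∫ ‖u_tx‖² ≤ ν ∫ ‖u_tx‖²`.
  rcases le_or_gt 1 ν with h1 | h1
  · have e1 := h.energy_le hab hT (t := S) ⟨hS0.le, hST⟩
    have e2 : 0 ≤ ∫ s in 0..S, ‖Vx s‖ ^ 2 :=
      intervalIntegral.integral_nonneg hS0.le fun _ _ => sq_nonneg _
    nlinarith
  -- For small viscosity, if the bound failed the integral would take the value `1 ≤ K` at some `s ≤
  -- S`. Up to `s` the differentiated energy is at most `M growBd`, whence `1 ≤ s M growBd ≤ 1 / 2`.
  · by_contra! hcon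
    have hV : ContinuousOn (fun s => ‖Vx s‖ ^ 2) (Icc 0 S) :=
      (h.hVx.continuousOn.mono (Icc_subset_Icc_right hST)).norm.pow 2
    have hA := (isPrim_integral (hV.intervalIntegrable_of_Icc (μ := volume) hS0.le)
      (0 : ℝ)).continuousOn
    obtain ⟨s, hs, hs1⟩ := intermediate_value_Icc hS0.le hA (show (1 : ℝ) ∈ Icc _ _ by
      simp only [intervalIntegral.integral_same, add_zero, zero_add]
      exact ⟨by norm_num, hK1.trans hcon.le⟩)
    simp only [zero_add] at hs1
    have hs0 : 0 < s := by
      rcases hs.1.eq_or_lt with h2 | h2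
      · rw [← h2] at hs1
        simp at hs1
      · exact h2
    have e1 : ∀ t ∈ Icc 0 s, ‖Vx t‖ ^ 2 ≤ M * growBd a b μ θ₀ K := by
      intro t ht
      have e2 := h.derivEnergy_le hab hT hμ hν hP hs0 (hs.2.trans hS1) (hs.2.trans hST)
        (hs1.le.trans hK1) ht
      have e3 : derivEnergy P Vx Θt 0 * growBd a b μ θ₀ K ≤ M * growBd a b μ θ₀ K :=
        mul_le_mul_of_nonneg_right (hM h1) (Real.exp_pos _).le
      have e4 : ‖Vx t‖ ^ 2 ≤ derivEnergy P Vx Θt t := by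
        unfold derivEnergy
        nlinarith [sq_nonneg ‖P t‖, sq_nonneg ‖Θt t‖]
      linarith
    have e5 := intervalIntegral.integral_mono_on hs0.le
      ((hV.mono (Icc_subset_Icc_right hs.2)).intervalIntegrable_of_Icc hs0.le)
      (intervalIntegrable_const (μ := volume)) e1
    rw [intervalIntegral.integral_const, smul_eq_mul, sub_zero] at e5
    have e6 : 0 ≤ M * growBd a b μ θ₀ K := (sq_nonneg _).trans (e1 0 ⟨le_rfl, hs0.le⟩)
    have e7 : s * (M * growBd a b μ θ₀ K) ≤ S * (M * growBd a b μ θ₀ K) :=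
      mul_le_mul_of_nonneg_right hs.2 e6
    linarith

end Limit

/-! ### Initial values -/

section Initial

variable {a b T ν μ : ℝ} {u₀ u₁ θ₀ : L2 a b} {U Ux V Vx P Px Θ Θt Θtt Θx : ℝ → L2 a b}

theorem StrongSol.congr_utt (hT : 0 < T)
    (h : StrongSol T ν μ u₀ u₁ θ₀ U Ux V Vx P Px Θ Θt Θtt Θx) {Q : ℝ → L2 a b}
    (hQ : Q =ᵐ[volume.restrict (Ioo 0 T)] P) :
    StrongSol T ν μ u₀ u₁ θ₀ U Ux V Vx Q Px Θ Θt Θtt Θx :=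
  { h with
    hV := h.hV.congr hT.le (fun _ _ => rfl) hQ
    memP := h.memP.ae_eq hQ.symm
    momentum := by
      filter_upwards [h.momentum, hQ] with t h1 h2
      rw [h2]
      exact h1 }

theorem HasDx.tendsto_tri {ι : Type*} {l : Filter ι} {f f' : L2 a b} (h : HasDx f f')
    (hab : a < b) {g k : ι → L2 a b} {g₀ k₀ : L2 a b} (hg : Tendsto g l (𝓝 g₀))
    (hk : Tendsto k l (𝓝 k₀)) : Tendsto (fun i => tri f (g i) (k i)) l (𝓝 (tri f g₀ k₀)) := by
  have hM : 0 ≤ embC a b * (‖f‖ + ‖f'‖) := by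
    have := embC_pos hab
    positivity
  have key : ∀ i, ‖tri f (g i) (k i) - tri f g₀ k₀‖ ≤
      embC a b * (‖f‖ + ‖f'‖) * (‖g i - g₀‖ * ‖k i‖ + ‖g₀‖ * ‖k i - k₀‖) := by
    intro i
    have e : tri f (g i) (k i) - tri f g₀ k₀ = tri f (g i - g₀) (k i) + tri f g₀ (k i - k₀) := by
      rw [h.tri_sub_mid hab, h.tri_sub_right hab]
      ring
    rw [e]
    refine (norm_add_le _ _).trans ?_
    have e1 := h.abs_tri_le hab (g i - g₀) (k i)
    have e2 := h.abs_tri_le hab g₀ (k i - k₀)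
    rw [Real.norm_eq_abs, Real.norm_eq_abs]
    linarith
  rw [tendsto_iff_norm_sub_tendsto_zero]
  refine squeeze_zero (fun _ => norm_nonneg _) key ?_
  have h1 := tendsto_iff_norm_sub_tendsto_zero.1 hg
  have h2 := tendsto_iff_norm_sub_tendsto_zero.1 hk
  have h3 := ((h1.mul hk.norm).add (h2.const_mul ‖g₀‖)).const_mul (embC a b * (‖f‖ + ‖f'‖))
  simpa using h3

/-- Almost everywhere this is the momentum equation. Flux and `u_tt` are continuous in time, so
closedness of the weak derivative extends it to every time, including `t = 0`, where it determines
`u_tt(0)`. -/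
theorem StrongSol.hasDx_flux (hT : 0 < T)
    (h : StrongSol T ν μ u₀ u₁ θ₀ U Ux V Vx P Px Θ Θt Θtt Θx) (hP : ContinuousOn P (Icc 0 T))
    {t : ℝ} (ht : t ∈ Icc 0 T) : HasDx (Ux t + ν • Vx t - μ • Θ t) (P t) := by
  obtain ⟨s, hs, hst⟩ := exists_seq_tendsto_of_ae h.momentum' ht hT
  have hst' : Tendsto s atTop (𝓝[Icc 0 T] t) :=
    tendsto_nhdsWithin_iff.2 ⟨hst, Eventually.of_forall fun n => Ioo_subset_Icc_self (hs n).1⟩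
  have hG := ((h.hUx.add (h.hVx.const_smul ν)).sub (h.hΘ.const_smul μ)).continuousOn
  exact HasDx.of_tendsto (l := atTop)
    (Eventually.of_forall fun n => hasDx_of_forall_hasDx0 (hs n).2)
    ((hG t ht).tendsto.comp hst') ((hP t ht).tendsto.comp hst')

theorem StrongSol.Ux_zero (hT : 0 < T)
    (h : StrongSol T ν μ u₀ u₁ θ₀ U Ux V Vx P Px Θ Θt Θtt Θx) : Ux 0 = weakDx u₀ := by
  rw [← h.initU, (h.dxU 0 ⟨le_rfl, hT.le⟩).hasDx.weakDx_eq]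

theorem StrongSol.Vx_zero (hT : 0 < T)
    (h : StrongSol T ν μ u₀ u₁ θ₀ U Ux V Vx P Px Θ Θt Θtt Θx) : Vx 0 = weakDx u₁ := by
  rw [← h.initV, (h.dxV 0 ⟨le_rfl, hT.le⟩).hasDx.weakDx_eq]

theorem StrongSol.P_zero (hT : 0 < T)
    (h : StrongSol T ν μ u₀ u₁ θ₀ U Ux V Vx P Px Θ Θt Θtt Θx) (hP : ContinuousOn P (Icc 0 T))
    {u₀'' u₁'' θ₀' : L2 a b} (hu₀ : HasDx (weakDx u₀) u₀'') (hu₁ : HasDx (weakDx u₁) u₁'')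
    (hθ₀ : HasDx θ₀ θ₀') : P 0 = u₀'' + ν • u₁'' - μ • θ₀' := by
  have h1 := h.hasDx_flux hT hP (t := 0) ⟨le_rfl, hT.le⟩
  rw [h.Ux_zero hT, h.Vx_zero hT, h.initΘ] at h1
  exact h1.unique ((hu₀.add (hu₁.smul ν)).sub (hθ₀.smul μ))

/-- The curve `θ_x` has no value at `t = 0`, so both space derivatives are moved to the test
function before the limit and moved back on `θ₀` afterwards. -/
theorem StrongSol.Θt_zero (hab : a < b) (hT : 0 < T)
    (h : StrongSol T ν μ u₀ u₁ θ₀ U Ux V Vx P Px Θ Θt Θtt Θx)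
    {θ₀' θ₀'' : L2 a b} (hθ₀ : HasDx θ₀ θ₀') (hθ₀' : HasDx θ₀' θ₀'') :
    Θt 0 = θ₀'' - μ • (hθ₀.memLp_mul hab (weakDx u₁)).toLp _ := by
  have h0 : (0 : ℝ) ∈ Icc 0 T := ⟨le_rfl, hT.le⟩
  refine eq_of_inner_test fun φ hφ => ?_
  obtain ⟨s, hs, hst⟩ := exists_seq_tendsto_of_ae (h.heat.and h.dxΘ) h0 hT
  have hst' : Tendsto s atTop (𝓝[Icc 0 T] 0) :=
    tendsto_nhdsWithin_iff.2 ⟨hst, Eventually.of_forall fun n => Ioo_subset_Icc_self (hs n).1⟩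
  have t1 := (h.hΘt.continuousOn 0 h0).tendsto.comp hst'
  have t2 := (h.hΘ.continuousOn 0 h0).tendsto.comp hst'
  have t3 := (h.hVx.continuousOn 0 h0).tendsto.comp hst'
  have d1 := hφ.hasDx0
  have d2 := hφ.derivative.hasDx0
  have lim := ((t1.inner (tendsto_const_nhds (x := hφ.toL2))).sub
    (t2.inner (tendsto_const_nhds (x := hφ.derivative.derivative.toL2)))).add
    ((d1.hasDx.tendsto_tri hab t2 t3).const_mul μ)
  have e0 : ∀ n, inner ℝ (Θt (s n)) hφ.toL2 -
      inner ℝ (Θ (s n)) hφ.derivative.derivative.toL2 +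
      μ * tri hφ.toL2 (Θ (s n)) (Vx (s n)) = 0 := by
    intro n
    have e1 := (hs n).2.1 _ _ d1.hasDx
    have e2 := (hs n).2.2.inner_right d2
    rw [e2, tri_comm, tri_swap]
    linarith
  have e3 := tendsto_nhds_unique lim (tendsto_const_nhds.congr fun n => (e0 n).symm)
  rw [h.initΘ, h.Vx_zero hT, hθ₀.inner_right d2, hθ₀'.inner_right d1, tri_comm, tri_swap,
    hθ₀.tri_eq hab] at e3
  rw [inner_sub_left, inner_smul_left]
  simp only [conj_trivial]
  linarith

/-- If the initial time derivatives vanish then the initial temperature is constant. -/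
theorem StrongSol.hasDx_zero_of_stationary (hab : a < b) (hT : 0 < T) (hμ : 0 < μ)
    (h : StrongSol T ν μ u₀ u₁ θ₀ U Ux V Vx P Px Θ Θt Θtt Θx) (hV : Vx 0 = 0) (hΘ : Θt 0 = 0) :
    HasDx θ₀ 0 := by
  have h0 : (0 : ℝ) ∈ Icc 0 T := ⟨le_rfl, hT.le⟩
  obtain ⟨s, hs, hst⟩ :=
    exists_seq_tendsto_of_ae ((h.norm_sq_theta_x_le hab hμ).and h.dxΘ) h0 hT
  have hst' : Tendsto s atTop (𝓝[Icc 0 T] 0) :=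
    tendsto_nhdsWithin_iff.2 ⟨hst, Eventually.of_forall fun n => Ioo_subset_Icc_self (hs n).1⟩
  have t1 := ((h.hΘt.continuousOn 0 h0).tendsto.comp hst').norm
  have t2 := (h.hΘ.continuousOn 0 h0).tendsto.comp hst'
  have t3 := ((h.hVx.continuousOn 0 h0).tendsto.comp hst').norm
  rw [hΘ, norm_zero] at t1
  rw [hV, norm_zero] at t3
  rw [h.initΘ] at t2
  have tr := t1.add t3
  have tB := t2.norm
  simp only [add_zero, Function.comp_apply] at tr tB
  -- This is the bound of `‖θ_x‖²` with `r = ‖θ_t‖ + ‖u_tx‖`, which tends to zero. It comes from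
  -- testing with `θ` itself, without boundary values; here the Neumann condition enters, as `θ₀'' =
  -- 0` alone would allow affine functions.
  have lim : Tendsto (fun n => 2 * (‖Θt (s n)‖ + ‖Vx (s n)‖) * ‖Θ (s n)‖ *
      (1 + μ * embC a b * ‖Θ (s n)‖) +
      (μ * embC a b * ‖Θ (s n)‖ * (‖Θt (s n)‖ + ‖Vx (s n)‖)) ^ 2) atTop (𝓝 0) := by
    have := (((tr.const_mul 2).mul tB).mul ((tB.const_mul (μ * embC a b)).const_add 1)).add
      (((tB.const_mul (μ * embC a b)).mul tr).pow 2)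
    simpa using this
  have hsq : Tendsto (fun n => ‖Θx (s n)‖ ^ 2) atTop (𝓝 0) := by
    refine squeeze_zero (fun _ => sq_nonneg _) (fun n => ?_) lim
    exact (hs n).2.1 _ _ (by linarith [norm_nonneg (Vx (s n))])
      (by linarith [norm_nonneg (Θt (s n))]) le_rfl
  have hx : Tendsto (fun n => Θx (s n)) atTop (𝓝 0) := by
    rw [tendsto_zero_iff_norm_tendsto_zero]
    have := hsq.sqrt
    simpa using this
  exact HasDx.of_tendsto (Eventually.of_forall fun n => (hs n).2.2) t2 hx

theorem weakDx_zero : weakDx (0 : L2 a b) = 0 :=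
  HasDx.weakDx_eq ((dxGraph a b).zero_mem)

/-- A bound from below of the initial time derivatives, uniform in the viscosity. -/
theorem exists_pos_le_initial (hab : a < b) (hμ : 0 < μ) (hu₀ : MemH 2 u₀ ∧ MemH10 u₀)
    (hu₁ : MemH 2 u₁ ∧ MemH10 u₁) (hθ₀ : MemH 3 θ₀)
    (hne : ¬ (u₀ = 0 ∧ u₁ = 0 ∧ HasDx θ₀ 0)) :
    ∃ c : ℝ, 0 < c ∧ ∀ (T ν : ℝ) (U Ux V Vx P Px Θ Θt Θtt Θx : ℝ → L2 a b), 0 < T →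
      StrongSol T ν μ u₀ u₁ θ₀ U Ux V Vx P Px Θ Θt Θtt Θx → ContinuousOn P (Icc 0 T) →
      c ≤ ‖P 0‖ + ‖Vx 0‖ + ‖Θt 0‖ := by
  have hu₀x := (memH_succ_iff.1 hu₀.1).2
  have hu₁x := (memH_succ_iff.1 hu₁.1).2
  have hθ := memH_succ_iff.1 hθ₀
  have hθx := (memH_succ_iff.1 hθ.2).1
  rw [memH_one_iff] at hu₀x hu₁x
  -- If `u₁' ≠ 0`, the bound is `‖u_tx(0)‖ = ‖u₁'‖`. If `u₁' = 0`, the viscous part `ν u₁''` of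
  -- `u_tt(0)` vanishes and the initial derivatives do not depend on `ν`.
  by_cases h1 : weakDx u₁ = 0
  · have hu₁0 : u₁ = 0 := by
      have := memH10_iff.1 hu₁.2
      rw [h1] at this
      exact this.eq_zero hab
    have hP : ∀ (T ν : ℝ) (U Ux V Vx P Px Θ Θt Θtt Θx : ℝ → L2 a b), 0 < T →
        StrongSol T ν μ u₀ u₁ θ₀ U Ux V Vx P Px Θ Θt Θtt Θx → ContinuousOn P (Icc 0 T) →
        P 0 = weakDx (weakDx u₀) - μ • weakDx θ₀ ∧ Vx 0 = 0 ∧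
          Θt 0 = weakDx (weakDx θ₀) := by
      intro T ν U Ux V Vx P Px Θ Θt Θtt Θx hT h hP
      refine ⟨?_, (h.Vx_zero hT).trans h1, ?_⟩
      · rw [h.P_zero hT hP hu₀x hu₁x hθ.1, h1, weakDx_zero, smul_zero, add_zero]
      · rw [h.Θt_zero hab hT hθ.1 hθx]
        have := hθ.1.norm_mul_le hab (weakDx u₁)
        rw [h1] at this ⊢
        rw [norm_zero, mul_zero, norm_le_zero_iff] at this
        rw [this, smul_zero, sub_zero]
    rcases eq_or_lt_of_le (add_nonneg (norm_nonneg (weakDx (weakDx u₀) - μ • weakDx θ₀))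
      (norm_nonneg (weakDx (weakDx θ₀)))) with h2 | h2
    -- All initial derivatives vanish. If a solution exists, `θ₀` is constant, so `u₀'' = 0` and the
    -- boundary values force `u₀ = 0`: the excluded case. The choice `1` is therefore immaterial.
    · refine ⟨1, one_pos, ?_⟩
      intro T ν U Ux V Vx P Px Θ Θt Θtt Θx hT h hPc
      exfalso
      obtain ⟨p1, p2, p3⟩ := hP T ν U Ux V Vx P Px Θ Θt Θtt Θx hT h hPc
      have n1 := norm_nonneg (weakDx (weakDx u₀) - μ • weakDx θ₀)
      have n2 := norm_nonneg (weakDx (weakDx θ₀))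
      have z1 : weakDx (weakDx u₀) - μ • weakDx θ₀ = 0 := norm_eq_zero.1 (by linarith)
      have z2 : weakDx (weakDx θ₀) = 0 := norm_eq_zero.1 (by linarith)
      have d0 := h.hasDx_zero_of_stationary hab hT hμ p2 (p3.trans z2)
      rw [d0.weakDx_eq, smul_zero, sub_zero] at z1
      rw [z1] at hu₀x
      have hd := memH10_iff.1 hu₀.2
      have := hu₀x.inner_right hd
      rw [inner_zero_left, neg_zero, inner_self_eq_zero] at this
      rw [this] at hd
      exact hne ⟨hd.eq_zero hab, hu₁0, d0⟩
    · refine ⟨_, h2, ?_⟩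
      intro T ν U Ux V Vx P Px Θ Θt Θtt Θx hT h hPc
      obtain ⟨p1, p2, p3⟩ := hP T ν U Ux V Vx P Px Θ Θt Θtt Θx hT h hPc
      rw [p1, p2, p3, norm_zero, add_zero]
  · refine ⟨‖weakDx u₁‖, norm_pos_iff.2 h1, ?_⟩
    intro T ν U Ux V Vx P Px Θ Θt Θtt Θx hT h hPc
    rw [h.Vx_zero hT]
    linarith [norm_nonneg (P 0), norm_nonneg (Θt 0)]

/-- The second derivative in space of the displacement. -/
theorem StrongSol.exists_hasDx_Ux (hT : 0 < T) (hν : 0 < ν)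
    (h : StrongSol T ν μ u₀ u₁ θ₀ U Ux V Vx P Px Θ Θt Θtt Θx)
    {u₀'' : L2 a b} (hu₀ : HasDx (weakDx u₀) u₀'')
    {S N : ℝ} (hST : S ≤ T) (hN : ∀ᵐ t ∂volume.restrict (Ioo 0 S), ‖P t + μ • Θx t‖ ≤ N)
    (hN0 : 0 ≤ N) {t : ℝ} (ht : t ∈ Icc 0 S) : ∃ g, HasDx (Ux t) g ∧ ‖g‖ ≤ ‖u₀''‖ + N := by
  have htT : t ∈ Icc 0 T := ⟨ht.1, ht.2.trans hST⟩
  have h0 : (0 : ℝ) ∈ Icc 0 T := ⟨le_rfl, hT.le⟩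
  have hder : ∀ x, HasDerivAt (fun s => Real.exp (s / ν)) (ν⁻¹ * Real.exp (x / ν)) x := by
    intro x
    have := ((hasDerivAt_id' x).div_const ν).exp
    convert this using 1
    ring
  -- Integrating factor: `d/dt (e^{t/ν} u_x) = ν⁻¹ e^{t/ν} (u_x + ν u_tx)`, and the momentum
  -- equation provides the space derivative of the right side, `u_tt + μ θ_x` up to the factor.
  have hexp : IsPrim 0 T (fun s => Real.exp (s / ν)) (fun s => ν⁻¹ * Real.exp (s / ν)) := by
    have hc : Continuous fun s => ν⁻¹ * Real.exp (s / ν) := by fun_prop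
    refine ⟨hc.intervalIntegrable _ _, fun t _ => ?_⟩
    rw [intervalIntegral.integral_eq_sub_of_hasDerivAt (fun x _ => hder x)
      (hc.intervalIntegrable _ _)]
    ring
  have hX := hexp.bilin h.hUx hT.le (ContinuousLinearMap.lsmul ℝ ℝ)
  have hX' := hX.congr (g' := fun s => (ν⁻¹ * Real.exp (s / ν)) • (Ux s + ν • Vx s)) hT.le
    (fun _ _ => rfl) (ae_of_all _ fun s => by
      simp only [ContinuousLinearMap.lsmul_apply, smul_add, smul_smul]
      congr 2
      field_simp)
  have hflux : ∀ᵐ s ∂volume.restrict (Ioo 0 t),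
      HasDx ((ν⁻¹ * Real.exp (s / ν)) • (Ux s + ν • Vx s))
        ((ν⁻¹ * Real.exp (s / ν)) • (P s + μ • Θx s)) := by
    filter_upwards [ae_restrict_of_ae_restrict_of_subset (Ioo_subset_Ioo_right htT.2) h.momentum',
      ae_restrict_of_ae_restrict_of_subset (Ioo_subset_Ioo_right htT.2) h.dxΘ] with s h1 h2
    have := (hasDx_of_forall_hasDx0 h1).add (h2.smul μ)
    rw [sub_add_cancel] at this
    exact this.smul _
  have hgi : IntervalIntegrable (fun s => (ν⁻¹ * Real.exp (s / ν)) • (P s + μ • Θx s))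
      volume 0 t := by
    have hi : IntervalIntegrable (fun s => P s + μ • Θx s) volume 0 T := by
      refine (intervalIntegrable_iff_integrableOn_Ioo_of_le hT.le).2 ?_
      exact (h.memP.add (h.memΘx.const_smul μ)).integrable (by norm_num)
    have hi' := (isPrim_integral hi 0).intervalIntegrable h0 htT
    exact hi'.continuousOn_smul (by fun_prop)
  have hint := HasDx.intervalIntegral ht.1 hflux (hX'.intervalIntegrable h0 htT) hgi
  have hb : ‖∫ s in 0..t, (ν⁻¹ * Real.exp (s / ν)) • (P s + μ • Θx s)‖ ≤
      (Real.exp (t / ν) - 1) * N := by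
    -- The kernel has mass `e^{t/ν} - 1`; after division by `e^{t/ν}` no dependence on `ν` survives
    -- in the bound.
    have e1 : ∫ s in 0..t, ν⁻¹ * Real.exp (s / ν) = Real.exp (t / ν) - 1 := by
      rw [← hexp.sub_eq h0 htT]; simp
    rw [← e1, ← intervalIntegral.integral_mul_const]
    refine intervalIntegral.norm_integral_le_of_norm_le ht.1 ?_ ?_
    · have h1 := (ae_restrict_iff' measurableSet_Ioo).1 hN
      have hSn : ∀ᵐ s : ℝ, s ≠ S := by simp [ae_iff, measure_singleton]
      filter_upwards [h1, hSn] with s hs hsS hsm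
      have hpos : 0 < ν⁻¹ * Real.exp (s / ν) := by positivity
      rw [norm_smul, Real.norm_eq_abs, abs_of_pos hpos]
      exact mul_le_mul_of_nonneg_left
        (hs ⟨hsm.1, lt_of_le_of_ne (hsm.2.trans ht.2) hsS⟩) hpos.le
    · exact ((hexp.intervalIntegrable h0 htT)).mul_const N
  have hE := Real.exp_pos (t / ν)
  have hE1 : 1 ≤ Real.exp (t / ν) := Real.one_le_exp (div_nonneg ht.1 hν.le)
  have hUt : Ux t = (Real.exp (t / ν))⁻¹ • (weakDx u₀ +
      ∫ s in 0..t, (ν⁻¹ * Real.exp (s / ν)) • (Ux s + ν • Vx s)) := by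
    have := hX'.2 t htT
    simp only [ContinuousLinearMap.lsmul_apply, zero_div, Real.exp_zero, one_smul,
      h.Ux_zero hT] at this
    rw [← this, smul_smul, inv_mul_cancel₀ hE.ne', one_smul]
  refine ⟨(Real.exp (t / ν))⁻¹ • (u₀'' +
    ∫ s in 0..t, (ν⁻¹ * Real.exp (s / ν)) • (P s + μ • Θx s)), ?_, ?_⟩
  · rw [hUt]
    exact (hu₀.add hint).smul _
  · rw [norm_smul, norm_inv, Real.norm_eq_abs, abs_of_pos hE, inv_mul_le_iff₀ hE]
    refine (norm_add_le _ _).trans ?_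
    have := norm_nonneg u₀''
    nlinarith

end Initial

/-! ### From bounds of representatives to norms of `W^{m,p}(0,S; H^k)`. -/

section Bounds

variable {a b : ℝ}

theorem IsPrim.norm_le {S M : ℝ} {F G : ℝ → L2 a b} (h : IsPrim 0 S F G) (hS1 : S ≤ 1)
    (hM : ∀ t ∈ Icc 0 S, ‖G t‖ ≤ M) {t : ℝ} (ht : t ∈ Icc 0 S) : ‖F t‖ ≤ ‖F 0‖ + M := by
  have hM0 : 0 ≤ M := (norm_nonneg _).trans (hM t ht)
  have h1 : ‖∫ s in (0 : ℝ)..t, G s‖ ≤ M * |t - 0| := by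
    refine intervalIntegral.norm_integral_le_of_norm_le_const fun s hs => hM s ?_
    rw [uIoc_of_le ht.1] at hs
    exact ⟨hs.1.le, hs.2.trans ht.2⟩
  rw [sub_zero, abs_of_nonneg ht.1] at h1
  rw [h.2 t ht]
  refine (norm_add_le _ _).trans (add_le_add le_rfl (h1.trans ?_))
  exact mul_le_of_le_one_right hM0 (ht.2.trans hS1)

/-- The derivative in time of a primitive. -/
theorem IsPrim.weakDt_ae_eq {S : ℝ} (hS : 0 ≤ S) {F G f : ℝ → L2 a b} (h : IsPrim 0 S F G)
    (hf : F =ᵐ[volume.restrict (Ioo 0 S)] f) :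
    IsWeakDeriv 0 S f G ∧ G =ᵐ[volume.restrict (Ioo 0 S)] weakDt S f := by
  have h1 : IsWeakDeriv 0 S f G := (h.isWeakDeriv hS).congr hf EventuallyEq.rfl
  exact ⟨h1, h1.unique (weakDt_spec ⟨G, h1⟩)⟩

theorem hNorm_le {k : ℕ} {f : L2 a b} {N : ℝ} (h : ∀ j ≤ k, ‖weakDx^[j] f‖ ≤ N) :
    hNorm k f ≤ (k + 1) * N := by
  have hN : 0 ≤ N := (norm_nonneg _).trans (h 0 (Nat.zero_le _))
  refine Real.sqrt_le_iff.2 ⟨by positivity, ?_⟩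
  calc ∑ j ∈ Finset.range (k + 1), ‖weakDx^[j] f‖ ^ 2
      ≤ ∑ j ∈ Finset.range (k + 1), N ^ 2 := Finset.sum_le_sum fun j hj => by
        have := h j (by simpa [Nat.lt_succ_iff] using hj)
        gcongr
    _ = (k + 1) * N ^ 2 := by simp
    _ ≤ ((k + 1) * N) ^ 2 := by
        have : (0 : ℝ) ≤ k := Nat.cast_nonneg k
        nlinarith [mul_nonneg (mul_nonneg this (by linarith : (0 : ℝ) ≤ k + 1)) (sq_nonneg N)]

theorem hNorm_nonneg (k : ℕ) (f : L2 a b) : 0 ≤ hNorm k f := Real.sqrt_nonneg _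

theorem hNorm_one_le (f : L2 a b) : hNorm 1 f ≤ ‖f‖ + ‖weakDx f‖ := by
  refine Real.sqrt_le_iff.2 ⟨by positivity, ?_⟩
  simp only [Finset.sum_range_succ, Finset.range_zero, Finset.sum_empty, Function.iterate_zero,
    id, Function.iterate_one, zero_add]
  nlinarith [mul_nonneg (norm_nonneg f) (norm_nonneg (weakDx f))]

theorem aestronglyMeasurable_weakDx_iterate {S : ℝ} {f : ℝ → L2 a b}
    (hf : AEStronglyMeasurable f (volume.restrict (Ioo 0 S))) (j : ℕ) :
    AEStronglyMeasurable (fun t => weakDx^[j] (f t)) (volume.restrict (Ioo 0 S)) := by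
  induction j with
  | zero => exact hf
  | succ j ih =>
    simp only [Function.iterate_succ_apply']
    exact aestronglyMeasurable_weakDx ih

theorem memLpH_top {S N : ℝ} {k : ℕ} {F f : ℝ → L2 a b}
    (hFf : F =ᵐ[volume.restrict (Ioo 0 S)] f)
    (hF : AEStronglyMeasurable F (volume.restrict (Ioo 0 S)))
    (hH : ∀ᵐ t ∂volume.restrict (Ioo 0 S), MemH k (F t))
    (hN : ∀ᵐ t ∂volume.restrict (Ioo 0 S), ∀ j ≤ k, ‖weakDx^[j] (F t)‖ ≤ N) :
    MemLpH S ⊤ k f ∧ eLpNorm (fun t => hNorm k (f t)) ⊤ (volume.restrict (Ioo 0 S)) ≤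
      ENNReal.ofReal ((k + 1) * N) := by
  refine ⟨⟨?_, fun j hj => ?_⟩, ?_⟩
  · filter_upwards [hFf, hH] with t h1 h2
    rwa [← h1]
  · refine MemLp.of_bound (aestronglyMeasurable_weakDx_iterate (hF.congr hFf) j) N ?_
    filter_upwards [hFf, hN] with t h1 h2
    rw [← h1]
    exact h2 j hj
  · rw [eLpNorm_exponent_top]
    refine eLpNormEssSup_le_of_ae_bound ?_
    filter_upwards [hFf, hN] with t h1 h2
    rw [← h1, Real.norm_of_nonneg (hNorm_nonneg _ _)]
    exact hNorm_le h2

theorem eLpNorm_two_le_of_lintegral {S N : ℝ} (hN : 0 ≤ N) {f : ℝ → L2 a b}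
    (h : ∫⁻ t in Ioo 0 S, ‖f t‖ₑ ^ 2 ≤ ENNReal.ofReal (N ^ 2)) :
    eLpNorm f 2 (volume.restrict (Ioo 0 S)) ≤ ENNReal.ofReal N := by
  rw [eLpNorm_eq_lintegral_rpow_enorm_toReal (by norm_num) (by norm_num)]
  simp only [ENNReal.toReal_ofNat, ENNReal.rpow_ofNat, one_div]
  refine (ENNReal.rpow_le_rpow h (by norm_num)).trans_eq ?_
  rw [ENNReal.ofReal_rpow_of_nonneg (sq_nonneg _) (by norm_num), ← one_div,
    ← Real.sqrt_eq_rpow, Real.sqrt_sq hN]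

theorem memLpH_two {S N : ℝ} (hN : 0 ≤ N) {F f : ℝ → L2 a b}
    (hFf : F =ᵐ[volume.restrict (Ioo 0 S)] f)
    (hF : AEStronglyMeasurable F (volume.restrict (Ioo 0 S)))
    (hH : ∀ᵐ t ∂volume.restrict (Ioo 0 S), MemH 1 (F t))
    (hN0 : ∫⁻ t in Ioo 0 S, ‖F t‖ₑ ^ 2 ≤ ENNReal.ofReal (N ^ 2))
    (hN1 : ∫⁻ t in Ioo 0 S, ‖weakDx (F t)‖ₑ ^ 2 ≤ ENNReal.ofReal (N ^ 2)) :
    MemLpH S 2 1 f ∧ eLpNorm (fun t => hNorm 1 (f t)) 2 (volume.restrict (Ioo 0 S)) ≤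
      ENNReal.ofReal (2 * N) := by
  have e0 := eLpNorm_two_le_of_lintegral hN hN0
  have e1 := eLpNorm_two_le_of_lintegral hN hN1
  have hxF := aestronglyMeasurable_weakDx hF
  refine ⟨⟨?_, fun j hj => ?_⟩, ?_⟩
  · filter_upwards [hFf, hH] with t h1 h2
    rwa [← h1]
  · interval_cases j
    · exact MemLp.ae_eq hFf ⟨hF, e0.trans_lt ENNReal.ofReal_lt_top⟩
    · refine MemLp.ae_eq ?_ ⟨hxF, e1.trans_lt ENNReal.ofReal_lt_top⟩
      filter_upwards [hFf] with t h1
      rw [h1, Function.iterate_one]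
  · calc eLpNorm (fun t => hNorm 1 (f t)) 2 (volume.restrict (Ioo 0 S))
        ≤ eLpNorm (fun t => ‖F t‖ + ‖weakDx (F t)‖) 2 (volume.restrict (Ioo 0 S)) := by
          refine eLpNorm_mono_ae_real ?_
          filter_upwards [hFf] with t h1
          rw [← h1, Real.norm_of_nonneg (hNorm_nonneg _ _)]
          exact hNorm_one_le _
      _ ≤ eLpNorm (fun t => ‖F t‖) 2 (volume.restrict (Ioo 0 S)) +
          eLpNorm (fun t => ‖weakDx (F t)‖) 2 (volume.restrict (Ioo 0 S)) :=
          eLpNorm_add_le hF.norm hxF.norm (by norm_num)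
      _ ≤ ENNReal.ofReal N + ENNReal.ofReal N := by
          rw [eLpNorm_norm, eLpNorm_norm]
          exact add_le_add e0 e1
      _ = ENNReal.ofReal (2 * N) := by rw [← ENNReal.ofReal_add hN hN, two_mul]

theorem lintegral_sq_le_of_norm_le {S N : ℝ} (hS1 : S ≤ 1) {F : ℝ → L2 a b}
    (h : ∀ᵐ t ∂volume.restrict (Ioo 0 S), ‖F t‖ ≤ N) :
    ∫⁻ t in Ioo 0 S, ‖F t‖ₑ ^ 2 ≤ ENNReal.ofReal (N ^ 2) := by
  calc ∫⁻ t in Ioo 0 S, ‖F t‖ₑ ^ 2 ≤ ∫⁻ _ in Ioo 0 S, ENNReal.ofReal (N ^ 2) := by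
        refine lintegral_mono_ae ?_
        filter_upwards [h] with t ht
        rw [← ofReal_norm, ← ENNReal.ofReal_pow (norm_nonneg _)]
        exact ENNReal.ofReal_le_ofReal (by gcongr)
    _ ≤ ENNReal.ofReal (N ^ 2) := by
        rw [setLIntegral_const, Real.volume_Ioo, sub_zero]
        exact mul_le_of_le_one_right (by positivity) (by simpa using hS1)

/-- Norms of a displacement with bounded derivatives. -/
theorem memW_displacement {S N : ℝ} (hS : 0 ≤ S) {U Ux V Vx P u : ℝ → L2 a b}
    (hU : IsPrim 0 S U V) (hV : IsPrim 0 S V P) (hP : ContinuousOn P (Icc 0 S))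
    (hu : U =ᵐ[volume.restrict (Ioo 0 S)] u)
    (dxU : ∀ t ∈ Icc 0 S, HasDx (U t) (Ux t)) (dxV : ∀ t ∈ Icc 0 S, HasDx (V t) (Vx t))
    (dxx : ∀ t ∈ Icc 0 S, ∃ g, HasDx (Ux t) g ∧ ‖g‖ ≤ N)
    (bU : ∀ t ∈ Icc 0 S, ‖U t‖ ≤ N ∧ ‖Ux t‖ ≤ N)
    (bV : ∀ t ∈ Icc 0 S, ‖V t‖ ≤ N ∧ ‖Vx t‖ ≤ N ∧ ‖P t‖ ≤ N) :
    (MemW S 2 ⊤ 0 u ∧ MemW S 1 ⊤ 1 u ∧ MemW S 0 ⊤ 2 u) ∧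
      wNorm S 2 ⊤ 0 u + wNorm S 1 ⊤ 1 u + wNorm S 0 ⊤ 2 u ≤ ENNReal.ofReal (10 * N) := by
  have hN : 0 ≤ N := (norm_nonneg _).trans (bU 0 ⟨le_rfl, hS⟩).1
  obtain ⟨w1, v1⟩ := hU.weakDt_ae_eq hS hu
  obtain ⟨w2, v2⟩ := hV.weakDt_ae_eq hS v1
  have meas : ∀ {k : ℝ → L2 a b}, ContinuousOn k (Icc 0 S) →
      AEStronglyMeasurable k (volume.restrict (Ioo 0 S)) := fun hk =>
    (hk.mono Ioo_subset_Icc_self).aestronglyMeasurable measurableSet_Ioo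
  have ae : ∀ {p : ℝ → Prop}, (∀ t ∈ Icc 0 S, p t) → ∀ᵐ t ∂volume.restrict (Ioo 0 S), p t :=
    fun hp => (ae_restrict_iff' measurableSet_Ioo).2
      (ae_of_all _ fun t ht => hp t (Ioo_subset_Icc_self ht))
  have mU := meas hU.continuousOn
  have mV := meas hV.continuousOn
  have U0 := memLpH_top (k := 0) (N := N) hu mU (ae_of_all _ fun _ => trivial)
    (ae fun t ht j hj => by obtain rfl := Nat.le_zero.1 hj; exact (bU t ht).1)
  have V0 := memLpH_top (k := 0) (N := N) v1 mV (ae_of_all _ fun _ => trivial)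
    (ae fun t ht j hj => by obtain rfl := Nat.le_zero.1 hj; exact (bV t ht).1)
  have P0 := memLpH_top (k := 0) (N := N) v2 (meas hP) (ae_of_all _ fun _ => trivial)
    (ae fun t ht j hj => by obtain rfl := Nat.le_zero.1 hj; exact (bV t ht).2.2)
  have U1 := memLpH_top (k := 1) (N := N) hu mU (ae fun t ht => (dxU t ht).memH_one)
    (ae fun t ht j hj => by
      interval_cases j
      · exact (bU t ht).1
      · rw [Function.iterate_one, (dxU t ht).weakDx_eq]
        exact (bU t ht).2)
  have V1 := memLpH_top (k := 1) (N := N) v1 mV (ae fun t ht => (dxV t ht).memH_one)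
    (ae fun t ht j hj => by
      interval_cases j
      · exact (bV t ht).1
      · rw [Function.iterate_one, (dxV t ht).weakDx_eq]
        exact (bV t ht).2.1)
  have U2 := memLpH_top (k := 2) (N := N) hu mU (ae fun t ht => by
      obtain ⟨g, hg, -⟩ := dxx t ht
      rw [memH_succ_iff, (dxU t ht).weakDx_eq]
      exact ⟨dxU t ht, hg.memH_one⟩)
    (ae fun t ht j hj => by
      obtain ⟨g, hg, hgN⟩ := dxx t ht
      interval_cases j
      · exact (bU t ht).1
      · rw [Function.iterate_one, (dxU t ht).weakDx_eq]
        exact (bU t ht).2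
      · rw [Function.iterate_succ_apply', Function.iterate_one, (dxU t ht).weakDx_eq,
          hg.weakDx_eq]
        exact hgN)
  refine ⟨⟨⟨fun i hi => ?_, fun i hi => ?_⟩, ⟨fun i hi => ?_, fun i hi => ?_⟩,
    ⟨fun i hi => absurd hi (Nat.not_lt_zero i), fun i hi => ?_⟩⟩, ?_⟩
  · interval_cases i
    exacts [⟨V, w1⟩, ⟨P, w2⟩]
  · interval_cases i
    exacts [U0.1, V0.1, P0.1]
  · interval_cases i
    exact ⟨V, w1⟩
  · interval_cases i
    exacts [U1.1, V1.1]
  · obtain rfl := Nat.le_zero.1 hi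
    exact U2.1
  -- Each time derivative measured in `H^k` contributes `k + 1`, and `3 · 1 + 2 · 2 + 3 = 10`.
  · simp only [wNorm, Finset.sum_range_succ, Finset.range_zero, Finset.sum_empty, zero_add]
    refine (add_le_add (add_le_add (add_le_add (add_le_add U0.2 V0.2) P0.2)
      (add_le_add U1.2 V1.2)) U2.2).trans_eq ?_
    rw [← ENNReal.ofReal_add, ← ENNReal.ofReal_add, ← ENNReal.ofReal_add, ← ENNReal.ofReal_add,
      ← ENNReal.ofReal_add]
    · congr 1
      push_cast
      ring
    all_goals positivity

/-- Norms of a temperature with bounded derivatives. -/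
theorem memW_temperature {S N : ℝ} (hS : 0 ≤ S) (hS1 : S ≤ 1) {Θ Θt Θx θ : ℝ → L2 a b}
    (hΘ : IsPrim 0 S Θ Θt) (hΘt : ContinuousOn Θt (Icc 0 S))
    (hθ : Θ =ᵐ[volume.restrict (Ioo 0 S)] θ)
    (dxΘ : ∀ᵐ t ∂volume.restrict (Ioo 0 S), HasDx (Θ t) (Θx t) ∧ ‖Θx t‖ ≤ N)
    (bΘ : ∀ t ∈ Icc 0 S, ‖Θ t‖ ≤ N ∧ ‖Θt t‖ ≤ N)
    (hH : ∀ᵐ t ∂volume.restrict (Ioo 0 S), MemH 1 (Θt t))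
    (hL : ∫⁻ t in Ioo 0 S, ‖weakDx (Θt t)‖ₑ ^ 2 ≤ ENNReal.ofReal (N ^ 2)) :
    (MemW S 1 ⊤ 0 θ ∧ MemW S 1 2 1 θ) ∧
      wNorm S 1 ⊤ 0 θ + wNorm S 1 2 1 θ ≤ ENNReal.ofReal (6 * N) := by
  have hN : 0 ≤ N := (norm_nonneg _).trans (bΘ 0 ⟨le_rfl, hS⟩).1
  obtain ⟨w1, v1⟩ := hΘ.weakDt_ae_eq hS hθ
  have meas : ∀ {k : ℝ → L2 a b}, ContinuousOn k (Icc 0 S) →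
      AEStronglyMeasurable k (volume.restrict (Ioo 0 S)) := fun hk =>
    (hk.mono Ioo_subset_Icc_self).aestronglyMeasurable measurableSet_Ioo
  have ae : ∀ {p : ℝ → Prop}, (∀ t ∈ Icc 0 S, p t) → ∀ᵐ t ∂volume.restrict (Ioo 0 S), p t :=
    fun hp => (ae_restrict_iff' measurableSet_Ioo).2
      (ae_of_all _ fun t ht => hp t (Ioo_subset_Icc_self ht))
  have m0 := meas hΘ.continuousOn
  have m1 := meas hΘt
  have A0 := memLpH_top (k := 0) (N := N) hθ m0 (ae_of_all _ fun _ => trivial)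
    (ae fun t ht j hj => by obtain rfl := Nat.le_zero.1 hj; exact (bΘ t ht).1)
  have A1 := memLpH_top (k := 0) (N := N) v1 m1 (ae_of_all _ fun _ => trivial)
    (ae fun t ht j hj => by obtain rfl := Nat.le_zero.1 hj; exact (bΘ t ht).2)
  have B0 := memLpH_two hN hθ m0 (dxΘ.mono fun t ht => ht.1.memH_one)
    (lintegral_sq_le_of_norm_le hS1 (ae fun t ht => (bΘ t ht).1))
    (lintegral_sq_le_of_norm_le hS1 (dxΘ.mono fun t ht => by
      rw [ht.1.weakDx_eq]
      exact ht.2))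
  have B1 := memLpH_two hN v1 m1 hH
    (lintegral_sq_le_of_norm_le hS1 (ae fun t ht => (bΘ t ht).2)) hL
  refine ⟨⟨⟨fun i hi => ?_, fun i hi => ?_⟩, ⟨fun i hi => ?_, fun i hi => ?_⟩⟩, ?_⟩
  · interval_cases i
    exact ⟨Θt, w1⟩
  · interval_cases i
    exacts [A0.1, A1.1]
  · interval_cases i
    exact ⟨Θt, w1⟩
  · interval_cases i
    exacts [B0.1, B1.1]
  · simp only [wNorm, Finset.sum_range_succ, Finset.range_zero, Finset.sum_empty, zero_add]
    refine (add_le_add (add_le_add A0.2 A1.2) (add_le_add B0.2 B1.2)).trans_eq ?_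
    rw [← ENNReal.ofReal_add, ← ENNReal.ofReal_add, ← ENNReal.ofReal_add]
    · congr 1
      push_cast
      ring
    all_goals positivity

end Bounds

/-! ### Choice of the time interval and of the constants. -/

section Main

variable {a b : ℝ} {T ν μ : ℝ} {u₀ u₁ θ₀ : L2 a b} {U Ux V Vx P Px Θ Θt Θtt Θx : ℝ → L2 a b}

/-- The bound of `θ_x` in terms of a bound `r` of `u_tx, θ_t` and a bound `B` of `θ`. -/
def thetaXBd (a b μ r B : ℝ) : ℝ :=
  √(2 * r * B * (1 + μ * embC a b * B) + (μ * embC a b * B * r) ^ 2)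

/-- The norms of a solution are bounded in terms of the data and of
`R = ‖u_tt(0)‖ + ‖u_tx(0)‖ + ‖θ_t(0)‖` on every interval on which `∫ ‖u_tx‖²` is controlled. -/
theorem StrongSol.norms_le (hab : a < b) (hT : 0 < T) (hμ : 0 < μ) (hν : 0 < ν)
    (h : StrongSol T ν μ u₀ u₁ θ₀ U Ux V Vx P Px Θ Θt Θtt Θx) (hP : ContinuousOn P (Icc 0 T))
    {u₀'' : L2 a b} (hu₀ : HasDx (weakDx u₀) u₀'') {S K : ℝ} (hS0 : 0 < S) (hS1 : S ≤ 1)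
    (hST : S ≤ T) (hK : ∫ s in 0..S, ‖Vx s‖ ^ 2 ≤ K) {u θ : ℝ → L2 a b}
    (hu : U =ᵐ[volume.restrict (Ioo 0 S)] u) (hθ : Θ =ᵐ[volume.restrict (Ioo 0 S)] θ) {r X : ℝ}
    (hr : r = √(growBd a b μ θ₀ K) * (‖P 0‖ + ‖Vx 0‖ + ‖Θt 0‖))
    (hX : X = thetaXBd a b μ r (√(thetaBd a b μ θ₀ K))) :
    ((MemW S 2 ⊤ 0 u ∧ MemW S 1 ⊤ 1 u ∧ MemW S 0 ⊤ 2 u) ∧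
      wNorm S 2 ⊤ 0 u + wNorm S 1 ⊤ 1 u + wNorm S 0 ⊤ 2 u ≤ ENNReal.ofReal
        (10 * (‖u₀‖ + ‖weakDx u₀‖ + ‖u₀''‖ + ‖u₁‖ + r + μ * X))) ∧
    ((MemW S 1 ⊤ 0 θ ∧ MemW S 1 2 1 θ) ∧
      wNorm S 1 ⊤ 0 θ + wNorm S 1 2 1 θ ≤ ENNReal.ofReal (6 * (‖θ₀‖ + r + X))) := by
  have hsub : Icc 0 S ⊆ Icc 0 T := Icc_subset_Icc_right hST
  have hG : 0 ≤ growBd a b μ θ₀ K := (Real.exp_pos _).le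
  have hr0 : 0 ≤ r := by rw [hr]; positivity
  have hX0 : 0 ≤ X := by rw [hX]; exact Real.sqrt_nonneg _
  have hE0 : derivEnergy P Vx Θt 0 * growBd a b μ θ₀ K ≤ r ^ 2 := by
    rw [hr, mul_pow, Real.sq_sqrt hG, mul_comm]
    refine mul_le_mul_of_nonneg_left ?_ hG
    unfold derivEnergy
    nlinarith [mul_nonneg (norm_nonneg (P 0)) (norm_nonneg (Vx 0)),
      mul_nonneg (norm_nonneg (P 0)) (norm_nonneg (Θt 0)),
      mul_nonneg (norm_nonneg (Vx 0)) (norm_nonneg (Θt 0))]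
  have hE : ∀ t ∈ Icc 0 S, ‖P t‖ ≤ r ∧ ‖Vx t‖ ≤ r ∧ ‖Θt t‖ ≤ r := by
    intro t ht
    have := (h.derivEnergy_le hab hT hμ hν hP hS0 hS1 hST hK ht).trans hE0
    unfold derivEnergy at this
    have n1 := sq_nonneg ‖P t‖
    have n2 := sq_nonneg ‖Vx t‖
    have n3 := sq_nonneg ‖Θt t‖
    exact ⟨abs_le_of_sq_le_sq' (by linarith) hr0 |>.2, abs_le_of_sq_le_sq' (by linarith) hr0 |>.2,
      abs_le_of_sq_le_sq' (by linarith) hr0 |>.2⟩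
  have pU := h.hU.mono le_rfl hST hS0.le
  have pUx := h.hUx.mono le_rfl hST hS0.le
  have pV := h.hV.mono le_rfl hST hS0.le
  have pΘ := h.hΘ.mono le_rfl hST hS0.le
  have bV : ∀ t ∈ Icc 0 S, ‖V t‖ ≤ ‖u₁‖ + r := fun t ht => by
    rw [← h.initV]
    exact pV.norm_le hS1 (fun s hs => (hE s hs).1) ht
  have bU : ∀ t ∈ Icc 0 S, ‖U t‖ ≤ ‖u₀‖ + (‖u₁‖ + r) := fun t ht => by
    rw [← h.initU]
    exact pU.norm_le hS1 bV ht
  have bUx : ∀ t ∈ Icc 0 S, ‖Ux t‖ ≤ ‖weakDx u₀‖ + r := fun t ht => by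
    rw [← h.Ux_zero hT]
    exact pUx.norm_le hS1 (fun s hs => (hE s hs).2.1) ht
  have bΘ : ∀ t ∈ Icc 0 S, ‖Θ t‖ ≤ ‖θ₀‖ + r := fun t ht => by
    rw [← h.initΘ]
    exact pΘ.norm_le hS1 (fun s hs => (hE s hs).2.2) ht
  have dxΘ : ∀ᵐ t ∂volume.restrict (Ioo 0 S), HasDx (Θ t) (Θx t) ∧ ‖Θx t‖ ≤ X := by
    filter_upwards [ae_restrict_of_ae_restrict_of_subset (Ioo_subset_Ioo_right hST) h.dxΘ,
      ae_restrict_of_ae_restrict_of_subset (Ioo_subset_Ioo_right hST)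
        (h.norm_sq_theta_x_le hab hμ), ae_restrict_mem measurableSet_Ioo] with t h1 h2 htm
    have htS := Ioo_subset_Icc_self htm
    refine ⟨h1, ?_⟩
    rw [hX]
    exact Real.le_sqrt_of_sq_le (h2 r _ (hE t htS).2.2 (hE t htS).2.1
      (Real.le_sqrt_of_sq_le (h.norm_sq_theta_le hab hT hμ hS1 hST hK htS)))
  have hN : ∀ᵐ t ∂volume.restrict (Ioo 0 S), ‖P t + μ • Θx t‖ ≤ r + μ * X := by
    filter_upwards [dxΘ, ae_restrict_mem measurableSet_Ioo] with t h1 htm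
    refine (norm_add_le _ _).trans (add_le_add (hE t (Ioo_subset_Icc_self htm)).1 ?_)
    rw [norm_smul, Real.norm_of_nonneg hμ.le]
    exact mul_le_mul_of_nonneg_left h1.2 hμ.le
  have hμX : 0 ≤ μ * X := mul_nonneg hμ.le hX0
  obtain ⟨hH, hL⟩ := h.lintegral_theta_tx_le hab hT hμ hν hP hS0 hS1 hST hK
  have n1 := norm_nonneg u₀
  have n2 := norm_nonneg (weakDx u₀)
  have n3 := norm_nonneg u₀''
  have n4 := norm_nonneg u₁
  have n5 := norm_nonneg θ₀
  constructor
  · refine memW_displacement hS0.le pU pV (hP.mono hsub) hu (fun t ht => (h.dxU t (hsub ht)).hasDx)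
      (fun t ht => (h.dxV t (hsub ht)).hasDx) (fun t ht => ?_) (fun t ht => ?_) (fun t ht => ?_)
    · obtain ⟨g, hg, hgN⟩ := h.exists_hasDx_Ux hT hν hu₀ hST hN (by positivity) ht
      exact ⟨g, hg, by linarith⟩
    · have := bU t ht
      have := bUx t ht
      constructor <;> linarith
    · have := bV t ht
      obtain ⟨h1, h2, -⟩ := hE t ht
      refine ⟨?_, ?_, ?_⟩ <;> linarith
  · refine memW_temperature hS0.le hS1 pΘ (h.hΘt.continuousOn.mono hsub) hθ
      (dxΘ.mono fun t ht => ⟨ht.1, by linarith [ht.2]⟩) (fun t ht => ?_) hH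
      (hL.trans (ENNReal.ofReal_le_ofReal (hE0.trans ?_)))
    · have := bΘ t ht
      obtain ⟨-, -, h3⟩ := hE t ht
      constructor <;> linarith
    · gcongr
      linarith

/-- The part of the radicand linear in `R` becomes quadratic through `R ≤ R² / c`; without a
positive lower bound of `R` the estimate could not be linear. -/
theorem thetaXBd_le {c r R B g : ℝ} (hab : a < b) (hμ : 0 < μ) (hc : 0 < c) (hB : 0 ≤ B)
    (hg : 0 ≤ g) (hr : r = g * R) (hR : c ≤ R) :
    thetaXBd a b μ r B ≤
      √(2 * g * B * (1 + μ * embC a b * B) / c + (μ * embC a b * B * g) ^ 2) * R := by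
  have he := embC_pos hab
  have hR0 : 0 < R := hc.trans_le hR
  refine Real.sqrt_le_iff.2 ⟨by positivity, ?_⟩
  rw [mul_pow (√_), Real.sq_sqrt (by positivity), hr, add_mul]
  refine add_le_add ?_ (le_of_eq (by ring))
  have h1 : 0 ≤ 2 * g * B * (1 + μ * embC a b * B) := by positivity
  have h2 : R ≤ R ^ 2 / c := by
    rw [le_div_iff₀ hc]
    nlinarith
  calc 2 * (g * R) * B * (1 + μ * embC a b * B)
      = 2 * g * B * (1 + μ * embC a b * B) * R := by ring
    _ ≤ 2 * g * B * (1 + μ * embC a b * B) * (R ^ 2 / c) := by gcongr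
    _ = _ := by ring

/-- A time, depending on the data only, up to which all norms are controlled. -/
theorem exists_time_norms_le (hab : a < b) (hμ : 0 < μ) (hu₀ : MemH 2 u₀) (hu₁ : MemH 2 u₁)
    (hθ₀ : MemH 3 θ₀) (hθ₀_nonneg : 0 ≤ θ₀) :
    ∃ T₀ g B : ℝ, 0 < T₀ ∧ 0 ≤ g ∧ 0 ≤ B ∧ ∀ ν : ℝ, 0 < ν → ∀ T : ℝ, T₀ ≤ T →
      ∀ u θ : ℝ → L2 a b, IsRegularSolution T ν μ u₀ u₁ θ₀ u θ →
      ∃ U Ux V Vx P Px Θ Θt Θtt Θx : ℝ → L2 a b,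
        StrongSol T ν μ u₀ u₁ θ₀ U Ux V Vx P Px Θ Θt Θtt Θx ∧ ContinuousOn P (Icc 0 T) ∧
        P =ᵐ[volume.restrict (Ioo 0 T)] (weakDt T)^[2] u ∧
        Vx =ᵐ[volume.restrict (Ioo 0 T)] (fun t => weakDx (weakDt T u t)) ∧
        Θt =ᵐ[volume.restrict (Ioo 0 T)] weakDt T θ ∧
        ∀ r X : ℝ, r = g * (‖P 0‖ + ‖Vx 0‖ + ‖Θt 0‖) → X = thetaXBd a b μ r B →
        ((MemW T₀ 2 ⊤ 0 u ∧ MemW T₀ 1 ⊤ 1 u ∧ MemW T₀ 0 ⊤ 2 u) ∧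
          wNorm T₀ 2 ⊤ 0 u + wNorm T₀ 1 ⊤ 1 u + wNorm T₀ 0 ⊤ 2 u ≤ ENNReal.ofReal
            (10 * (‖u₀‖ + ‖weakDx u₀‖ + ‖weakDx (weakDx u₀)‖ + ‖u₁‖ + r + μ * X))) ∧
        ((MemW T₀ 1 ⊤ 0 θ ∧ MemW T₀ 1 2 1 θ) ∧
          wNorm T₀ 1 ⊤ 0 θ + wNorm T₀ 1 2 1 θ ≤ ENNReal.ofReal (6 * (‖θ₀‖ + r + X))) := by
  have d0 := memH_one_iff.1 (memH_succ_iff.1 hu₀).2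
  have d1 := memH_one_iff.1 (memH_succ_iff.1 hu₁).2
  have e0 := (memH_succ_iff.1 hθ₀).1
  have e1 := (memH_succ_iff.1 (memH_succ_iff.1 hθ₀).2).1
  set E : ℝ := (‖u₁‖ ^ 2 + ‖weakDx u₀‖ ^ 2) / 2 + inner ℝ θ₀ (oneL2 a b) with hE
  have hE0 : 0 ≤ E := by
    have := inner_oneL2_nonneg hθ₀_nonneg
    positivity
  set q : L2 a b := weakDx (weakDx θ₀) - μ • (e0.memLp_mul hab (weakDx u₁)).toLp _ with hq
  -- A bound of the initial differentiated energy for `ν < 1`, from `u_tt(0) = u₀'' + ν u₁'' - μ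
  -- θ₀'` and `θ_t(0) = q`.
  set M : ℝ := (‖weakDx (weakDx u₀)‖ + ‖weakDx (weakDx u₁)‖ + μ * ‖weakDx θ₀‖) ^ 2
    + ‖weakDx u₁‖ ^ 2 + ‖q‖ ^ 2 with hM
  have hM0 : 0 ≤ M := by positivity
  set G := growBd a b μ θ₀ (1 + E) with hG
  have hG0 : 0 < G := Real.exp_pos _
  -- Chosen so that `T₀ M G ≤ 1 / 2`, as the continuity argument demands; `M + 1` avoids division by
  -- zero.
  set T₀ : ℝ := min 1 (1 / (2 * (M + 1) * G)) with hT₀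
  have hT₀0 : 0 < T₀ := lt_min one_pos (by positivity)
  have hT₀M : T₀ * (M * G) ≤ 1 / 2 := by
    calc T₀ * (M * G) ≤ 1 / (2 * (M + 1) * G) * ((M + 1) * G) := by
          gcongr
          · exact min_le_right _ _
          · linarith
      _ = 1 / 2 := by field_simp
  refine ⟨T₀, √G, √(thetaBd a b μ θ₀ (1 + E)), hT₀0, Real.sqrt_nonneg _, Real.sqrt_nonneg _, ?_⟩
  intro ν hν T hT₀T u θ hreg
  have hT : 0 < T := hT₀0.trans_le hT₀T
  obtain ⟨U, Ux, V, Vx, Px, Θ, Θt, Θtt, h, hUu, hVu, hΘθ, hΘtθ, -⟩ := hreg.exists_strongSol hT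
  obtain ⟨Q, hQ, -, hQP⟩ := h.exists_utt hT
  have h' := h.congr_utt hT hQP
  have hVx : Vx =ᵐ[volume.restrict (Ioo 0 T)] (fun t => weakDx (weakDt T u t)) := by
    filter_upwards [hVu, ae_restrict_mem measurableSet_Ioo] with t h1 htm
    rw [← h1, (h.dxV t (Ioo_subset_Icc_self htm)).hasDx.weakDx_eq]
  have hM' : ν < 1 → derivEnergy Q Vx Θt 0 ≤ M := by
    intro hν1
    unfold derivEnergy
    rw [h'.P_zero hT hQ d0 d1 e0, h'.Vx_zero hT, h'.Θt_zero hab hT e0 e1, hM]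
    gcongr
    refine (norm_sub_le _ _).trans (add_le_add ((norm_add_le _ _).trans (add_le_add le_rfl ?_)) ?_)
    · rw [norm_smul, Real.norm_of_nonneg hν.le]
      exact mul_le_of_le_one_left (norm_nonneg _) hν1.le
    · rw [norm_smul, Real.norm_of_nonneg hμ.le]
  -- `K = 1 + E` serves both regimes: it is at least `1` for small viscosity and at least the energy
  -- `E` for large viscosity.
  have hK := h'.integral_Vx_le hab hT hμ hν hQ (K := 1 + E) (M := M) (S := T₀) (by linarith)
    (by rw [h'.Ux_zero hT]; linarith) hM' hT₀0 (min_le_left _ _) hT₀T hT₀M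
  refine ⟨U, Ux, V, Vx, Q, Px, Θ, Θt, Θtt, _, h', hQ, hQP, hVx, hΘtθ, fun r X hr hX => ?_⟩
  have sub : Ioo 0 T₀ ⊆ Ioo 0 T := Ioo_subset_Ioo_right hT₀T
  exact h'.norms_le hab hT hμ hν hQ d0 hT₀0 (min_le_left _ _) hT₀T hK
    (ae_restrict_of_ae_restrict_of_subset sub hUu) (ae_restrict_of_ae_restrict_of_subset sub hΘθ)
    hr hX

/-- At a stationary state the initial time derivatives vanish. -/
theorem StrongSol.initial_eq_zero (hab : a < b) (hT : 0 < T)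
    (h : StrongSol T ν μ 0 0 θ₀ U Ux V Vx P Px Θ Θt Θtt Θx) (hP : ContinuousOn P (Icc 0 T))
    (hθ₀ : HasDx θ₀ 0) : P 0 = 0 ∧ Vx 0 = 0 ∧ Θt 0 = 0 := by
  have z : HasDx (0 : L2 a b) 0 := (dxGraph a b).zero_mem
  have z' : HasDx (weakDx (0 : L2 a b)) 0 := by rwa [weakDx_zero]
  refine ⟨?_, ?_, ?_⟩
  · simpa using h.P_zero hT hP z' z' hθ₀
  · rw [h.Vx_zero hT, weakDx_zero]
  · rw [h.Θt_zero hab hT hθ₀ z, weakDx_zero]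
    have : (hθ₀.memLp_mul hab (0 : L2 a b)).toLp _ = 0 := by
      refine Lp.ext ((hθ₀.memLp_mul hab (0 : L2 a b)).coeFn_toLp.trans ?_)
      filter_upwards [Lp.coeFn_zero ℝ 2 (volume.restrict (Ioo a b))] with x hx
      rw [hx]
      simp
    rw [this]
    simp

/-- A nonnegative function with zero derivative is zero or a positive constant. -/
theorem HasDx.eq_zero_or_const {f : L2 a b} (h : HasDx f 0) (hab : a < b) (hf : 0 ≤ f) :
    f = 0 ∨ ∃ c : ℝ, 0 < c ∧ ∀ᵐ x ∂volume.restrict (Ioo a b), f x = c := by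
  obtain ⟨c, hc⟩ := h.ae_eq_const_of_zero hab
  have hne : (ae (volume.restrict (Ioo a b))).NeBot := by
    rw [ae_neBot, Ne, Measure.restrict_eq_zero, Real.volume_Ioo]
    simpa using hab
  have hc0 : 0 ≤ c := by
    obtain ⟨x, h1, h2⟩ := (hc.and ((Lp.coeFn_nonneg f).2 hf)).exists
    rw [← h1]
    exact h2
  rcases hc0.eq_or_lt with rfl | hc0
  · refine Or.inl (Lp.ext ?_)
    filter_upwards [hc, Lp.coeFn_zero ℝ 2 (volume.restrict (Ioo a b))] with x h1 h2
    rw [h1, h2]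
    rfl
  · exact Or.inr ⟨c, hc0, hc⟩

end Main

end Thermo

end

/-! ### The theorem. -/

open Thermo in
theorem mainTheorem5 (a b : ℝ) (hab : a < b) (μ : ℝ) (hμ : 0 < μ)
    (u₀ u₁ θ₀ : L2 a b)
    (hu₀ : MemH 2 u₀ ∧ MemH10 u₀) (hu₁ : MemH 2 u₁ ∧ MemH10 u₁)
    (hθ₀ : MemH 3 θ₀) (hθ₀_nonneg : 0 ≤ θ₀) :
    ∃ T₀ : ℝ, 0 < T₀ ∧ ∃ C : ℝ, 0 < C ∧
      ∀ ν : ℝ, 0 < ν → ∀ T : ℝ, T₀ ≤ T → ∀ u θ : ℝ → L2 a b,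
        IsRegularSolution T ν μ u₀ u₁ θ₀ u θ →
        ∃ utt₀ utx₀ θt₀ : L2 a b,
          HasInitialValue T ((weakDt T)^[2] u) utt₀ ∧
          HasInitialValue T (fun t => weakDx (weakDt T u t)) utx₀ ∧
          HasInitialValue T (weakDt T θ) θt₀ ∧
          MemW T₀ 2 ∞ 0 u ∧ MemW T₀ 1 ∞ 1 u ∧ MemW T₀ 0 ∞ 2 u ∧
          MemW T₀ 1 ∞ 0 θ ∧ MemW T₀ 1 2 1 θ ∧
          wNorm T₀ 2 ∞ 0 u + wNorm T₀ 1 ∞ 1 u + wNorm T₀ 0 ∞ 2 u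
            ≤ ENNReal.ofReal (C * (‖utt₀‖ + ‖utx₀‖ + ‖θt₀‖)) ∧
          (¬ (u₀ = 0 ∧ u₁ = 0 ∧
              ∃ c : ℝ, 0 < c ∧ ∀ᵐ x ∂volume.restrict (Ioo a b), θ₀ x = c) →
            wNorm T₀ 1 ∞ 0 θ + wNorm T₀ 1 2 1 θ
              ≤ ENNReal.ofReal (C * (‖utt₀‖ + ‖utx₀‖ + ‖θt₀‖))) := by
  obtain ⟨T₀, g, B, hT₀, hg, hB, key⟩ :=
    exists_time_norms_le hab hμ hu₀.1 hu₁.1 hθ₀ hθ₀_nonneg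
  refine ⟨T₀, hT₀, ?_⟩
  -- The stationary states are split off with `θ₀ = 0` included. For them `R = 0` and the bound of
  -- the displacement is zero, so any `C` works.
  by_cases hne : u₀ = 0 ∧ u₁ = 0 ∧ HasDx θ₀ 0
  · obtain ⟨rfl, rfl, hd⟩ := hne
    refine ⟨1, one_pos, fun ν hν T hT u θ hreg => ?_⟩
    obtain ⟨U, Ux, V, Vx, P, Px, Θ, Θt, Θtt, Θx, h, hP, hPu, hVxu, hΘtθ, hb⟩ :=
      key ν hν T hT u θ hreg
    obtain ⟨⟨⟨m1, m2, m3⟩, b1⟩, ⟨m4, m5⟩, b2⟩ := hb _ _ rfl rfl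
    obtain ⟨z1, z2, z3⟩ := h.initial_eq_zero hab (hT₀.trans_le hT) hP hd
    refine ⟨P 0, Vx 0, Θt 0, ⟨P, hP, hPu, rfl⟩, ⟨Vx, h.hVx.continuousOn, hVxu, rfl⟩,
      ⟨Θt, h.hΘt.continuousOn, hΘtθ, rfl⟩, m1, m2, m3, m4, m5, b1.trans_eq ?_, fun hn => ?_⟩
    · congr 1
      simp [z1, z2, z3, thetaXBd, weakDx_zero]
    -- `θ₀ = 0` is not excluded from the temperature estimate, but there the bound is zero as well.
    · rcases hd.eq_zero_or_const hab hθ₀_nonneg with h0 | h0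
      · refine b2.trans_eq ?_
        congr 1
        simp [z1, z2, z3, thetaXBd, h0]
      · exact absurd ⟨rfl, rfl, h0⟩ hn
  · obtain ⟨c, hc, hR⟩ := exists_pos_le_initial hab hμ hu₀ hu₁ hθ₀ hne
    set D := ‖u₀‖ + ‖weakDx u₀‖ + ‖weakDx (weakDx u₀)‖ + ‖u₁‖ with hD
    set Y := √(2 * g * B * (1 + μ * embC a b * B) / c + (μ * embC a b * B * g) ^ 2) with hY
    have hD0 : 0 ≤ D := by positivity
    have hY0 : 0 ≤ Y := Real.sqrt_nonneg _
    have hn0 := norm_nonneg θ₀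
    -- `R ≥ c` turns a data norm `d` into `d / c * R`; `10` and `6` are the norm counts for
    -- displacement and temperature, and the `1` makes `C` positive.
    refine ⟨1 + 10 * (D / c + g + μ * Y) + 6 * (‖θ₀‖ / c + g + Y), by positivity,
      fun ν hν T hT u θ hreg => ?_⟩
    obtain ⟨U, Ux, V, Vx, P, Px, Θ, Θt, Θtt, Θx, h, hP, hPu, hVxu, hΘtθ, hb⟩ :=
      key ν hν T hT u θ hreg
    obtain ⟨⟨⟨m1, m2, m3⟩, b1⟩, ⟨m4, m5⟩, b2⟩ := hb _ _ rfl rfl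
    have hcR := hR T ν U Ux V Vx P Px Θ Θt Θtt Θx (hT₀.trans_le hT) h hP
    set R := ‖P 0‖ + ‖Vx 0‖ + ‖Θt 0‖
    have hX := thetaXBd_le hab hμ hc hB hg rfl hcR
    rw [← hY] at hX
    set X := thetaXBd a b μ (g * R) B
    have hR0 : 0 < R := hc.trans_le hcR
    have hμX : μ * X ≤ μ * Y * R := by
      rw [mul_assoc]
      exact mul_le_mul_of_nonneg_left hX hμ.le
    have scale : ∀ {d : ℝ}, 0 ≤ d → d ≤ d / c * R := fun {d} hd => by
      rw [div_mul_eq_mul_div, le_div_iff₀ hc]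
      exact mul_le_mul_of_nonneg_left hcR hd
    have s1 := scale hD0
    have s2 := scale hn0
    have p1 : 0 ≤ 10 * (D / c + g + μ * Y) * R := by positivity
    have p2 : 0 ≤ 6 * (‖θ₀‖ / c + g + Y) * R := by positivity
    refine ⟨P 0, Vx 0, Θt 0, ⟨P, hP, hPu, rfl⟩, ⟨Vx, h.hVx.continuousOn, hVxu, rfl⟩,
      ⟨Θt, h.hΘt.continuousOn, hΘtθ, rfl⟩, m1, m2, m3, m4, m5,
      b1.trans (ENNReal.ofReal_le_ofReal ?_), fun _ => b2.trans (ENNReal.ofReal_le_ofReal ?_)⟩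
    · linarith
    · linarith
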